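/- Let $R$ be a commutative Noetherian ring, $M$ an $R$-module, and $(x_a)_{a\in A}$ a family of elements of $R$ indexed by an arbitrary (possibly infinite) set $A$; let $I=(x_a \mid a\in A)$. Let $\Delta(A)$ be the poset of non-empty finite subsets of $A$ ordered by inclusion and $\Delta(A)^+$ the poset of all finite subsets. For a finite subset $\sigma$ put $x_\sigma=\prod_{a\in\sigma}x_a$ and $L_\sigma N=N[1/x_\sigma]$, with unit $N\to L_\sigma N$; $M$ is regarded as a constant coefficient system. The adelic cochain complex of $\Delta(A)$ has $$C^{s}(\Delta(A);L_A,M)=\prod_{\sigma_0}L_{\sigma_0}\prod_{\sigma_1\subsetneq\sigma_0}L_{\sigma_1}\cdots\prod_{\sigma_s\subsetneq\sigma_{s-1}}L_{\sigma_s}M ,\qquad s\ge 0,$$ with differential $\sum_{i=0}^{s+1}(-1)^i\delta_i$, where $\delta_i$ inserts the unit of $L_{\sigma_i}$ in the $i$-th place of the flags $\sigma_0\supsetneq\cdots\supsetneq\sigma_{s+1}$ of non-empty subsets. The adelic cochain complex of $\Delta(A)^+$ is its augmentation $M\to C^0\to C^1\to\cdots$ by the units $M\to L_{\sigma_0}M$,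 with $M$ (the contribution of the empty set) in degree $0$ and $C^s$ in degree $s+1$. Their cohomologies are denoted $H^*_{ad}(\Delta(A);L_A,M)$ and $H^*_{ad}(\Delta(A)^+;L_A,M)$. Then, for all $n\ge 0$, there are isomorphisms of $R$-modules as follows. 1. $H^n_{ad}(\Delta(A)^+;L_A,M)\cong H^n_I(R;M)$, the local cohomology $\varinjlim_t \mathrm{Ext}^n_R(R/I^t,M)$; moreover, for every total order on $A$, it is isomorphic to the $n$-th cohomology of the stable Koszul complex $$M\to\prod_{a}M[1/x_a]\to\prod_{a<b}M[1/(x_ax_b)]\to\cdots$$ (with $M$ in degree $0$). 2. For every total order on $A$, $H^n_{ad}(\Delta(A);L_A,M)\cong \check C^n_{(x_a\mid a\in A)}(R;M)$, the Čech cohomology, i.e. the $n$-th cohomology of $$\prod_{a}M[1/x_a]\to\prod_{a<b}M[1/(x_ax_b)]\to\cdots$$ (with $\prod_a M[1/x_a]$ in degree $0$). 3. Consequently both depend only on the radical of $I$: if $(y_b)_{b\in B}$ is another family in $R$ with $\sqrt{(y_b\mid b\in B)}=\sqrt{I}$, then $H^n_{ad}(\Delta(A)^+;L_A,M)\cong H^n_{ad}(\Delta(B)^+;L_B,M)$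 and $H^n_{ad}(\Delta(A);L_A,M)\cong H^n_{ad}(\Delta(B);L_B,M)$. -/

import Mathlib

open CategoryTheory CategoryTheory.Limits

universe v w u

namespace Adelic

noncomputable section

/-! ### The adelic cochain complex of a poset -/

section General

variable {C : Type w} [Category.{v} C] [Abelian C] [HasProducts.{u} C]
variable {X : Type u} [PartialOrder X]

/-- The part of an `X`-collection of localizations that enters the adelic cochain complex:
additive functors `A_p` for `p ∈ X`, each with a natural transformation `1 ⟶ A_p`. -/
structure Collection (C : Type w) [Category.{v} C] [Abelian C] (X : Type u) where
  loc : X → C ⥤ C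
  additive : ∀ p, (loc p).Additive
  unit : ∀ p, 𝟭 C ⟶ loc p

attribute [instance] Collection.additive

variable (A : Collection C X) (M : Xᵒᵖ ⥤ C)

/-- `tail A M k p = ∏_{q₁ < p} A_{q₁} ∏_{q₂ < q₁} A_{q₂} ⋯ ∏_{q_k < q_{k-1}} A_{q_k} M(q_k)`,
which is `M(p)` for `k = 0`. -/
def tail : ℕ → X → C
  | 0, p => M.obj (Opposite.op p)
  | k + 1, p => ∏ᶜ fun q : {q : X // q < p} => (A.loc q.1).obj (tail k q.1)

/-- The projection of `tail (k + 1) p` to the factor indexed by `q < p`. -/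
def tailProj (k : ℕ) {q p : X} (h : q < p) : tail A M (k + 1) p ⟶ (A.loc q).obj (tail A M k q) :=
  Pi.π (fun q : {q : X // q < p} => (A.loc q.1).obj (tail A M k q.1)) ⟨q, h⟩

/-- The map into the product `tail (k + 1) p` with given components. -/
def tailLift (k : ℕ) {p : X} {Z : C} (f : ∀ q, q < p → (Z ⟶ (A.loc q).obj (tail A M k q))) :
    Z ⟶ tail A M (k + 1) p :=
  Pi.lift (f := fun q : {q : X // q < p} => (A.loc q.1).obj (tail A M k q.1)) fun q => f q.1 q.2

@[simp] lemma tailLift_proj (k : ℕ) {p : X} {Z : C}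
    (f : ∀ q, q < p → (Z ⟶ (A.loc q).obj (tail A M k q))) {q : X} (h : q < p) :
    tailLift A M k f ≫ tailProj A M k h = f q h :=
  Pi.lift_π _ _

@[simp] lemma tailLift_proj_assoc (k : ℕ) {p : X} {Z W : C}
    (f : ∀ q, q < p → (Z ⟶ (A.loc q).obj (tail A M k q))) {q : X} (h : q < p)
    (g : (A.loc q).obj (tail A M k q) ⟶ W) :
    tailLift A M k f ≫ tailProj A M k h ≫ g = f q h ≫ g := by
  rw [← Category.assoc, tailLift_proj]

lemma tail_hom_ext {k : ℕ} {p : X} {Z : C} {f g : Z ⟶ tail A M (k + 1) p}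
    (h : ∀ q (hq : q < p), f ≫ tailProj A M k hq = g ≫ tailProj A M k hq) : f = g :=
  Pi.hom_ext (f := fun q : {q : X // q < p} => (A.loc q.1).obj (tail A M k q.1)) f g
    fun q => h q.1 q.2

/-- For `q < p` the map `tail k p ⟶ tail k q`: the structure map of the coefficient system for
`k = 0`, and the projection onto the factors indexed by elements below `q` otherwise. -/
def tailRes : (k : ℕ) → {q p : X} → (q < p) → (tail A M k p ⟶ tail A M k q)
  | 0, _, _, h => M.map (homOfLE h.le).op
  | k + 1, _, _, h => tailLift A M k fun _ hr => tailProj A M k (hr.trans h)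

/-- The coface `δ_i : tail k p ⟶ tail (k + 1) p` for `0 ≤ i ≤ k`, which corresponds to the
omission of the `i`-th term of a flag below `p` and inserts the unit of `A` at that spot. -/
def tailFace : (k i : ℕ) → (p : X) → (tail A M k p ⟶ tail A M (k + 1) p)
  | k, 0, _ => tailLift A M k fun q hq => tailRes A M k hq ≫ (A.unit q).app (tail A M k q)
  | 0, _ + 1, _ => 0
  | k + 1, i + 1, _ =>
      tailLift A M (k + 1) fun q hq => tailProj A M k hq ≫ (A.loc q).map (tailFace k i q)

/-- The adelic `s`-cochains
`∏_{p₀} A_{p₀} ∏_{p₁ < p₀} A_{p₁} ⋯ ∏_{p_s < p_{s-1}} A_{p_s} M(p_s)`. -/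
def cochains (s : ℕ) : C := ∏ᶜ fun p : X => (A.loc p).obj (tail A M s p)

/-- The projection of the `s`-cochains to the factor of all flags with `p₀ = p`. -/
def cochainsProj (s : ℕ) (p : X) : cochains A M s ⟶ (A.loc p).obj (tail A M s p) :=
  Pi.π (fun p : X => (A.loc p).obj (tail A M s p)) p

/-- The map into the `s`-cochains with given components. -/
def cochainsLift (s : ℕ) {Z : C} (f : ∀ p, Z ⟶ (A.loc p).obj (tail A M s p)) :
    Z ⟶ cochains A M s :=
  Pi.lift (f := fun p : X => (A.loc p).obj (tail A M s p)) f

@[simp] lemma cochainsLift_proj (s : ℕ) {Z : C} (f : ∀ p, Z ⟶ (A.loc p).obj (tail A M s p))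
    (p : X) : cochainsLift A M s f ≫ cochainsProj A M s p = f p :=
  Pi.lift_π _ _

@[simp] lemma cochainsLift_proj_assoc (s : ℕ) {Z W : C}
    (f : ∀ p, Z ⟶ (A.loc p).obj (tail A M s p)) (p : X)
    (g : (A.loc p).obj (tail A M s p) ⟶ W) :
    cochainsLift A M s f ≫ cochainsProj A M s p ≫ g = f p ≫ g := by
  rw [← Category.assoc, cochainsLift_proj]

lemma cochains_hom_ext {s : ℕ} {Z : C} {f g : Z ⟶ cochains A M s}
    (h : ∀ p, f ≫ cochainsProj A M s p = g ≫ cochainsProj A M s p) : f = g :=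
  Pi.hom_ext (f := fun p : X => (A.loc p).obj (tail A M s p)) f g h

/-- The coface `δ_i` from adelic `s`-cochains to adelic `(s + 1)`-cochains
(`0 ≤ i ≤ s + 1`). -/
def face (s : ℕ) : ℕ → (cochains A M s ⟶ cochains A M (s + 1))
  | 0 => cochainsLift A M (s + 1) fun p =>
      tailLift A M s (fun q _ => cochainsProj A M s q) ≫ (A.unit p).app (tail A M (s + 1) p)
  | i + 1 => cochainsLift A M (s + 1) fun p =>
      cochainsProj A M s p ≫ (A.loc p).map (tailFace A M s i p)

/-- The adelic differential `δ = ∑_i (-1)^i δ_i`. -/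
def delta (s : ℕ) : cochains A M s ⟶ cochains A M (s + 1) :=
  ∑ i ∈ Finset.range (s + 2), (-1 : ℤ) ^ i • face A M s i

/-- Auxiliary: the alternating sum of the cofaces below `p`. -/
def tailDelta (k : ℕ) (p : X) : tail A M k p ⟶ tail A M (k + 1) p :=
  ∑ i ∈ Finset.range (k + 1), (-1 : ℤ) ^ i • tailFace A M k i p

lemma delta_proj (s : ℕ) (p : X) : delta A M s ≫ cochainsProj A M (s + 1) p =
    tailLift A M s (fun q _ => cochainsProj A M s q) ≫ (A.unit p).app (tail A M (s + 1) p) -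
      cochainsProj A M s p ≫ (A.loc p).map (tailDelta A M s p) := by
  unfold delta tailDelta
  rw [Finset.sum_range_succ']
  simp only [Preadditive.add_comp, Preadditive.neg_comp, Preadditive.sum_comp, Functor.map_sum, Preadditive.comp_sum,
    Preadditive.zsmul_comp, Preadditive.comp_zsmul, Functor.map_zsmul, face, cochainsLift_proj,
    pow_succ, pow_zero, one_smul, mul_neg, mul_one, neg_smul, Finset.sum_neg_distrib]
  abel

lemma tailDelta_zero_proj {q p : X} (h : q < p) : tailDelta A M 0 p ≫ tailProj A M 0 h =
    tailRes A M 0 h ≫ (A.unit q).app (tail A M 0 q) := by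
  simp [tailDelta, tailFace]

lemma tailDelta_succ_proj (k : ℕ) {q p : X} (h : q < p) :
    tailDelta A M (k + 1) p ≫ tailProj A M (k + 1) h =
      tailRes A M (k + 1) h ≫ (A.unit q).app (tail A M (k + 1) q) -
        tailProj A M k h ≫ (A.loc q).map (tailDelta A M k q) := by
  unfold tailDelta
  rw [Finset.sum_range_succ']
  simp only [Preadditive.add_comp, Preadditive.neg_comp, Preadditive.sum_comp, Functor.map_sum, Preadditive.comp_sum,
    Preadditive.zsmul_comp, Preadditive.comp_zsmul, Functor.map_zsmul, tailFace, tailLift_proj,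
    pow_succ, pow_zero, one_smul, mul_neg, mul_one, neg_smul, Finset.sum_neg_distrib]
  abel

lemma tailRes_comp (k : ℕ) {r q p : X} (h : q < p) (h' : r < q) :
    tailRes A M k h ≫ tailRes A M k h' = tailRes A M k (h'.trans h) := by
  cases k with
  | zero =>
    change M.map _ ≫ M.map _ = M.map _
    rw [← M.map_comp]; rfl
  | succ k =>
    apply tail_hom_ext
    intro s hs
    simp [tailRes]

lemma tailRes_tailDelta (k : ℕ) {q p : X} (h : q < p) :
    tailRes A M k h ≫ tailDelta A M k q = tailDelta A M k p ≫ tailRes A M (k + 1) h := by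
  apply tail_hom_ext
  intro r hr
  cases k with
  | zero =>
    simp only [Category.assoc, tailDelta_zero_proj]
    rw [← Category.assoc, tailRes_comp]
    simp [tailRes, tailDelta_zero_proj]
  | succ k =>
    simp only [Category.assoc, tailDelta_succ_proj, Preadditive.comp_sub]
    rw [← Category.assoc, tailRes_comp]
    simp [tailRes, tailDelta_succ_proj]

lemma tailDelta_comp (k : ℕ) (p : X) : tailDelta A M k p ≫ tailDelta A M (k + 1) p = 0 := by
  induction k generalizing p with
  | zero =>
    apply tail_hom_ext
    intro q hq
    simp only [Category.assoc, tailDelta_succ_proj, Preadditive.comp_sub, zero_comp]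
    rw [← Category.assoc, ← tailRes_tailDelta, ← Category.assoc _ (tailProj A M 0 hq),
      tailDelta_zero_proj]
    have := (A.unit q).naturality (tailDelta A M 0 q)
    simp only [Functor.id_obj, Functor.id_map] at this
    simp [this]
  | succ k ih =>
    apply tail_hom_ext
    intro q hq
    simp only [Category.assoc, tailDelta_succ_proj A M (k + 1), Preadditive.comp_sub, zero_comp]
    rw [← Category.assoc, ← tailRes_tailDelta, ← Category.assoc _ (tailProj A M (k + 1) hq),
      tailDelta_succ_proj]
    have := (A.unit q).naturality (tailDelta A M (k + 1) q)
    simp only [Functor.id_obj, Functor.id_map] at this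
    simp [this, Preadditive.sub_comp, ← Functor.map_comp, ih]

lemma tailLift_tailDelta (s : ℕ) (p : X) :
    tailLift A M s (p := p) (fun q _ => cochainsProj A M s q) ≫ tailDelta A M (s + 1) p =
      delta A M s ≫ tailLift A M (s + 1) (fun q _ => cochainsProj A M (s + 1) q) := by
  apply tail_hom_ext
  intro q hq
  simp only [Category.assoc, tailDelta_succ_proj, tailLift_proj, Preadditive.comp_sub, delta_proj,
    tailLift_proj_assoc]
  congr 1
  rw [← Category.assoc]
  congr 1
  apply tail_hom_ext
  intro r hr
  simp [tailRes]

lemma delta_comp (s : ℕ) : delta A M s ≫ delta A M (s + 1) = 0 := by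
  apply cochains_hom_ext
  intro p
  simp only [Category.assoc, delta_proj A M (s + 1), Preadditive.comp_sub, zero_comp]
  rw [← Category.assoc, ← tailLift_tailDelta, ← Category.assoc _ (cochainsProj A M (s + 1) p),
    delta_proj]
  have := (A.unit p).naturality (tailDelta A M (s + 1) p)
  simp only [Functor.id_obj, Functor.id_map] at this
  simp [this, Preadditive.sub_comp, ← Functor.map_comp, tailDelta_comp]

/-- The adelic cochain complex `C^*(X; A, M)`. -/
def complex : CochainComplex C ℕ :=
  CochainComplex.of (cochains A M) (delta A M) (delta_comp A M)

/-- The constant coefficient system. -/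
abbrev const (X : Type u) [PartialOrder X] (N : C) : Xᵒᵖ ⥤ C := (Functor.const Xᵒᵖ).obj N

/-- The map `N ⟶ ∏_p A_p N` given by the units. -/
def augmentation (N : C) : N ⟶ cochains A (const X N) 0 :=
  cochainsLift A (const X N) 0 fun p => (A.unit p).app N

lemma augmentation_proj (N : C) (p : X) :
    augmentation A N ≫ cochainsProj A (const X N) 0 p = (A.unit p).app N :=
  cochainsLift_proj A (const X N) 0 (fun p => (A.unit p).app N) p

lemma augmentation_tail (N : C) (p : X) :
    augmentation A N ≫ tailLift A (const X N) 0 (p := p)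
      (fun q _ => cochainsProj A (const X N) 0 q) = tailDelta A (const X N) 0 p := by
  apply tail_hom_ext
  intro q hq
  rw [Category.assoc, tailLift_proj, augmentation_proj]
  refine Eq.trans ?_ (tailDelta_zero_proj A (const X N) hq).symm
  exact (Category.id_comp _).symm

lemma augmentation_delta (N : C) : augmentation A N ≫ delta A (const X N) 0 = 0 := by
  apply cochains_hom_ext
  intro p
  simp only [Category.assoc, delta_proj, Preadditive.comp_sub, zero_comp]
  rw [sub_eq_zero, ← Category.assoc, ← Category.assoc]
  refine (congrArg (· ≫ _) (augmentation_tail A N p)).trans ?_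
  refine Eq.trans ?_ (congrArg (· ≫ _) (augmentation_proj A N p)).symm
  exact (A.unit p).naturality (tailDelta A (const X N) 0 p)

/-- The augmented adelic cochain complex
`N ⟶ ∏_{p₀} A_{p₀} N ⟶ ∏_{p₀} A_{p₀} ∏_{p₁ < p₀} A_{p₁} N ⟶ ⋯`
of a constant coefficient system, in which the empty flag contributes `N` in degree `0` and the
`s`-cochains are in degree `s + 1`. -/
def augmentedComplex (N : C) : CochainComplex C ℕ :=
  (complex A (const X N)).augment (augmentation A N) (by
    have : (complex A (const X N)).d 0 1 = delta A (const X N) 0 :=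
      CochainComplex.of_d (cochains A (const X N)) (delta A (const X N)) 0
    rw [this]
    exact augmentation_delta A N)

end General

/-! ### Simplicial cochains on the full simplex -/

section Simplicial

variable {C : Type w} [Category.{v} C] [Abelian C] [HasProducts.{u} C]
variable {A : Type u} [LinearOrder A]

set_option linter.unusedSectionVars false

/-- The set of vertices of an ordered simplex `a_0 < ⋯ < a_{n-1}`. -/
def vertices {n : ℕ} (f : Fin n ↪o A) : Finset A := Finset.univ.map f.toEmbedding

/-- The ordered simplex obtained by omitting the `i`-th vertex. -/
def omitVertex {n : ℕ} (f : Fin (n + 1) ↪o A) (i : Fin (n + 1)) : Fin n ↪o A :=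
  (Fin.succAboveOrderEmb i).trans f

lemma vertices_omit_le {n : ℕ} (f : Fin (n + 1) ↪o A) (i : Fin (n + 1)) :
    vertices (omitVertex f i) ≤ vertices f := by
  intro a
  simp only [vertices, omitVertex, Finset.mem_map, Finset.mem_univ, true_and]
  rintro ⟨j, rfl⟩
  exact ⟨i.succAbove j, rfl⟩

variable (N : Finset A ⥤ C)

/-- The product of the `N(σ)` over the subsets `σ` of `A` with `n` elements. -/
def simpCochains (n : ℕ) : C := ∏ᶜ fun f : Fin n ↪o A => N.obj (vertices f)

/-- The projection to the factor of the simplex `g`. -/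
def simpProj {n : ℕ} (g : Fin n ↪o A) : simpCochains N n ⟶ N.obj (vertices g) :=
  Pi.π (fun f : Fin n ↪o A => N.obj (vertices f)) g

/-- The map into the simplicial cochains with given components. -/
def simpLift {n : ℕ} {Z : C} (a : ∀ f : Fin n ↪o A, Z ⟶ N.obj (vertices f)) :
    Z ⟶ simpCochains N n :=
  Pi.lift (f := fun f : Fin n ↪o A => N.obj (vertices f)) a

lemma simpLift_proj {n : ℕ} {Z : C} (a : ∀ f : Fin n ↪o A, Z ⟶ N.obj (vertices f))
    (f : Fin n ↪o A) : simpLift N a ≫ simpProj N f = a f :=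
  Pi.lift_π _ _

lemma simp_hom_ext {n : ℕ} {Z : C} {a b : Z ⟶ simpCochains N n}
    (h : ∀ f, a ≫ simpProj N f = b ≫ simpProj N f) : a = b :=
  Pi.hom_ext (f := fun f : Fin n ↪o A => N.obj (vertices f)) a b h

/-- The simplicial coboundary `∑_i (-1)^i δ_i`, with `δ_i` induced by the omission of the `i`-th
vertex. -/
def simpDelta (n : ℕ) : simpCochains N n ⟶ simpCochains N (n + 1) :=
  simpLift N fun f => ∑ i : Fin (n + 1), (-1 : ℤ) ^ (i : ℕ) •
    (simpProj N (omitVertex f i) ≫ N.map (homOfLE (vertices_omit_le f i)))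

/-- Auxiliary: the projection to the factor of `g` followed by a structure map of `N`. -/
def simpTerm {n m : ℕ} (g : Fin n ↪o A) (f : Fin m ↪o A) (h : vertices g ≤ vertices f) :
    simpCochains N n ⟶ N.obj (vertices f) :=
  simpProj N g ≫ N.map (homOfLE h)

lemma simpTerm_congr {n m : ℕ} {g g' : Fin n ↪o A} (f : Fin m ↪o A) (e : g = g')
    (h : vertices g ≤ vertices f) (h' : vertices g' ≤ vertices f) :
    simpTerm N g f h = simpTerm N g' f h' := by
  subst e; rfl

lemma omit_omit {n : ℕ} (f : Fin (n + 2) ↪o A) (i : Fin (n + 2)) (j : Fin (n + 1))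
    (h : (j : ℕ) < i) :
    omitVertex (omitVertex f i) j = omitVertex (omitVertex f j.castSucc) (i.pred (by
      rintro rfl; simp at h)) := by
  apply RelEmbedding.ext
  intro k
  apply congrArg f
  apply Fin.ext
  change (i.succAbove (j.succAbove k) : ℕ) = (j.castSucc.succAbove ((i.pred _).succAbove k) : ℕ)
  simp only [Fin.succAbove, Fin.lt_def, Fin.val_castSucc, Fin.val_pred]
  split_ifs <;> simp_all <;> omega

lemma simpDelta_comp (n : ℕ) : simpDelta N n ≫ simpDelta N (n + 1) = 0 := by
  apply simp_hom_ext
  intro f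
  have key : (simpDelta N n ≫ simpDelta N (n + 1)) ≫ simpProj N f =
      ∑ ij : Fin (n + 2) × Fin (n + 1), (-1 : ℤ) ^ ((ij.1 : ℕ) + (ij.2 : ℕ)) •
        simpTerm N (omitVertex (omitVertex f ij.1) ij.2) f
          ((vertices_omit_le _ _).trans (vertices_omit_le _ _)) := by
    rw [Fintype.sum_prod_type, Category.assoc]
    conv_lhs => rw [simpDelta, simpDelta, simpLift_proj]
    rw [Preadditive.comp_sum]
    refine Finset.sum_congr rfl fun i _ => ?_
    rw [Preadditive.comp_zsmul, ← Category.assoc, simpLift_proj, Preadditive.sum_comp,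
      Finset.smul_sum]
    refine Finset.sum_congr rfl fun j _ => ?_
    rw [Preadditive.zsmul_comp, smul_smul, ← pow_add, Category.assoc, ← N.map_comp]
    rfl
  rw [key, zero_comp]
  have hi : ∀ {i : Fin (n + 2)} {j : Fin (n + 1)}, (j : ℕ) < i → i ≠ 0 := by
    rintro i j h rfl; simp at h
  refine Finset.sum_involution
    (fun ij _ => if h : (ij.2 : ℕ) < ij.1 then (ij.2.castSucc, ij.1.pred (hi h))
      else (ij.2.succ, ij.1.castLT (by have := ij.2.2; omega))) ?_ ?_ ?_ ?_
  · rintro ⟨i, j⟩ _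
    by_cases h : (j : ℕ) < i
    · simp only [h, dite_true]
      rw [simpTerm_congr N f (omit_omit f i j h) _
        ((vertices_omit_le _ _).trans (vertices_omit_le _ _)), ← add_smul]
      obtain ⟨i, rfl⟩ := Fin.exists_succ_eq.2 (hi h)
      simp only [Fin.val_succ, Fin.val_castSucc, Fin.pred_succ, pow_add, pow_one]
      convert zero_smul ℤ _ using 2
      ring
    · simp only [h, dite_false]
      have h' : ((i.castLT (by have := j.2; omega) : Fin (n + 1)) : ℕ) < j.succ := by
        simp; omega
      rw [simpTerm_congr N f (omit_omit f j.succ _ h') _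
        ((vertices_omit_le _ _).trans (vertices_omit_le _ _))]
      simp only [Fin.castSucc_castLT, Fin.pred_succ, Fin.val_succ, Fin.val_castLT]
      rw [← add_smul]
      convert zero_smul ℤ _ using 2
      ring
  · rintro ⟨i, j⟩ _ _ e
    have e1 := congrArg (fun z : Fin (n + 2) × Fin (n + 1) => (z.1 : ℕ)) e
    by_cases h : (j : ℕ) < i
    · simp [h] at e1; omega
    · simp [h] at e1; omega
  · intros; exact Finset.mem_univ _
  · rintro ⟨i, j⟩ _
    by_cases h : (j : ℕ) < i
    · have h' : ¬ ((i.pred (hi h) : ℕ) < (j.castSucc : ℕ)) := by simp; omega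
      simp only [h, dite_true, h', dite_false]
      simp
    · have h' : ((i.castLT (by have := j.2; omega) : Fin (n + 1)) : ℕ) < j.succ := by
        simp; omega
      simp only [h, dite_false, h', dite_true]
      simp

/-- The simplicial cochain complex of the full simplex on `A` together with its empty face, with
coefficients in a functor `N` on all finite subsets of `A`: the product of the `N(σ)` over the
subsets `σ` with `n` elements is in degree `n`. -/
def augmentedSimplicialComplex : CochainComplex C ℕ :=
  CochainComplex.of (simpCochains N) (simpDelta N) (simpDelta_comp N)

/-- The simplicial cochain complex of the full simplex on `A`, the simplices of which are the
non-empty finite subsets of `A`: the product of the `N(σ)` over the subsets `σ` with `n + 1`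
elements is in degree `n`. -/
def simplicialComplex : CochainComplex C ℕ :=
  CochainComplex.truncate.obj (augmentedSimplicialComplex N)

end Simplicial

/-! ### Localization away from a family of elements -/

section Away

variable {R : Type u} [CommRing R]

/-- The functor `N ↦ N[1/r]` on `R`-modules. -/
def away (r : R) : ModuleCat.{u} R ⥤ ModuleCat.{u} R where
  obj N := ModuleCat.of R (LocalizedModule (Submonoid.powers r) N)
  map {N N'} f := ModuleCat.ofHom
    (IsLocalizedModule.map (Submonoid.powers r) (LocalizedModule.mkLinearMap _ N)
      (LocalizedModule.mkLinearMap _ N') f.hom)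
  map_id N := by
    ext : 1
    exact IsLocalizedModule.map_id _ _
  map_comp {N N' N''} f g := by
    ext : 1
    exact IsLocalizedModule.map_comp' _ _ (LocalizedModule.mkLinearMap _ N') _ _ _

instance (r : R) : (away r).Additive where
  map_add {N N' f g} := by
    ext : 1
    exact map_add (IsLocalizedModule.map (Submonoid.powers r) _ _) f.hom g.hom

/-- The canonical map `N ⟶ N[1/r]`. -/
def awayUnit (r : R) : 𝟭 (ModuleCat.{u} R) ⟶ away r where
  app N := ModuleCat.ofHom (LocalizedModule.mkLinearMap (Submonoid.powers r) N)
  naturality {N N'} f := by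
    ext : 1
    exact (IsLocalizedModule.map_comp (Submonoid.powers r) (LocalizedModule.mkLinearMap _ N)
      (LocalizedModule.mkLinearMap _ N') f.hom).symm

lemma isUnit_of_dvd {r r' : R} (h : r ∣ r') (N : Type u) [AddCommGroup N] [Module R N]
    (s : Submonoid.powers r) : IsUnit (algebraMap R
      (Module.End R (LocalizedModule (Submonoid.powers r') N)) s) := by
  obtain ⟨s, k, rfl⟩ := s
  have := IsLocalizedModule.map_units (LocalizedModule.mkLinearMap (Submonoid.powers r') N)
    (⟨r' ^ k, k, rfl⟩ : Submonoid.powers r')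
  obtain ⟨c, hc⟩ := pow_dvd_pow_of_dvd h k
  change IsUnit (algebraMap R (Module.End R _) (r' ^ k)) at this
  rw [hc, map_mul] at this
  exact ((Commute.isUnit_mul_iff (Algebra.commutes _ _)).1 this).1

/-- The canonical map `N[1/r] ⟶ N[1/r']` for `r ∣ r'`. -/
def awayMap {r r' : R} (h : r ∣ r') (N : ModuleCat.{u} R) : (away r).obj N ⟶ (away r').obj N :=
  ModuleCat.ofHom (LocalizedModule.lift (Submonoid.powers r)
    (LocalizedModule.mkLinearMap (Submonoid.powers r') N) (isUnit_of_dvd h N))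

lemma unit_awayMap {r r' : R} (h : r ∣ r') (N : ModuleCat.{u} R) :
    (awayUnit r).app N ≫ awayMap h N = (awayUnit r').app N := by
  ext : 1
  exact LocalizedModule.lift_comp _ _ _

lemma awayMap_ext {r r' : R} (h : r ∣ r') (N : ModuleCat.{u} R)
    {f g : (away r).obj N ⟶ (away r').obj N}
    (e : (awayUnit r).app N ≫ f = (awayUnit r).app N ≫ g) : f = g := by
  ext : 1
  exact IsLocalizedModule.ext (Submonoid.powers r) (LocalizedModule.mkLinearMap _ N)
    (isUnit_of_dvd h N) (congrArg ModuleCat.Hom.hom e)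

variable {A : Type u} (x : A → R)

/-- The poset `Δ(A)` of non-empty finite subsets of `A`, ordered by inclusion. -/
abbrev Simplex (A : Type u) : Type u := {σ : Finset A // σ.Nonempty}

/-- The localizations `L_σ N = N[1/x_σ]`, `x_σ = ∏_{a ∈ σ} x_a`, for `σ ∈ Δ(A)`. -/
def localizations : Collection (ModuleCat.{u} R) (Simplex A) where
  loc σ := away (∏ a ∈ σ.1, x a)
  additive _ := inferInstance
  unit σ := awayUnit (∏ a ∈ σ.1, x a)

/-- The functor `σ ↦ M[1/x_σ]` on all finite subsets of `A`. -/
def localizationSystem (M : ModuleCat.{u} R) : Finset A ⥤ ModuleCat.{u} R where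
  obj σ := (away (∏ a ∈ σ, x a)).obj M
  map f := awayMap (Finset.prod_dvd_prod_of_subset _ _ _ (leOfHom f)) M
  map_id σ := by
    apply awayMap_ext dvd_rfl
    rw [unit_awayMap, Category.comp_id]
  map_comp {σ τ ρ} f g := by
    apply awayMap_ext (Finset.prod_dvd_prod_of_subset _ _ _ (leOfHom (f ≫ g)))
    rw [unit_awayMap, ← Category.assoc, unit_awayMap, unit_awayMap]

variable (M : ModuleCat.{u} R) (n : ℕ)

/-- The adelic cohomology `H^n_ad(Δ(A); L_A, M)`. -/
def adelicCohomology : ModuleCat.{u} R :=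
  (complex (localizations x) (const (Simplex A) M)).homology n

/-- The adelic cohomology `H^n_ad(Δ(A)⁺; L_A, M)`, where `Δ(A)⁺` includes the empty set. -/
def augmentedAdelicCohomology : ModuleCat.{u} R :=
  (augmentedComplex (localizations x) M).homology n

/-- The cohomology of the stable Koszul complex
`M ⟶ ∏_a M[1/x_a] ⟶ ∏_{a < b} M[1/(x_a x_b)] ⟶ ⋯`, where `M` in degree `0` is written as
`M[1/x_∅]` with `x_∅ = 1`. -/
def stableKoszulCohomology [LinearOrder A] : ModuleCat.{u} R :=
  (augmentedSimplicialComplex (localizationSystem x M)).homology n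

/-- The Čech cohomology, which is the cohomology of the complex
`∏_a M[1/x_a] ⟶ ∏_{a < b} M[1/(x_a x_b)] ⟶ ⋯`. -/
def cechCohomology [LinearOrder A] : ModuleCat.{u} R :=
  (simplicialComplex (localizationSystem x M)).homology n

end Away

end

end Adelic

/-! Both kinds of complexes are instances of one construction. Let P be a poset whose elements p
carry finite supports `w p` in A. `localizationChains` sends M to the cochains on chains of P with
values in M[1/x_σ], where σ is the union of the supports along the chain. For P = A totally ordered
with singletons as supports this is the stable Koszul complex. For P = Δ(A) with the reversed order
it is the augmented adelic complex: a finite set σ_0 has only finitely many subsets, localization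
commutes with finite products, and each x_{σ_i} divides x_{σ_0}, so the nested localizations
collapse to a product of copies of M[1/x_{σ_0}] over flags (`isLocalizedModule_tailEval`,
`bijective_cochainsToFlags`). Dropping the empty chain gives the Čech complex and the unaugmented
adelic complex.

The construction is exact in M. If some x_a acts invertibly on M, the complex is acyclic
(`ChainContraction.isZero_homology`); if M is I-torsion, it is concentrated in degree 0. Over a
Noetherian ring the torsion submodule Γ_I E of an injective E is injective by Artin-Rees, so E is a
retract of the sum of Γ_I E and finitely many E[1/x_a] (`isZero_obj_of_injective`), and its
cohomology vanishes in positive degrees. Hence dimension shifting recovers the cohomology from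
degree 0 (`DimensionShift.nonempty_iso`), where it is Γ_I, which depends only on the radical of I.
The colimit of the Ext^n(R/I^t, -) has the same two properties, whence the comparison with local
cohomology.

Without the empty chain, degree 0 is a left exact functor whose value on an injective E is E/Γ_I E.
A left exact functor is determined by its restriction to injectives (`nonempty_iso_of_injective`),
and dimension shifting applies again. -/

namespace Adelic

noncomputable section

/-! ### Cochains on the chains of a poset. -/

section Chains

variable {P : Type u} [PartialOrder P] {A : Type u} (w : P → Finset A)

/-- The chain obtained by omitting the `i`-th element. -/
def chainOmit {n : ℕ} (f : Fin (n + 1) ↪o P) (i : Fin (n + 1)) : Fin n ↪o P :=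
  (Fin.succAboveOrderEmb i).trans f

@[simp] lemma chainOmit_apply {n : ℕ} (f : Fin (n + 1) ↪o P) (i : Fin (n + 1)) (j : Fin n) :
    chainOmit f i j = f (i.succAbove j) := rfl

open Classical in
/-- The union of the supports `w p` of the elements `p` of a chain. -/
def chainSupport {n : ℕ} (f : Fin n ↪o P) : Finset A := Finset.univ.biUnion fun i => w (f i)

@[simp] lemma mem_chainSupport {n : ℕ} (f : Fin n ↪o P) (a : A) :
    a ∈ chainSupport w f ↔ ∃ i, a ∈ w (f i) := by
  simp [chainSupport]

lemma chainSupport_omit_le {n : ℕ} (f : Fin (n + 1) ↪o P) (i : Fin (n + 1)) :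
    chainSupport w (chainOmit f i) ≤ chainSupport w f := by
  intro a
  simp only [mem_chainSupport]
  rintro ⟨j, h⟩
  exact ⟨_, h⟩

/-- These are the two orders of omitting the same two members: the `j`-th member that is left after
`i` was at position `i.succAbove j` before. -/
lemma chainOmit_omit {n : ℕ} (f : Fin (n + 2) ↪o P) (i : Fin (n + 2)) (j : Fin (n + 1)) :
    chainOmit (chainOmit f (i.succAbove j)) (j.predAbove i) = chainOmit (chainOmit f i) j := by
  ext k
  simp [Fin.succAbove_succAbove_succAbove_predAbove]

variable {R : Type u} [CommRing R] (N : Finset A ⥤ ModuleCat.{u} R)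

/-- The structure map of `N` for an inclusion, as a linear map. -/
def resMap {σ τ : Finset A} (h : σ ≤ τ) : N.obj σ →ₗ[R] N.obj τ := (N.map (homOfLE h)).hom

lemma resMap_resMap {σ τ ρ : Finset A} (h : σ ≤ τ) (h' : τ ≤ ρ) (m : N.obj σ) :
    resMap N h' (resMap N h m) = resMap N (h.trans h') m := by
  change (N.map (homOfLE h) ≫ N.map (homOfLE h')).hom m = _
  rw [← N.map_comp]
  rfl

lemma resMap_rfl {σ : Finset A} (m : N.obj σ) : resMap N le_rfl m = m := by
  change (N.map (𝟙 σ)).hom m = m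
  rw [N.map_id]
  rfl

/-- Cochains on chains of length `n`. -/
abbrev ChainCochain (n : ℕ) : Type u := ∀ f : Fin n ↪o P, N.obj (chainSupport w f)

variable {w N} in
/-- The value of a cochain at `g`, moved to a larger support. -/
def chainTerm {n : ℕ} (c : ChainCochain w N n) (g : Fin n ↪o P) {τ : Finset A}
    (h : chainSupport w g ≤ τ) : N.obj τ := resMap N h (c g)

variable {w N} in
lemma chainTerm_congr {n : ℕ} (c : ChainCochain w N n) {g g' : Fin n ↪o P} (e : g = g')
    {τ : Finset A} (h : chainSupport w g ≤ τ) :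
    chainTerm c g h = chainTerm c g' (e ▸ h) := by
  subst e; rfl

/-- The coboundary `∑_i (-1)^i δ_i` of chain cochains. -/
def chainDelta (n : ℕ) : ChainCochain w N n →ₗ[R] ChainCochain w N (n + 1) :=
  LinearMap.pi fun f => ∑ i : Fin (n + 1), (-1 : ℤ) ^ (i : ℕ) •
    (resMap N (chainSupport_omit_le w f i) ∘ₗ LinearMap.proj (chainOmit f i))

lemma chainDelta_apply {n : ℕ} (c : ChainCochain w N n) (f : Fin (n + 1) ↪o P) :
    chainDelta w N n c f = ∑ i : Fin (n + 1), (-1 : ℤ) ^ (i : ℕ) •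
      chainTerm c (chainOmit f i) (chainSupport_omit_le w f i) := by
  simp [chainDelta, chainTerm]

/-- Exchanging the order of two omissions shifts exactly one of the two indices by one, so the
corresponding terms of the squared coboundary cancel. -/
lemma neg_one_pow_succAbove_predAbove {n : ℕ} (i : Fin (n + 2)) (j : Fin (n + 1)) :
    (-1 : ℤ) ^ ((i.succAbove j : ℕ) + (j.predAbove i : ℕ)) = -(-1) ^ ((i : ℕ) + (j : ℕ)) := by
  rcases lt_or_ge j.castSucc i with h | h
  · rw [Fin.succAbove_of_castSucc_lt _ _ h, Fin.predAbove_of_castSucc_lt _ _ h]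
    obtain ⟨i, rfl⟩ := Fin.exists_succ_eq.2 (Fin.ne_zero_of_lt h)
    simp only [Fin.pred_succ, Fin.val_castSucc, Fin.val_succ]
    ring
  · rw [Fin.succAbove_of_le_castSucc _ _ h, Fin.predAbove_of_le_castSucc _ _ h]
    simp only [Fin.coe_castPred, Fin.val_succ]
    ring

lemma chainDelta_chainDelta {n : ℕ} (c : ChainCochain w N n) :
    chainDelta w N (n + 1) (chainDelta w N n c) = 0 := by
  funext f
  have key : chainDelta w N (n + 1) (chainDelta w N n c) f =
      ∑ ij : Fin (n + 2) × Fin (n + 1), (-1 : ℤ) ^ ((ij.1 : ℕ) + (ij.2 : ℕ)) •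
        chainTerm c (chainOmit (chainOmit f ij.1) ij.2)
          ((chainSupport_omit_le w _ _).trans (chainSupport_omit_le w _ _)) := by
    rw [Fintype.sum_prod_type, chainDelta_apply]
    refine Finset.sum_congr rfl fun i _ => ?_
    rw [chainTerm, chainDelta_apply, map_sum, Finset.smul_sum]
    refine Finset.sum_congr rfl fun j _ => ?_
    rw [map_zsmul, smul_smul, ← pow_add, chainTerm, resMap_resMap]
    rfl
  rw [key]
  refine Finset.sum_involution
    (fun ij _ => (ij.1.succAbove ij.2, ij.2.predAbove ij.1)) ?_ ?_ ?_ ?_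
  · rintro ⟨i, j⟩ _
    dsimp only
    rw [chainTerm_congr c (chainOmit_omit f i j), neg_one_pow_succAbove_predAbove, neg_smul]
    exact add_neg_cancel _
  · rintro ⟨i, j⟩ _ _ e
    exact Fin.succAbove_ne i j (congrArg Prod.fst e)
  · intros; exact Finset.mem_univ _
  · rintro ⟨i, j⟩ _
    ext1
    · exact Fin.succAbove_succAbove_predAbove i j
    · exact Fin.predAbove_predAbove_succAbove i j

/-- The cochain complex of the chains of `P` with coefficients in `N`; chains of length `n` are in
degree `n`. -/
def chainComplexObj : CochainComplex (ModuleCat.{u} R) ℕ :=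
  CochainComplex.of (fun n => ModuleCat.of R (ChainCochain w N n))
    (fun n => ModuleCat.ofHom (chainDelta w N n)) fun n => by
      ext c : 2
      exact chainDelta_chainDelta w N c

lemma chainComplexObj_d (n : ℕ) :
    (chainComplexObj w N).d n (n + 1) = ModuleCat.ofHom (chainDelta w N n) :=
  CochainComplex.of_d (fun n => ModuleCat.of R (ChainCochain w N n))
    (fun n => ModuleCat.ofHom (chainDelta w N n)) n

variable {N} {N' : Finset A ⥤ ModuleCat.{u} R}

/-- The map on cochains induced by a map of coefficients. -/
def chainCochainMap (α : N ⟶ N') (n : ℕ) : ChainCochain w N n →ₗ[R] ChainCochain w N' n :=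
  LinearMap.pi fun f => (α.app (chainSupport w f)).hom ∘ₗ LinearMap.proj f

lemma resMap_app (α : N ⟶ N') {σ τ : Finset A} (h : σ ≤ τ) (m : N.obj σ) :
    (α.app τ).hom (resMap N h m) = resMap N' h ((α.app σ).hom m) := by
  change (N.map (homOfLE h) ≫ α.app τ).hom m = (α.app σ ≫ N'.map (homOfLE h)).hom m
  rw [α.naturality]

lemma chainDelta_chainCochainMap (α : N ⟶ N') {n : ℕ} (c : ChainCochain w N n) :
    chainDelta w N' n (chainCochainMap w α n c) =
      chainCochainMap w α (n + 1) (chainDelta w N n c) := by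
  funext f
  change _ = (α.app _).hom (chainDelta w N n c f)
  rw [chainDelta_apply, chainDelta_apply, map_sum]
  refine Finset.sum_congr rfl fun i _ => ?_
  rw [map_zsmul, chainTerm, chainTerm, resMap_app]
  rfl

/-- The cochain complex of chains as a functor of the coefficients. -/
def chainComplexFunctor : (Finset A ⥤ ModuleCat.{u} R) ⥤ CochainComplex (ModuleCat.{u} R) ℕ where
  obj N := chainComplexObj w N
  map α :=
    { f := fun n => ModuleCat.ofHom (chainCochainMap w α n)
      comm' := by
        rintro i j ⟨rfl⟩
        rw [chainComplexObj_d, chainComplexObj_d]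
        ext c
        exact chainDelta_chainCochainMap w α c }
  map_id N := by
    ext n c
    rfl
  map_comp α β := by
    ext n c
    rfl

instance : (chainComplexFunctor (R := R) w).Additive where
  map_add {N N' α β} := by
    ext n c
    rfl

end Chains

/-! ### Functoriality of the localizations in the module. -/

section LocalizationFunctor

variable {R : Type u} [CommRing R] {A : Type u} (x : A → R)

lemma unit_away_map (r : R) {N N' : ModuleCat.{u} R} (g : N ⟶ N') :
    (awayUnit r).app N ≫ (away r).map g = g ≫ (awayUnit r).app N' :=
  ((awayUnit r).naturality g).symm

lemma away_hom_ext (r : R) {N N' : ModuleCat.{u} R} {r' : R} (h : r ∣ r')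
    {f g : (away r).obj N ⟶ (away r').obj N'}
    (e : (awayUnit r).app N ≫ f = (awayUnit r).app N ≫ g) : f = g := by
  ext : 1
  exact IsLocalizedModule.ext (Submonoid.powers r) (LocalizedModule.mkLinearMap _ N)
    (isUnit_of_dvd h N') (congrArg ModuleCat.Hom.hom e)

lemma awayMap_naturality {r r' : R} (h : r ∣ r') {N N' : ModuleCat.{u} R} (g : N ⟶ N') :
    awayMap h N ≫ (away r').map g = (away r).map g ≫ awayMap h N' := by
  apply away_hom_ext r h
  rw [← Category.assoc, unit_awayMap, unit_away_map, ← Category.assoc, unit_away_map,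
    Category.assoc, unit_awayMap]

/-- `localizationSystem x M` as a functor of `M`. -/
def localizationSystemFunctor : ModuleCat.{u} R ⥤ Finset A ⥤ ModuleCat.{u} R where
  obj M := localizationSystem x M
  map g :=
    { app := fun σ => (away (∏ a ∈ σ, x a)).map g
      naturality := fun _ _ f =>
        awayMap_naturality (Finset.prod_dvd_prod_of_subset _ _ _ (leOfHom f)) g }
  map_id M := by
    ext σ : 2
    exact (away (∏ a ∈ σ, x a)).map_id M
  map_comp f g := by
    ext σ : 2
    exact (away (∏ a ∈ σ, x a)).map_comp f g

instance : (localizationSystemFunctor x).Additive where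
  map_add {M M' f g} := by
    ext σ : 2
    exact (away (∏ a ∈ σ, x a)).map_add

end LocalizationFunctor

end

end Adelic

namespace Adelic

/-! ### Acyclicity from a filtered cone contraction. -/

section Contraction

variable {P : Type u} [PartialOrder P] {A : Type u} (w : P → Finset A)
variable {R : Type u} [CommRing R] (N : Finset A ⥤ ModuleCat.{u} R)

/-- Apices for the chains of `P`, compatible with the omission of elements up to a filtration. -/
structure ChainContraction where
  /-- The apex of a chain. -/
  apex : ∀ {n : ℕ}, (Fin n ↪o P) → P
  /-- The filtration. -/
  rank : ∀ {n : ℕ}, (Fin n ↪o P) → ℕ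
  rank_le : ∀ {n : ℕ} (f : Fin n ↪o P), rank f ≤ n
  rank_omit_le : ∀ {n : ℕ} (f : Fin (n + 1) ↪o P) (i : Fin (n + 1)),
    rank (chainOmit f i) ≤ rank f
  apex_omit : ∀ {n : ℕ} (f : Fin (n + 1) ↪o P) (i : Fin (n + 1)),
    rank (chainOmit f i) = rank f → apex (chainOmit f i) = apex f
  exists_insert : ∀ {n : ℕ} (f : Fin n ↪o P), apex f ∉ Set.range f →
    ∃ (g : Fin (n + 1) ↪o P) (p : Fin (n + 1)), g p = apex f ∧ chainOmit g p = f ∧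
      rank g = rank f
  rank_omit_apex : ∀ {n : ℕ} (g : Fin (n + 1) ↪o P) (p : Fin (n + 1)), g p = apex g →
    rank (chainOmit g p) = rank g
  bijective : ∀ {n : ℕ} (g : Fin (n + 1) ↪o P) (p : Fin (n + 1)), g p = apex g →
    Function.Bijective (resMap N (chainSupport_omit_le w g p))

lemma range_eq_insert {n : ℕ} (g : Fin (n + 1) ↪o P) (p : Fin (n + 1)) :
    Set.range g = insert (g p) (Set.range (chainOmit g p)) := by
  ext y
  simp only [Set.mem_range, Set.mem_insert_iff, chainOmit_apply]
  constructor
  · rintro ⟨j, rfl⟩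
    obtain rfl | ⟨i, rfl⟩ := Fin.eq_self_or_eq_succAbove p j
    · exact Or.inl rfl
    · exact Or.inr ⟨i, rfl⟩
  · rintro (rfl | ⟨i, rfl⟩)
    exacts [⟨p, rfl⟩, ⟨_, rfl⟩]

lemma notMem_range_chainOmit {n : ℕ} (g : Fin (n + 1) ↪o P) (p : Fin (n + 1)) :
    g p ∉ Set.range (chainOmit g p) := by
  rintro ⟨i, h⟩
  exact Fin.succAbove_ne p i (g.injective h)

/-- A chain is determined by its range. -/
lemma insert_unique {n : ℕ} {g g' : Fin (n + 1) ↪o P} {p p' : Fin (n + 1)}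
    (h : g p = g' p') (h' : chainOmit g p = chainOmit g' p') : g = g' ∧ p = p' := by
  have e : g = g' := by
    apply DFunLike.coe_injective
    rw [← g.strictMono.range_inj g'.strictMono, range_eq_insert g p, range_eq_insert g' p', h, h']
  subst e
  exact ⟨rfl, g.injective h⟩

variable {w N} (K : ChainContraction w N)

namespace ChainContraction

include K in
-- This is the cone homotopy on the part of rank `m`: up to sign, `b f` is the value of `c` on the
-- chain that arises from `f` by inserting the apex, pulled back along the bijective structure map.
lemma exists_homotopy {n : ℕ} (c : ChainCochain w N (n + 1)) (m : ℕ) :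
    ∃ b : ChainCochain w N n,
      (∀ (g : Fin (n + 1) ↪o P) (p : Fin (n + 1)), g p = K.apex g → K.rank g = m →
        chainTerm b (chainOmit g p) (chainSupport_omit_le w g p) = (-1 : ℤ) ^ (p : ℕ) • c g) ∧
      ∀ f : Fin n ↪o P, K.apex f ∈ Set.range f ∨ K.rank f ≠ m → b f = 0 := by
  classical
  have hb : ∀ f : Fin n ↪o P, ∃ y : N.obj (chainSupport w f),
      (∀ (g : Fin (n + 1) ↪o P) (p : Fin (n + 1)) (e : chainOmit g p = f), g p = K.apex g →
        K.rank g = m →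
        resMap N (e ▸ chainSupport_omit_le w g p) y = (-1 : ℤ) ^ (p : ℕ) • c g) ∧
      (K.apex f ∈ Set.range f ∨ K.rank f ≠ m → y = 0) := by
    intro f
    by_cases h : K.apex f ∈ Set.range f ∨ K.rank f ≠ m
    -- The prescribed equation is vacuous here: if `f` arose from such a `g` by omission of the
    -- apex, it would have rank `m` and lack its apex.
    · refine ⟨0, fun g p e hg hm => ?_, fun _ => rfl⟩
      subst e
      rw [K.apex_omit g p (K.rank_omit_apex g p hg), ← hg, K.rank_omit_apex g p hg] at h
      exact (h.elim (notMem_range_chainOmit g p) (fun h => h hm)).elim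
    · push Not at h
      obtain ⟨g, p, hg, rfl, hr⟩ := K.exists_insert f h.1
      rw [K.apex_omit g p hr.symm] at hg
      obtain ⟨y, hy⟩ := (K.bijective g p hg).2 ((-1 : ℤ) ^ (p : ℕ) • c g)
      refine ⟨y, fun g' p' e hg' hm => ?_, fun h' => (h'.elim h.1 (fun h' => h' h.2)).elim⟩
      -- Only one chain `g` has to be considered, because the inserted element must be the apex of
      -- `f`.
      obtain ⟨rfl, rfl⟩ := insert_unique (g := g) (g' := g') (p := p) (p' := p') (by
        rw [hg, hg', ← K.apex_omit g p hr.symm, ← K.apex_omit g' p' (K.rank_omit_apex g' p' hg'),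
          e]) e.symm
      exact hy
  choose b h1 h2 using hb
  exact ⟨b, fun g p hg hm => h1 _ g p rfl hg hm, h2⟩

include K in
-- Faces of rank `m` of a chain of rank `m` have the same apex as the chain. Modulo lower ranks,
-- where everything vanishes, the chains therefore behave like a cone, and the cone homotopy inverts
-- the coboundary.
lemma exists_step {n : ℕ} (c : ChainCochain w N (n + 1)) (hc : chainDelta w N (n + 1) c = 0)
    (m : ℕ) (h0 : ∀ f, K.rank f < m → c f = 0) :
    ∃ b : ChainCochain w N n, ∀ f, K.rank f < m + 1 → chainDelta w N n b f = c f := by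
  obtain ⟨b, hb, hb0⟩ := K.exists_homotopy c m
  refine ⟨b, fun f hf => ?_⟩
  have hb' : ∀ f, K.rank f < m → b f = 0 := fun f hf => hb0 f (Or.inr hf.ne)
  have h0' : ∀ {k : ℕ} (d : ChainCochain w N k) (g : Fin k ↪o P) {τ : Finset A}
      (h : chainSupport w g ≤ τ), d g = 0 → chainTerm d g h = 0 := by
    intro k d g τ h e
    rw [chainTerm, e, map_zero]
  rcases (Nat.lt_succ_iff.1 hf).lt_or_eq with hf | hf
  · rw [h0 f hf, chainDelta_apply]
    refine Finset.sum_eq_zero fun i _ => ?_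
    rw [h0' _ _ _ (hb' _ ((K.rank_omit_le f i).trans_lt hf)), smul_zero]
  by_cases hr : K.apex f ∈ Set.range f
  -- The apex is a member. Omitting it gives the only face on which `b` can be nonzero, since every
  -- other face of rank `m` still contains the apex.
  · obtain ⟨p, hp⟩ := hr
    rw [chainDelta_apply, Finset.sum_eq_single p, hb f p hp hf, smul_smul, ← mul_pow]
    · simp
    · intro i _ hi
      rw [h0' _ _ _ (hb0 _ ?_), smul_zero]
      by_cases hm : K.rank (chainOmit f i) = m
      · left
        rw [K.apex_omit f i (hm.trans hf.symm), ← hp]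
        obtain ⟨j, rfl⟩ := Fin.exists_succAbove_eq hi.symm
        exact ⟨j, rfl⟩
      · exact Or.inr hm
    · simp
  -- The apex is not a member. After its insertion, the cocycle equation at `g` expresses the value
  -- of `c` on the given chain through the faces of `g` that keep the apex, and these are governed
  -- by `b`.
  · obtain ⟨g, p, hg, rfl, hgr⟩ := K.exists_insert f hr
    have hug := K.apex_omit g p hgr.symm
    rw [hug] at hg
    apply (K.bijective g p hg).1
    have hcg := congrFun hc g
    rw [chainDelta_apply, Fin.sum_univ_succAbove _ p] at hcg
    have hs : ((-1 : ℤ) ^ (p : ℕ)) * (-1) ^ (p : ℕ) = 1 := by rw [← mul_pow]; simp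
    have hcg' := congrArg (fun z => (-1 : ℤ) ^ (p : ℕ) • z) hcg
    simp only [smul_add, smul_smul, hs, one_smul, Pi.zero_apply, smul_zero] at hcg'
    rw [eq_comm]
    refine (eq_neg_of_add_eq_zero_left hcg').trans ?_
    rw [chainDelta_apply, map_sum, Finset.smul_sum, ← Finset.sum_neg_distrib]
    refine Finset.sum_congr rfl fun i _ => ?_
    rw [map_zsmul, chainTerm_congr b (chainOmit_omit g p i).symm]
    have hq : chainOmit g (p.succAbove i) (i.predAbove p) = g p := by
      rw [chainOmit_apply, Fin.succAbove_succAbove_predAbove]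
    by_cases hm : K.rank (chainOmit g (p.succAbove i)) = m
    · have hu := K.apex_omit g (p.succAbove i) (hm.trans (hf.symm.trans hgr.symm))
      have := hb _ _ (hq.trans (hg.trans hu.symm)) hm
      have h3 := congrArg (resMap N (chainSupport_omit_le w g (p.succAbove i))) this
      rw [chainTerm, resMap_resMap, map_zsmul] at h3
      unfold chainTerm
      rw [resMap_resMap, h3, smul_smul, smul_smul, ← neg_smul]
      congr 1
      have h4 := neg_one_pow_succAbove_predAbove p i
      rw [pow_add, pow_add] at h4
      have h5 : ((-1 : ℤ) ^ (p.succAbove i : ℕ)) * (-1) ^ (p.succAbove i : ℕ) = 1 := by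
        rw [← mul_pow]; simp
      have h6 : ((-1 : ℤ) ^ (i : ℕ)) * (-1) ^ (i : ℕ) = 1 := by
        rw [← mul_pow]; simp
      -- `h4` is the sign change between the two orders of omission; `h5` and `h6` remove squares of
      -- signs.
      linear_combination (-(-1 : ℤ) ^ (p.succAbove i : ℕ) * (-1 : ℤ) ^ (i : ℕ)) * h4
        + ((-1 : ℤ) ^ (i : ℕ) * (-1 : ℤ) ^ (i.predAbove p : ℕ)) * h5
        + (-1 : ℤ) ^ (p : ℕ) * (-1 : ℤ) ^ (p.succAbove i : ℕ) * h6
    · have hlt : K.rank (chainOmit g (p.succAbove i)) < m :=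
        lt_of_le_of_ne ((K.rank_omit_le _ _).trans (hgr.trans hf).le) hm
      rw [h0' c _ _ (h0 _ hlt), h0' b _ _ (hb' _ ((K.rank_omit_le _ _).trans_lt hlt))]
      simp

include K in
lemma exists_chainDelta_eq {n : ℕ} (c : ChainCochain w N (n + 1))
    (hc : chainDelta w N (n + 1) c = 0) : ∃ b, chainDelta w N n b = c := by
  -- `k` bounds the number of ranks still to be cleared: a chain of length `n + 1` has rank at most
  -- `n + 1`, so a cochain that vanishes below rank `n + 2` is zero.
  have key : ∀ k m : ℕ, n + 2 ≤ m + k → ∀ c : ChainCochain w N (n + 1),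
      chainDelta w N (n + 1) c = 0 → (∀ f, K.rank f < m → c f = 0) →
      ∃ b, chainDelta w N n b = c := by
    intro k
    induction k with
    | zero =>
      intro m hm c _ h0
      refine ⟨0, ?_⟩
      rw [map_zero]
      funext f
      exact (h0 f (by have := K.rank_le f; omega)).symm
    | succ k ih =>
      intro m hm c hc h0
      obtain ⟨b, hb⟩ := K.exists_step c hc m h0
      obtain ⟨b', hb'⟩ := ih (m + 1) (by omega) (c - chainDelta w N n b)
        (by rw [map_sub, hc, chainDelta_chainDelta, sub_zero])
        (fun f hf => by rw [Pi.sub_apply, hb f hf, sub_self])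
      exact ⟨b' + b, by rw [map_add, hb', sub_add_cancel]⟩
  exact key (n + 2) 0 (by omega) c hc fun f hf => (Nat.not_lt_zero _ hf).elim

include K in
-- The empty chain extends to the chain that consists of its apex alone, and there the coboundary is
-- the bijective structure map.
lemma eq_zero_of_chainDelta_eq_zero (c : ChainCochain w N 0) (hc : chainDelta w N 0 c = 0) :
    c = 0 := by
  funext f
  obtain ⟨g, p, hg, rfl, hr⟩ := K.exists_insert f (by rintro ⟨i, _⟩; exact i.elim0)
  rw [K.apex_omit g p hr.symm] at hg
  apply (K.bijective g p hg).1
  rw [Pi.zero_apply, map_zero]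
  have := congrFun hc g
  rw [chainDelta_apply] at this
  obtain rfl : p = 0 := Fin.fin_one_eq_zero p
  simpa [chainTerm] using this

include K in
lemma isZero_homology (n : ℕ) : IsZero ((chainComplexObj w N).homology n) := by
  rw [← HomologicalComplex.exactAt_iff_isZero_homology]
  cases n with
  | zero =>
    rw [HomologicalComplex.exactAt_iff' _ 0 0 1 (by simp) (by simp),
      ShortComplex.moduleCat_exact_iff]
    intro c hc
    refine ⟨0, ?_⟩
    rw [map_zero]
    refine (K.eq_zero_of_chainDelta_eq_zero c ?_).symm
    have hc' : ((chainComplexObj w N).d 0 1).hom c = 0 := hc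
    rwa [chainComplexObj_d] at hc'
  | succ n =>
    rw [HomologicalComplex.exactAt_iff' _ n (n + 1) (n + 2) (by simp) (by simp),
      ShortComplex.moduleCat_exact_iff]
    intro c hc
    have hc' : ((chainComplexObj w N).d (n + 1) (n + 2)).hom c = 0 := hc
    rw [chainComplexObj_d] at hc'
    obtain ⟨b, hb⟩ := K.exists_chainDelta_eq c hc'
    refine ⟨b, ?_⟩
    change ((chainComplexObj w N).d n (n + 1)).hom b = c
    rw [chainComplexObj_d]
    exact hb

end ChainContraction

end Contraction

end Adelic

namespace Adelic

/-! ### Insertion of an element into a chain. -/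

section Insert

variable {P : Type u} [PartialOrder P]

/-- A downward closed subset of `Fin n` is an initial segment. The cut `p` lies in `Fin (n + 1)`
because it may come after the last element. -/
lemma exists_fin_lt_iff {n : ℕ} (q : Fin n → Prop) (hq : ∀ i j, i ≤ j → q j → q i) :
    ∃ p : Fin (n + 1), ∀ i, q i ↔ i.castSucc < p := by
  classical
  induction n with
  | zero => exact ⟨0, fun i => i.elim0⟩
  | succ n ih =>
    by_cases h : q (Fin.last n)
    · exact ⟨Fin.last _, fun i => ⟨fun _ => i.castSucc_lt_last, fun _ => hq _ _ i.le_last h⟩⟩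
    · obtain ⟨p, hp⟩ := ih (fun i => q i.castSucc) fun i j hij => hq _ _ (by simpa using hij)
      refine ⟨p.castSucc, fun i => ?_⟩
      induction i using Fin.lastCases with
      | last => simp [h, Fin.lt_def]; omega
      | cast i => simpa [Fin.lt_def] using hp i

/-- The position of `y` is the cut between the members below it and those above it. -/
lemma exists_insert_of_comparable {n : ℕ} (f : Fin n ↪o P) (y : P)
    (h : ∀ i, f i < y ∨ y < f i) :
    ∃ (g : Fin (n + 1) ↪o P) (p : Fin (n + 1)), g p = y ∧ chainOmit g p = f := by
  obtain ⟨p, hp⟩ := exists_fin_lt_iff (fun i => f i < y)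
    fun i j hij hj => (f.monotone hij).trans_lt hj
  have hmono : StrictMono (p.insertNth (α := fun _ => P) y f) := by
    intro i j hij
    obtain rfl | ⟨i, rfl⟩ := Fin.eq_self_or_eq_succAbove p i
    · obtain rfl | ⟨j, rfl⟩ := Fin.eq_self_or_eq_succAbove i j
      · exact (lt_irrefl _ hij).elim
      · rw [Fin.insertNth_apply_same, Fin.insertNth_apply_succAbove]
        refine (h j).resolve_left fun hj => ?_
        rw [Fin.succAbove_of_castSucc_lt _ _ ((hp j).1 hj)] at hij
        exact lt_asymm hij ((hp j).1 hj)
    · obtain rfl | ⟨j, rfl⟩ := Fin.eq_self_or_eq_succAbove p j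
      · rw [Fin.insertNth_apply_same, Fin.insertNth_apply_succAbove]
        by_contra hi
        rw [Fin.succAbove_of_le_castSucc _ _ (not_lt.1 fun h => hi ((hp i).2 h))] at hij
        exact hi ((hp i).2 ((Fin.castSucc_lt_succ).trans hij))
      · rw [Fin.insertNth_apply_succAbove, Fin.insertNth_apply_succAbove]
        exact f.strictMono ((Fin.succAbove_lt_succAbove_iff).1 hij)
  refine ⟨OrderEmbedding.ofStrictMono _ hmono, p,
    Fin.insertNth_apply_same (α := fun _ => P) p y f, ?_⟩
  ext i
  exact Fin.insertNth_apply_succAbove (α := fun _ => P) p y f i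

end Insert

/-! ### Contractions for vertices and for flags. -/

section Contractions

variable {A : Type u} {R : Type u} [CommRing R] (N : Finset A ⥤ ModuleCat.{u} R)

/-- The contraction of the full simplex on a totally ordered set from the vertex `a`. -/
def vertexContraction [LinearOrder A] (a : A)
    (hN : ∀ (σ τ : Finset A) (h : σ ≤ τ), (∀ b ∈ τ, b = a ∨ b ∈ σ) →
      Function.Bijective (resMap N h)) :
    ChainContraction (P := A) (fun b => {b}) N where
  -- All chains share the cone point `a`, so the filtration can be trivial.
  apex _ := a
  rank _ := 0
  rank_le _ := Nat.zero_le _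
  rank_omit_le _ _ := le_rfl
  apex_omit _ _ _ := rfl
  exists_insert f hf := by
    obtain ⟨g, p, h, h'⟩ := exists_insert_of_comparable f a
      fun i => lt_or_gt_of_ne fun h => hf ⟨i, h⟩
    exact ⟨g, p, h, h', rfl⟩
  rank_omit_apex _ _ _ := rfl
  bijective {n} g p hp := by
    apply hN
    intro b hb
    simp only [mem_chainSupport, Finset.mem_singleton] at hb ⊢
    obtain ⟨j, rfl⟩ := hb
    obtain rfl | ⟨i, rfl⟩ := Fin.eq_self_or_eq_succAbove p j
    · exact Or.inl hp
    · exact Or.inr ⟨i, rfl⟩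

/-- The finite set that underlies an element of `(Simplex A)ᵒᵈ`. -/
abbrev flagSet (p : (Simplex A)ᵒᵈ) : Finset A := (OrderDual.ofDual p).1

lemma flagSet_le {p q : (Simplex A)ᵒᵈ} (h : p ≤ q) : flagSet q ⊆ flagSet p := h

lemma flagSet_injective : Function.Injective (flagSet (A := A)) :=
  fun _ _ h => Subtype.ext h

lemma lt_of_flagSet {p q : (Simplex A)ᵒᵈ} (h : flagSet q ⊆ flagSet p)
    (hne : p ≠ q) : p < q := lt_of_le_of_ne h hne

open Classical in
/-- The union of `{a}` and the members of a flag that do not contain `a`. -/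
noncomputable def flagApex (a : A) {n : ℕ} (f : Fin n ↪o (Simplex A)ᵒᵈ) : (Simplex A)ᵒᵈ :=
  OrderDual.toDual ⟨insert a (Finset.univ.biUnion fun i =>
    if a ∈ flagSet (f i) then ∅ else flagSet (f i)), Finset.insert_nonempty _ _⟩

lemma mem_flagApex (a : A) {n : ℕ} (f : Fin n ↪o (Simplex A)ᵒᵈ) (b : A) :
    b ∈ flagSet (flagApex a f) ↔ b = a ∨ ∃ i, a ∉ flagSet (f i) ∧ b ∈ flagSet (f i) := by
  simp only [flagSet, flagApex, OrderDual.ofDual_toDual, Finset.mem_insert, Finset.mem_biUnion,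
    Finset.mem_univ, true_and]
  refine or_congr Iff.rfl (exists_congr fun i => ?_)
  split_ifs with h <;> simp [h]

open Classical in
/-- The number of members of a flag that do not contain `a`. -/
noncomputable def flagRank (a : A) {n : ℕ} (f : Fin n ↪o (Simplex A)ᵒᵈ) : ℕ :=
  (Finset.univ.filter fun i => a ∉ flagSet (f i)).card

lemma flagRank_omit (a : A) {n : ℕ} (f : Fin (n + 1) ↪o (Simplex A)ᵒᵈ) (p : Fin (n + 1)) :
    (a ∈ flagSet (f p) ∧ flagRank a (chainOmit f p) = flagRank a f) ∨
      (a ∉ flagSet (f p) ∧ flagRank a (chainOmit f p) + 1 = flagRank a f) := by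
  classical
  have : flagRank a f = (if a ∉ flagSet (f p) then 1 else 0) + flagRank a (chainOmit f p) := by
    unfold flagRank
    rw [Finset.card_filter, Finset.card_filter, Fin.sum_univ_succAbove _ p]
    rfl
  by_cases h : a ∈ flagSet (f p)
  · simp [this, h]
  · simp [this, h, add_comm]

lemma flagSet_le_total {n : ℕ} (f : Fin n ↪o (Simplex A)ᵒᵈ) (i j : Fin n) :
    flagSet (f i) ⊆ flagSet (f j) ∨ flagSet (f j) ⊆ flagSet (f i) := by
  rcases le_total i j with h | h
  · exact Or.inr (flagSet_le (f.monotone h))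
  · exact Or.inl (flagSet_le (f.monotone h))

/-- The contraction of the flags of non-empty finite subsets of `A` from the element `a`. -/
noncomputable def flagContraction (a : A)
    (hN : ∀ (σ τ : Finset A) (h : σ ≤ τ), (∀ b ∈ τ, b = a ∨ b ∈ σ) →
      Function.Bijective (resMap N h)) :
    ChainContraction (P := (Simplex A)ᵒᵈ) flagSet N where
  apex := flagApex a
  rank := flagRank a
  rank_le f := (Finset.card_le_univ _).trans (by simp)
  rank_omit_le f i := by
    rcases flagRank_omit a f i with h | h <;> omega
  apex_omit f p h := by
    -- Equal rank means that the omitted member contains `a`, and such members do not contribute to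
    -- the apex.
    have hp : a ∈ flagSet (f p) := by
      rcases flagRank_omit a f p with h' | h'
      · exact h'.1
      · omega
    apply flagSet_injective
    ext b
    rw [mem_flagApex, mem_flagApex]
    refine or_congr Iff.rfl ⟨fun ⟨i, hi⟩ => ⟨_, hi⟩, fun ⟨j, hj⟩ => ?_⟩
    obtain rfl | ⟨i, rfl⟩ := Fin.eq_self_or_eq_succAbove p j
    · exact (hj.1 hp).elim
    · exact ⟨i, hj⟩
  exists_insert f hf := by
    -- As the members of a flag are nested, the apex is `{a}` together with the largest member that
    -- avoids `a`, if there is one. It contains every member without `a` and lies in every member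
    -- with `a`, so it fits into the flag.
    have hcomp : ∀ i, f i < flagApex a f ∨ flagApex a f < f i := by
      intro i
      have hne : f i ≠ flagApex a f := fun h => hf ⟨i, h⟩
      by_cases hi : a ∈ flagSet (f i)
      · left
        refine lt_of_flagSet (fun b hb => ?_) hne
        rw [mem_flagApex] at hb
        obtain rfl | ⟨j, hj, hb⟩ := hb
        · exact hi
        · exact (flagSet_le_total f i j).elim (fun h => (hj (h hi)).elim) (fun h => h hb)
      · right
        refine lt_of_flagSet (fun b hb => ?_) hne.symm
        rw [mem_flagApex]
        exact Or.inr ⟨i, hi, hb⟩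
    obtain ⟨g, p, hg, e⟩ := exists_insert_of_comparable f (flagApex a f) hcomp
    refine ⟨g, p, hg, e, ?_⟩
    have ha : a ∈ flagSet (g p) := by rw [hg, mem_flagApex]; exact Or.inl rfl
    rcases flagRank_omit a g p with h | h
    · rw [← h.2, e]
    · exact (h.1 ha).elim
  rank_omit_apex g p hg := by
    have ha : a ∈ flagSet (g p) := by rw [hg, mem_flagApex]; exact Or.inl rfl
    rcases flagRank_omit a g p with h | h
    · exact h.2
    · exact (h.1 ha).elim
  bijective g p hg := by
    apply hN
    intro b hb
    rw [mem_chainSupport] at hb ⊢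
    have ha : a ∈ flagSet (g p) := by rw [hg, mem_flagApex]; exact Or.inl rfl
    obtain ⟨j, hj⟩ := hb
    obtain rfl | ⟨i, rfl⟩ := Fin.eq_self_or_eq_succAbove p j
    · rw [hg, mem_flagApex] at hj
      -- An element of the apex other than `a` belongs to a member that avoids `a`; that member is
      -- not the apex and so survives the omission.
      refine hj.imp id fun ⟨i, hi, hb⟩ => ?_
      obtain rfl | ⟨k, rfl⟩ := Fin.eq_self_or_eq_succAbove j i
      · exact (hi ha).elim
      · exact ⟨k, hb⟩
    · exact Or.inr ⟨i, hj⟩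

end Contractions

end Adelic

namespace Adelic

/-! ### Torsion submodules over a Noetherian ring. -/

section Torsion

variable {R : Type u} [CommRing R] (I : Ideal R) (N : Type u) [AddCommGroup N] [Module R N]

/-- The elements of `N` that are killed by a power of every element of `I`. -/
def torsionSubmodule : Submodule R N where
  carrier := {m | ∀ r ∈ I, ∃ k : ℕ, r ^ k • m = 0}
  zero_mem' := fun r _ => ⟨0, smul_zero _⟩
  add_mem' := by
    intro m m' hm hm' r hr
    obtain ⟨k, hk⟩ := hm r hr
    obtain ⟨k', hk'⟩ := hm' r hr
    refine ⟨k + k', ?_⟩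
    rw [smul_add, pow_add, mul_smul _ _ m', hk', mul_comm, mul_smul, hk, smul_zero, smul_zero,
      add_zero]
  smul_mem' := by
    intro s m hm r hr
    obtain ⟨k, hk⟩ := hm r hr
    exact ⟨k, by rw [smul_comm, hk, smul_zero]⟩

variable {I N}

/-- In this form torsion visibly depends only on the radical of `I` and can be tested on generators.
-/
lemma mem_torsionSubmodule_iff_le {m : N} :
    m ∈ torsionSubmodule I N ↔ I ≤ (Ideal.torsionOf R N m).radical := Iff.rfl

lemma mem_torsionSubmodule_span {s : Set R} {m : N} :
    m ∈ torsionSubmodule (Ideal.span s) N ↔ ∀ r ∈ s, ∃ k : ℕ, r ^ k • m = 0 := by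
  rw [mem_torsionSubmodule_iff_le, Ideal.span_le]
  rfl

lemma torsionSubmodule_eq_of_radical_eq {J : Ideal R} (h : I.radical = J.radical) :
    torsionSubmodule I N = torsionSubmodule J N := by
  ext m
  rw [mem_torsionSubmodule_iff_le, mem_torsionSubmodule_iff_le, ← Ideal.radical_le_radical_iff,
    h, Ideal.radical_le_radical_iff]

lemma mem_torsionSubmodule_iff_exists_pow [IsNoetherianRing R] {m : N} :
    m ∈ torsionSubmodule I N ↔ ∃ t : ℕ, ∀ r ∈ I ^ t, r • m = 0 := by
  constructor
  · intro h
    obtain ⟨t, ht⟩ := Ideal.exists_pow_le_of_le_radical_of_fg (mem_torsionSubmodule_iff_le.1 h)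
      (IsNoetherian.noetherian I)
    exact ⟨t, fun r hr => ht hr⟩
  · rintro ⟨t, ht⟩ r hr
    exact ⟨t, ht _ (Ideal.pow_mem_pow hr t)⟩

lemma exists_pow_smul_eq_zero [IsNoetherianRing R] (J : Ideal R)
    (f : J →ₗ[R] torsionSubmodule I N) : ∃ t : ℕ, ∀ r ∈ I ^ t, ∀ j, r • f j = 0 := by
  obtain ⟨s, hs⟩ := (IsNoetherian.noetherian (⊤ : Submodule R J))
  have h : ∀ j : J, ∃ t : ℕ, ∀ r ∈ I ^ t, r • f j = 0 := fun j => by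
    obtain ⟨t, ht⟩ := mem_torsionSubmodule_iff_exists_pow.1 (f j).2
    exact ⟨t, fun r hr => Subtype.ext (ht r hr)⟩
  choose t ht using h
  refine ⟨s.sup t, fun r hr j => ?_⟩
  have hj : j ∈ Submodule.span R (s : Set J) := by rw [hs]; trivial
  induction hj using Submodule.span_induction with
  | mem j hj => exact ht j r (Ideal.pow_le_pow_right (Finset.le_sup hj) hr)
  | zero => rw [map_zero, smul_zero]
  | add j j' _ _ h h' => rw [map_add, smul_add, h, h', add_zero]
  | smul c j _ h => rw [map_smul, smul_comm, h, smul_zero]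

/-- Over a Noetherian ring the torsion submodule of an injective module is injective. -/
lemma injective_torsionSubmodule [IsNoetherianRing R] (hN : Module.Injective R N) :
    Module.Injective R (torsionSubmodule I N) := by
  apply Module.Baer.injective
  intro J f
  obtain ⟨t, ht⟩ := exists_pow_smul_eq_zero J f
  -- By Artin-Rees, `I ^ (k + t) ⊓ J` lies in `I ^ t • J`, which `f` kills. So `f` factors through
  -- the image of `J` in `R ⧸ I ^ (k + t)` and extends from there to a map into `N`.
  obtain ⟨k, hk⟩ := Ideal.exists_pow_inf_eq_pow_smul I (M := R) J
  let g : J →ₗ[R] R ⧸ I ^ (k + t) := (Submodule.mkQ (I ^ (k + t))) ∘ₗ J.subtype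
  have hker : LinearMap.ker g ≤ LinearMap.ker ((torsionSubmodule I N).subtype ∘ₗ f) := by
    intro j hj
    have hj' : (j : R) ∈ I ^ (k + t) := (Submodule.Quotient.mk_eq_zero _).1 hj
    have hle : I ^ t • J ≤ (LinearMap.ker f).map J.subtype := by
      rw [Submodule.smul_le]
      intro r hr i hi
      refine ⟨r • ⟨i, hi⟩, ?_, rfl⟩
      rw [SetLike.mem_coe, LinearMap.mem_ker, map_smul, ht r hr]
    have hmem : (j : R) ∈ I ^ (k + t) • (⊤ : Submodule R R) ⊓ J :=
      ⟨by simpa using hj', j.2⟩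
    rw [hk (k + t) (Nat.le_add_right _ _), Nat.add_sub_cancel_left] at hmem
    obtain ⟨j', hj'', e⟩ := hle (Submodule.smul_mono le_rfl inf_le_right hmem)
    obtain rfl : j' = j := Subtype.ext e
    rw [LinearMap.mem_ker, LinearMap.comp_apply, LinearMap.mem_ker.1 hj'', map_zero]
  have hinj : Function.Injective ((LinearMap.ker g).liftQ g le_rfl) :=
    LinearMap.ker_eq_bot.1 (Submodule.ker_liftQ_eq_bot _ _ _ le_rfl)
  obtain ⟨h, hh⟩ := hN.out _ hinj
    ((LinearMap.ker g).liftQ ((torsionSubmodule I N).subtype ∘ₗ f) hker)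
  refine ⟨(h ∘ₗ Submodule.mkQ (I ^ (k + t))).codRestrict _ fun r => ?_, fun j hj => ?_⟩
  · rw [mem_torsionSubmodule_iff_exists_pow]
    refine ⟨k + t, fun s hs => ?_⟩
    rw [← map_smul, LinearMap.comp_apply]
    convert map_zero h
    exact (Submodule.Quotient.mk_eq_zero _).2 (Ideal.mul_mem_right _ _ hs)
  · apply Subtype.ext
    exact hh (Submodule.Quotient.mk ⟨j, hj⟩)

end Torsion

/-! ### Injective modules as retracts of torsion modules and localizations. -/

section Retract

variable {R : Type u} [CommRing R]

open Classical in
/-- An additive functor vanishes on an injective module if it vanishes on torsion modules and on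
the localizations of the module. -/
lemma isZero_obj_of_injective [IsNoetherianRing R] {D : Type*} [Category D] [Preadditive D]
    (T : ModuleCat.{u} R ⥤ D) [T.Additive] {A : Type u} (x : A → R)
    (E : ModuleCat.{u} R) [Injective E]
    (htors : ∀ N : ModuleCat.{u} R, torsionSubmodule (Ideal.span (Set.range x)) N = ⊤ →
      IsZero (T.obj N))
    (hloc : ∀ a, IsZero (T.obj ((away (x a)).obj E))) : IsZero (T.obj E) := by
  -- Finitely many of the `x a` generate the ideal. This keeps the product of localizations finite,
  -- so that an additive functor can be applied summand by summand.
  obtain ⟨s, hs, hspan⟩ := (Submodule.fg_span_iff_fg_span_finset_subset (Set.range x)).1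
    (IsNoetherian.noetherian (Ideal.span (Set.range x)))
  have hE : Module.Injective R E := Module.injective_module_of_injective_object R E
  have hT := injective_torsionSubmodule (I := Ideal.span (Set.range x)) hE
  obtain ⟨r, hr⟩ := hT.out (torsionSubmodule (Ideal.span (Set.range x)) E).subtype
    Subtype.val_injective LinearMap.id
  let L : E →ₗ[R] (y : s) → LocalizedModule (Submonoid.powers (y : R)) E :=
    LinearMap.pi fun y => LocalizedModule.mkLinearMap _ _
  -- An element killed by `L` is torsion, and on torsion elements the retraction `r` is the
  -- identity.
  have hinj : Function.Injective (r.prod L) := by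
    rw [← LinearMap.ker_eq_bot, eq_bot_iff]
    intro m hm
    have h1 : r m = 0 := congrArg Prod.fst hm
    have h2 : L m = 0 := congrArg Prod.snd hm
    have hmem : m ∈ torsionSubmodule (Ideal.span (Set.range x)) E := by
      change m ∈ torsionSubmodule (Submodule.span R _) E
      rw [hspan]
      refine mem_torsionSubmodule_span.2 fun y hy => ?_
      obtain ⟨⟨_, k, rfl⟩, hk⟩ :=
        (IsLocalizedModule.eq_zero_iff (Submonoid.powers y)
          (LocalizedModule.mkLinearMap _ E)).1 (congrFun h2 ⟨y, hy⟩)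
      exact ⟨k, hk⟩
    have h3 := hr ⟨m, hmem⟩
    rw [Submodule.subtype_apply, h1] at h3
    exact (congrArg Subtype.val h3).symm
  obtain ⟨q, hq⟩ := hE.out _ hinj LinearMap.id
  let W := torsionSubmodule (Ideal.span (Set.range x)) E
  -- The splitting `q` writes the identity of `E` as a sum of maps that factor through the torsion
  -- submodule or through one localization; `T` kills each of them.
  have hid : 𝟙 E = ModuleCat.ofHom r ≫ ModuleCat.ofHom (q ∘ₗ LinearMap.inl R W _) +
      ∑ y : s, ModuleCat.ofHom (LocalizedModule.mkLinearMap (Submonoid.powers (y : R)) E) ≫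
        ModuleCat.ofHom (q ∘ₗ LinearMap.inr R W _ ∘ₗ
          LinearMap.single R (fun y : s => LocalizedModule (Submonoid.powers (y : R)) E) y) := by
    ext m
    have h1 : m = q (LinearMap.inl R W _ (r m)) + q (LinearMap.inr R W _ (L m)) := by
      rw [← map_add]
      refine (hq m).symm.trans (congrArg q ?_)
      ext1
      · exact (add_zero _).symm
      · exact (zero_add _).symm
    have hL := (LinearMap.sum_single_apply _ (L m)).symm
    rw [hL, map_sum, map_sum] at h1
    simp only [ModuleCat.hom_add, ModuleCat.hom_comp, ModuleCat.hom_sum, LinearMap.add_apply,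
      LinearMap.sum_apply, LinearMap.comp_apply, ModuleCat.hom_ofHom, ModuleCat.hom_id,
      LinearMap.id_apply]
    exact h1
  rw [IsZero.iff_id_eq_zero, ← T.map_id, hid, T.map_add, T.map_sum, T.map_comp]
  rw [(htors (ModuleCat.of R W) ?_).eq_of_tgt (T.map (ModuleCat.ofHom r)) 0, zero_comp, zero_add]
  · refine Finset.sum_eq_zero fun y _ => ?_
    obtain ⟨a, ha⟩ := hs y.2
    rw [T.map_comp]
    have hz : IsZero (T.obj (ModuleCat.of R (LocalizedModule (Submonoid.powers (y : R)) E))) := by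
      rw [← ha]
      exact hloc a
    rw [hz.eq_of_tgt (T.map (ModuleCat.ofHom (LocalizedModule.mkLinearMap
      (Submonoid.powers (y : R)) E))) 0, zero_comp]
  · rw [eq_top_iff]
    rintro ⟨m, hm⟩ _ t ht
    obtain ⟨k, hk⟩ := hm t ht
    exact ⟨k, Subtype.ext hk⟩

end Retract

/-! ### Localizations of a module on which one of the elements acts invertibly. -/

section Local

variable {R : Type u} [CommRing R]

/-- Multiplication by `s` on the localization is the localization of multiplication by `s`, and
functors preserve isomorphisms. -/
lemma isUnit_algebraMap_away_obj {s : R} (r : R) {M : ModuleCat.{u} R}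
    (h : IsUnit (algebraMap R (Module.End R M) s)) :
    IsUnit (algebraMap R (Module.End R ((away r).obj M)) s) := by
  rw [Module.End.isUnit_iff] at h ⊢
  let e := LinearEquiv.ofBijective _ h
  have e1 : (algebraMap R (Module.End R ((away r).obj M)) s) =
      ((away r).map (ModuleCat.ofHom (algebraMap R (Module.End R M) s))).hom := by
    refine congrArg ModuleCat.Hom.hom (away_hom_ext (N' := M) r dvd_rfl
      (f := ModuleCat.ofHom (algebraMap R (Module.End R ((away r).obj M)) s)) ?_)
    rw [unit_away_map]
    ext m
    exact ((LocalizedModule.mkLinearMap (Submonoid.powers r) M).map_smul s m).symm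
  rw [e1]
  have : IsIso (ModuleCat.ofHom (algebraMap R (Module.End R M) s)) :=
    (LinearEquiv.toModuleIso e).isIso_hom
  exact (ConcreteCategory.isIso_iff_bijective
    ((away r).map (ModuleCat.ofHom (algebraMap R (Module.End R M) s)))).1 inferInstance

/-- Since `r'` divides `s * r`, it acts invertibly on `M[1/r]`, and the universal property of
`M[1/r']` yields the inverse. -/
lemma awayMap_bijective {r r' s : R} (h : r ∣ r') (h' : r' ∣ s * r) {M : ModuleCat.{u} R}
    (hs : IsUnit (algebraMap R (Module.End R M) s)) :
    Function.Bijective (awayMap h M).hom := by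
  have hunit : ∀ t : Submonoid.powers r',
      IsUnit (algebraMap R (Module.End R ((away r).obj M)) t) := by
    rintro ⟨_, k, rfl⟩
    have h1 : IsUnit (algebraMap R (Module.End R ((away r).obj M)) (s * r)) := by
      rw [map_mul]
      exact (isUnit_algebraMap_away_obj r hs).mul
        (isUnit_of_dvd dvd_rfl M (⟨r, 1, pow_one r⟩ : Submonoid.powers r))
    obtain ⟨c, hc⟩ := h'
    rw [hc, map_mul] at h1
    have h2 := ((Commute.isUnit_mul_iff (Algebra.commutes _ _)).1 h1).1
    change IsUnit (algebraMap R (Module.End R _) (r' ^ k))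
    rw [map_pow]
    exact h2.pow k
  let g : (away r').obj M ⟶ (away r).obj M :=
    ModuleCat.ofHom (LocalizedModule.lift (Submonoid.powers r')
      (LocalizedModule.mkLinearMap (Submonoid.powers r) M) hunit)
  have hg : (awayUnit r').app M ≫ g = (awayUnit r).app M := by
    ext : 1
    exact LocalizedModule.lift_comp _ _ _
  have h1 : awayMap h M ≫ g = 𝟙 _ := by
    apply away_hom_ext r dvd_rfl
    rw [← Category.assoc, unit_awayMap, hg, Category.comp_id]
  have h2 : g ≫ awayMap h M = 𝟙 _ := by
    apply away_hom_ext r' dvd_rfl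
    rw [← Category.assoc, hg, unit_awayMap, Category.comp_id]
  have : IsIso (awayMap h M) := ⟨g, h1, h2⟩
  exact (ConcreteCategory.isIso_iff_bijective (awayMap h M)).1 inferInstance

/-- Adjoining `a` to the index set only inverts `x a`, which is invertible on `M` already. This is
the hypothesis of both contractions. -/
lemma localizationSystem_bijective {A : Type u} (x : A → R) {a : A} {M : ModuleCat.{u} R}
    (ha : IsUnit (algebraMap R (Module.End R M) (x a))) (σ τ : Finset A) (h : σ ≤ τ)
    (h' : ∀ b ∈ τ, b = a ∨ b ∈ σ) :
    Function.Bijective (resMap (localizationSystem x M) h) := by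
  classical
  refine awayMap_bijective (Finset.prod_dvd_prod_of_subset _ _ _ h) ?_ ha
  refine (Finset.prod_dvd_prod_of_subset τ (insert a σ) x fun b hb => ?_).trans ?_
  · simpa using h' b hb
  · by_cases hσ : a ∈ σ
    · rw [Finset.insert_eq_of_mem hσ]
      exact dvd_mul_left _ _
    · rw [Finset.prod_insert hσ]

end Local

end Adelic

namespace Adelic

/-! ### Dimension shifting and extension from injective objects. -/

section DimensionShift

universe v₁ v₂ u₁ u₂

variable {C : Type u₁} [Category.{v₁} C] [Abelian C] {D : Type u₂} [Category.{v₂} D] [Abelian D]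

/-- A sequence of functors that behaves on short exact sequences with injective middle term like the
right derived functors of the first one. -/
structure DimensionShift (F : ℕ → C ⥤ D) : Prop where
  one : ∀ S : ShortComplex C, S.ShortExact → Injective S.X₂ →
    Nonempty ((F 1).obj S.X₁ ≅ cokernel ((F 0).map S.g))
  succ : ∀ S : ShortComplex C, S.ShortExact → Injective S.X₂ → ∀ n : ℕ,
    Nonempty ((F (n + 2)).obj S.X₁ ≅ (F (n + 1)).obj S.X₃)

variable (C) in
lemma exists_shortExact_injective [EnoughInjectives C] (M : C) :
    ∃ (E Q : C) (f : M ⟶ E) (g : E ⟶ Q) (h : f ≫ g = 0),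
      Injective E ∧ (ShortComplex.mk f g h).ShortExact :=
  ⟨Injective.under M, cokernel (Injective.ι M), Injective.ι M, cokernel.π _, cokernel.condition _,
    inferInstance,
    { exact := ShortComplex.exact_of_g_is_cokernel _ (cokernelIsCokernel _)
      mono_f := inferInstanceAs (Mono (Injective.ι M))
      epi_g := inferInstanceAs (Epi (cokernel.π (Injective.ι M))) }⟩

/-- Embed `M` in an injective object with quotient `Q`; degree `n` at `M` is then governed by degree
`n - 1` at `Q`. Degree one compares cokernels and needs `θ` to be natural, while from degree two on
an isomorphism at the single object `Q` is enough. -/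
theorem DimensionShift.nonempty_iso [EnoughInjectives C] {F F' : ℕ → C ⥤ D}
    (hF : DimensionShift F) (hF' : DimensionShift F') (θ : F 0 ≅ F' 0) (n : ℕ) (M : C) :
    Nonempty ((F n).obj M ≅ (F' n).obj M) := by
  induction n using Nat.strong_induction_on generalizing M with
  | _ n ih =>
    obtain ⟨E, Q, f, g, h, hE, hS⟩ := exists_shortExact_injective C M
    match n, ih with
    | 0, _ => exact ⟨θ.app M⟩
    | 1, _ =>
      obtain ⟨e⟩ := hF.one _ hS hE
      obtain ⟨e'⟩ := hF'.one _ hS hE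
      exact ⟨e ≪≫ cokernel.mapIso _ _ (θ.app E) (θ.app Q) (θ.hom.naturality g) ≪≫ e'.symm⟩
    | n + 2, ih =>
      obtain ⟨e⟩ := hF.succ _ hS hE n
      obtain ⟨e'⟩ := hF'.succ _ hS hE n
      obtain ⟨e''⟩ := ih (n + 1) (by omega) Q
      exact ⟨e ≪≫ e'' ≪≫ e'.symm⟩

variable (K : C ⥤ CochainComplex D ℕ) [K.Additive]

/-- The homology of an exact functor to complexes that is acyclic on injective objects. -/
lemma dimensionShift_of_exact (hK : ∀ S : ShortComplex C, S.ShortExact → (S.map K).ShortExact)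
    (h0 : ∀ E : C, Injective E → ∀ n : ℕ, IsZero ((K.obj E).homology (n + 1))) :
    DimensionShift fun n => K ⋙ HomologicalComplex.homologyFunctor D _ n where
  one S hS hE := by
    have h := hK S hS
    have := h.epi_δ 0 1 (by simp) (h0 _ hE 0)
    exact ⟨IsColimit.coconePointUniqueUpToIso
      (h.homology_exact₃ 0 1 _).gIsCokernel (colimit.isColimit _)⟩
  succ S hS hE n := by
    have h := hK S hS
    exact ⟨(h.δIso (n + 1) (n + 2) (by simp) (h0 _ hE n) (h0 _ hE (n + 1))).symm⟩

/-- The preservation of the kernels of short exact sequences. -/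
structure IsLeftExact (F : C ⥤ D) [F.PreservesZeroMorphisms] : Prop where
  mono : ∀ S : ShortComplex C, S.ShortExact → Mono (F.map S.f)
  exact : ∀ S : ShortComplex C, S.ShortExact → (S.map F).Exact

/-- In degree zero the cohomology is the object of cycles, a subobject of the cochains. -/
lemma mono_homologyMap_zero {K L : CochainComplex D ℕ} (φ : K ⟶ L) (h : Mono (φ.f 0)) :
    Mono (HomologicalComplex.homologyMap φ 0) := by
  have h2 : Mono (HomologicalComplex.cyclesMap φ 0 ≫ HomologicalComplex.iCycles L 0) := by
    rw [HomologicalComplex.cyclesMap_i]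
    infer_instance
  have h3 : Mono (HomologicalComplex.cyclesMap φ 0) :=
    mono_of_mono _ (HomologicalComplex.iCycles L 0)
  have h4 : HomologicalComplex.homologyMap φ 0 = (CochainComplex.isoHomologyπ₀ K).inv ≫
      HomologicalComplex.cyclesMap φ 0 ≫ (CochainComplex.isoHomologyπ₀ L).hom := by
    rw [Iso.eq_inv_comp]
    exact HomologicalComplex.homologyπ_naturality φ 0
  rw [h4]
  infer_instance

lemma isLeftExact_homology_zero
    (hK : ∀ S : ShortComplex C, S.ShortExact → (S.map K).ShortExact) :
    IsLeftExact (K ⋙ HomologicalComplex.homologyFunctor D _ 0) where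
  mono S hS := by
    have h := hK S hS
    have := h.mono_f
    have h1 : Mono ((S.map K).f.f 0) := inferInstance
    exact mono_homologyMap_zero (K.map S.f) h1
  exact S hS := (hK S hS).homology_exact₂ 0

section Extension

variable [EnoughInjectives C] {F F' : C ⥤ D} [F.PreservesZeroMorphisms]
  [F'.PreservesZeroMorphisms]

omit [EnoughInjectives C] in
lemma IsLeftExact.mono_map (hF : IsLeftExact F) {M N : C} (f : M ⟶ N) [Mono f] :
    Mono (F.map f) :=
  hF.mono (ShortComplex.mk f (cokernel.π f) (cokernel.condition f))
    { exact := ShortComplex.exact_of_g_is_cokernel _ (cokernelIsCokernel _)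
      mono_f := inferInstance
      epi_g := inferInstance }

/-- For an embedding of `M` in an injective `E` with quotient `Q`, left exactness makes `F'.obj M`
the kernel of `F'.obj E ⟶ F'.obj Q`, so `θ` at `E` restricts to `M`. -/
lemma exists_extension_app (hF' : IsLeftExact F')
    (θ : ∀ E : C, Injective E → (F.obj E ⟶ F'.obj E))
    (hθ : ∀ (E E' : C) (hE : Injective E) (hE' : Injective E') (f : E ⟶ E'),
      F.map f ≫ θ E' hE' = θ E hE ≫ F'.map f) (M : C) :
    ∃ t : F.obj M ⟶ F'.obj M, ∀ (E : C) (hE : Injective E) (f : M ⟶ E),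
      t ≫ F'.map f = F.map f ≫ θ E hE := by
  obtain ⟨E, Q, f, g, h, hE, hS⟩ := exists_shortExact_injective C M
  have hm := hF'.mono _ hS
  have hm' := hF'.mono_map (Injective.ι Q)
  -- `θ` is not available at `Q`; the vanishing is tested after embedding `Q` in an injective
  -- object, where the naturality of `θ` applies.
  have hz : (F.map f ≫ θ E hE) ≫ F'.map g = 0 := by
    rw [← cancel_mono (F'.map (Injective.ι Q)), zero_comp, Category.assoc, ← F'.map_comp,
      Category.assoc, ← hθ E _ hE inferInstance, ← F.map_comp_assoc, ← Category.assoc, h, zero_comp,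
      F.map_zero, zero_comp]
  have hf : Mono (ShortComplex.map (ShortComplex.mk f g h) F').f := hm
  obtain ⟨t, ht⟩ : ∃ t : F.obj M ⟶ F'.obj M, t ≫ F'.map f = F.map f ≫ θ E hE :=
    ⟨(hF'.exact _ hS).lift _ hz, (hF'.exact _ hS).lift_f _ hz⟩
  refine ⟨t, fun E' hE' f' => ?_⟩
  have : Mono f := hS.mono_f
  -- Every map from `M` to an injective object extends along `f`, so compatibility with `f` gives
  -- all the others.
  have e : f ≫ Injective.factorThru f' f = f' := Injective.comp_factorThru f' f
  rw [← e, F'.map_comp, ← Category.assoc, ht, Category.assoc, ← hθ E E' hE hE', F.map_comp,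
    Category.assoc]

/-- An isomorphism of left exact functors on the injective objects extends to all objects. -/
theorem nonempty_iso_of_injective (hF : IsLeftExact F) (hF' : IsLeftExact F')
    (θ : ∀ E : C, Injective E → (F.obj E ≅ F'.obj E))
    (hθ : ∀ (E E' : C) (hE : Injective E) (hE' : Injective E') (f : E ⟶ E'),
      F.map f ≫ (θ E' hE').hom = (θ E hE).hom ≫ F'.map f) : Nonempty (F ≅ F') := by
  choose t ht using exists_extension_app hF' (fun E hE => (θ E hE).hom) hθ
  choose s hs using exists_extension_app hF (fun E hE => (θ E hE).inv)
    (fun E E' hE hE' f => by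
      rw [Iso.comp_inv_eq, Category.assoc, hθ E E' hE hE', Iso.inv_hom_id_assoc])
  have h1 : ∀ M, t M ≫ s M = 𝟙 _ := fun M => by
    have := hF.mono_map (Injective.ι M)
    rw [← cancel_mono (F.map (Injective.ι M)), Category.assoc, hs M _ inferInstance,
      ← Category.assoc, ht M _ inferInstance, Category.assoc, Iso.hom_inv_id, Category.comp_id,
      Category.id_comp]
  have h2 : ∀ M, s M ≫ t M = 𝟙 _ := fun M => by
    have := hF'.mono_map (Injective.ι M)
    rw [← cancel_mono (F'.map (Injective.ι M)), Category.assoc, ht M _ inferInstance,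
      ← Category.assoc, hs M _ inferInstance, Category.assoc, Iso.inv_hom_id, Category.comp_id,
      Category.id_comp]
  refine ⟨NatIso.ofComponents (fun M => ⟨t M, s M, h1 M, h2 M⟩) fun {M N} f => ?_⟩
  have := hF'.mono_map (Injective.ι N)
  rw [← cancel_mono (F'.map (Injective.ι N))]
  simp only [Category.assoc]
  rw [ht N _ inferInstance, ← F'.map_comp, ht M _ inferInstance, F.map_comp, Category.assoc]

end Extension

end DimensionShift

end Adelic

namespace Adelic

noncomputable section

/-! ### Exactness of the chain construction and its vanishing on injective modules. -/

section LocalizationChains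

variable {R : Type u} [CommRing R]

lemma shortExact_map_away (r : R) (S : ShortComplex (ModuleCat.{u} R)) (hS : S.ShortExact) :
    (S.map (away r)).ShortExact where
  exact := by
    rw [ShortComplex.ShortExact.moduleCat_exact_iff_function_exact]
    exact IsLocalizedModule.map_exact (Submonoid.powers r) (LocalizedModule.mkLinearMap _ S.X₁)
      (LocalizedModule.mkLinearMap _ S.X₂) (LocalizedModule.mkLinearMap _ S.X₃) _ _
      ((ShortComplex.ShortExact.moduleCat_exact_iff_function_exact S).1 hS.exact)
  mono_f := by
    rw [ModuleCat.mono_iff_injective]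
    exact IsLocalizedModule.map_injective (Submonoid.powers r)
      (LocalizedModule.mkLinearMap _ S.X₁) (LocalizedModule.mkLinearMap _ S.X₂) _
      hS.moduleCat_injective_f
  epi_g := by
    rw [ModuleCat.epi_iff_surjective]
    exact IsLocalizedModule.map_surjective (Submonoid.powers r)
      (LocalizedModule.mkLinearMap _ S.X₂) (LocalizedModule.mkLinearMap _ S.X₃) _
      hS.moduleCat_surjective_g

variable {P : Type u} [PartialOrder P] {A : Type u} (w : P → Finset A) (x : A → R)

/-- The complex of the chains of `P` with coefficients in the localizations of a module. -/
abbrev localizationChains : ModuleCat.{u} R ⥤ CochainComplex (ModuleCat.{u} R) ℕ :=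
  localizationSystemFunctor x ⋙ chainComplexFunctor w

/-- Localization is exact and so are arbitrary products of modules: preimages are chosen chain by
chain. -/
lemma localizationChains_shortExact (S : ShortComplex (ModuleCat.{u} R)) (hS : S.ShortExact) :
    (S.map (localizationChains w x)).ShortExact := by
  apply HomologicalComplex.shortExact_of_degreewise_shortExact
  intro n
  have h := fun f : Fin n ↪o P =>
    shortExact_map_away (∏ a ∈ chainSupport w f, x a) S hS
  refine { exact := ?_, mono_f := ?_, epi_g := ?_ }
  · rw [ShortComplex.moduleCat_exact_iff]
    intro c hc
    have h' := fun f => (ShortComplex.moduleCat_exact_iff _).1 (h f).exact (c f) (congrFun hc f)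
    choose b hb using h'
    exact ⟨b, funext hb⟩
  · rw [ModuleCat.mono_iff_injective]
    intro c c' hc
    exact funext fun f => (h f).moduleCat_injective_f (congrFun hc f)
  · rw [ModuleCat.epi_iff_surjective]
    intro c
    choose b hb using fun f => (h f).moduleCat_surjective_g (c f)
    exact ⟨b, funext hb⟩

/-- The hypotheses under which the chains of `P` compute local cohomology. -/
structure IsCovering : Prop where
  nonempty : ∀ p, (w p).Nonempty
  singleton : ∀ a, ∃ p, w p = {a}
  contraction : ∀ (a : A) (M : ModuleCat.{u} R), IsUnit (algebraMap R (Module.End R M) (x a)) →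
    Nonempty (ChainContraction w (localizationSystem x M))

variable {w x}

lemma isUnit_algebraMap_away (r : R) (M : ModuleCat.{u} R) :
    IsUnit (algebraMap R (Module.End R ((away r).obj M)) r) :=
  isUnit_of_dvd dvd_rfl M (⟨r, 1, pow_one r⟩ : Submonoid.powers r)

/-- Inverting a product kills all that inverting one factor kills, so nonempty supports give one
direction; the singleton supports give the other. -/
lemma mem_torsionSubmodule_iff_away (hw : IsCovering w x) {M : ModuleCat.{u} R} {m : M} :
    m ∈ torsionSubmodule (Ideal.span (Set.range x)) M ↔
      ∀ p, LocalizedModule.mkLinearMap (Submonoid.powers (∏ a ∈ w p, x a)) M m = 0 := by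
  rw [mem_torsionSubmodule_span]
  have key : ∀ r : R, LocalizedModule.mkLinearMap (Submonoid.powers r) M m = 0 ↔
      ∃ k : ℕ, r ^ k • m = 0 := by
    intro r
    refine (IsLocalizedModule.eq_zero_iff (Submonoid.powers r)
      (LocalizedModule.mkLinearMap _ M)).trans ⟨?_, ?_⟩
    · rintro ⟨⟨_, k, rfl⟩, hk⟩
      exact ⟨k, hk⟩
    · rintro ⟨k, hk⟩
      exact ⟨⟨_, k, rfl⟩, hk⟩
  simp only [key]
  constructor
  · intro h p
    obtain ⟨a, ha⟩ := hw.nonempty p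
    obtain ⟨k, hk⟩ := h _ ⟨a, rfl⟩
    obtain ⟨c, hc⟩ := pow_dvd_pow_of_dvd (Finset.dvd_prod_of_mem x ha) k
    exact ⟨k, by rw [hc, mul_comm, mul_smul, hk, smul_zero]⟩
  · rintro h _ ⟨a, rfl⟩
    obtain ⟨p, hp⟩ := hw.singleton a
    have := h p
    rwa [hp, Finset.prod_singleton] at this

/-- A nonempty chain has a nonempty support, and inverting a multiple of some `x a` kills a torsion
module. -/
lemma subsingleton_localizationChains (hw : IsCovering w x) (M : ModuleCat.{u} R)
    (hM : torsionSubmodule (Ideal.span (Set.range x)) M = ⊤) (n : ℕ) :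
    IsZero (((localizationChains w x).obj M).X (n + 1)) := by
  rw [ModuleCat.isZero_iff_subsingleton]
  suffices h : ∀ f : Fin (n + 1) ↪o P,
      Subsingleton ((localizationSystem x M).obj (chainSupport w f)) from
    inferInstanceAs (Subsingleton (∀ f : Fin (n + 1) ↪o P,
      (localizationSystem x M).obj (chainSupport w f)))
  intro f
  obtain ⟨a, ha⟩ := hw.nonempty (f 0)
  have ha' : a ∈ chainSupport w f := (mem_chainSupport w f a).2 ⟨0, ha⟩
  change Subsingleton (LocalizedModule _ _)
  rw [LocalizedModule.subsingleton_iff]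
  intro m
  have hm : m ∈ torsionSubmodule (Ideal.span (Set.range x)) M := by rw [hM]; trivial
  obtain ⟨k, hk⟩ := mem_torsionSubmodule_span.1 hm _ ⟨a, rfl⟩
  obtain ⟨c, hc⟩ := pow_dvd_pow_of_dvd (Finset.dvd_prod_of_mem x ha') k
  refine ⟨_, ⟨k, rfl⟩, ?_⟩
  change (∏ i ∈ chainSupport w f, x i) ^ k • m = 0
  rw [hc, mul_comm, mul_smul, hk, smul_zero]

/-- By the retract argument only two cases remain: on torsion modules the cochains themselves
vanish, and on `E[1/x_a]` the contraction from `a` applies. -/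
lemma isZero_homology_localizationChains (hw : IsCovering w x) [IsNoetherianRing R]
    (E : ModuleCat.{u} R) (hE : Injective E) (n : ℕ) :
    IsZero (((localizationChains w x).obj E).homology (n + 1)) := by
  refine isZero_obj_of_injective
    (localizationChains w x ⋙ HomologicalComplex.homologyFunctor _ _ (n + 1)) x E ?_ ?_
  · intro N hN
    exact ShortComplex.isZero_homology_of_isZero_X₂ _ (subsingleton_localizationChains hw N hN n)
  · intro a
    obtain ⟨K⟩ := hw.contraction a _ (isUnit_algebraMap_away (x a) E)
    exact K.isZero_homology (n + 1)

end LocalizationChains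

/-! ### Vertices and flags satisfy the hypotheses. -/

section Coverings

variable {R : Type u} [CommRing R] {A : Type u} (x : A → R)

lemma isCovering_vertices [LinearOrder A] : IsCovering (fun a : A => {a}) x where
  nonempty _ := Finset.singleton_nonempty _
  singleton a := ⟨a, rfl⟩
  contraction a _ ha := ⟨vertexContraction _ a (localizationSystem_bijective x ha)⟩

lemma isCovering_flags : IsCovering (flagSet (A := A)) x where
  nonempty p := (OrderDual.ofDual p).2
  singleton a := ⟨OrderDual.toDual ⟨{a}, Finset.singleton_nonempty a⟩, rfl⟩
  contraction a _ ha := ⟨flagContraction _ a (localizationSystem_bijective x ha)⟩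

end Coverings

end

end Adelic

namespace Adelic

noncomputable section

/-! ### Comparison of functors in degree zero. -/

section Comparison

variable {R : Type u} [CommRing R]

/-- Subfunctors of the identity with the same values are isomorphic. -/
lemma nonempty_iso_of_range_eq {F F' : ModuleCat.{u} R ⥤ ModuleCat.{u} R} (j : F ⟶ 𝟭 _)
    (j' : F' ⟶ 𝟭 _) (hj : ∀ M, Function.Injective (j.app M).hom)
    (hj' : ∀ M, Function.Injective (j'.app M).hom)
    (h : ∀ M, LinearMap.range (j.app M).hom = LinearMap.range (j'.app M).hom) :
    Nonempty (F ≅ F') := by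
  let e : ∀ M, F.obj M ≅ F'.obj M := fun M => LinearEquiv.toModuleIso
    ((LinearEquiv.ofInjective _ (hj M)).trans
      ((LinearEquiv.ofEq _ _ (h M)).trans (LinearEquiv.ofInjective _ (hj' M)).symm))
  have he : ∀ M, (e M).hom ≫ j'.app M = j.app M := by
    intro M
    ext m
    exact congrArg Subtype.val ((LinearEquiv.ofInjective _ (hj' M)).apply_symm_apply
      (LinearEquiv.ofEq _ _ (h M) (LinearEquiv.ofInjective _ (hj M) m)))
  refine ⟨NatIso.ofComponents e fun {M N} f => ?_⟩
  have : Mono (j'.app N) := (ModuleCat.mono_iff_injective _).2 (hj' N)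
  rw [← cancel_mono (j'.app N), Category.assoc, Category.assoc, he, j.naturality, j'.naturality,
    ← Category.assoc, he]

/-- Left exact functors that are the same quotient of the identity on injective modules are
isomorphic. -/
lemma nonempty_iso_of_ker_eq {F F' : ModuleCat.{u} R ⥤ ModuleCat.{u} R}
    [F.PreservesZeroMorphisms] [F'.PreservesZeroMorphisms]
    (hF : IsLeftExact F) (hF' : IsLeftExact F') (q : 𝟭 _ ⟶ F) (q' : 𝟭 _ ⟶ F')
    (hq : ∀ E, Injective E → Function.Surjective (q.app E).hom)
    (hq' : ∀ E, Injective E → Function.Surjective (q'.app E).hom)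
    (h : ∀ E, LinearMap.ker (q.app E).hom = LinearMap.ker (q'.app E).hom) :
    Nonempty (F ≅ F') := by
  let e : ∀ E, Injective E → (F.obj E ≅ F'.obj E) := fun E hE => LinearEquiv.toModuleIso
    ((LinearMap.quotKerEquivOfSurjective _ (hq E hE)).symm.trans
      ((Submodule.quotEquivOfEq _ _ (h E)).trans
        (LinearMap.quotKerEquivOfSurjective _ (hq' E hE))))
  have he : ∀ E hE, q.app E ≫ (e E hE).hom = q'.app E := by
    intro E hE
    ext m
    change (LinearMap.quotKerEquivOfSurjective _ (hq' E hE)) ((Submodule.quotEquivOfEq _ _ (h E))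
      ((LinearMap.quotKerEquivOfSurjective _ (hq E hE)).symm ((q.app E).hom m))) = _
    have : (LinearMap.quotKerEquivOfSurjective _ (hq E hE)).symm ((q.app E).hom m) =
        Submodule.Quotient.mk m := by
      rw [LinearEquiv.symm_apply_eq]
      rfl
    rw [this]
    rfl
  refine nonempty_iso_of_injective hF hF' e fun E E' hE hE' f => ?_
  have : Epi (q.app E) := (ModuleCat.epi_iff_surjective _).2 (hq E hE)
  rw [← cancel_epi (q.app E), ← Category.assoc, ← q.naturality, Category.assoc, he E' hE',
    ← Category.assoc, he E hE, q'.naturality]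

/-- The inclusion of the homology of a cochain complex in degree `0`. -/
def homologyZeroι (K : CochainComplex (ModuleCat.{u} R) ℕ) : K.homology 0 ⟶ K.X 0 :=
  (CochainComplex.isoHomologyπ₀ K).inv ≫ K.iCycles 0

lemma homologyπ_homologyZeroι (K : CochainComplex (ModuleCat.{u} R) ℕ) :
    K.homologyπ 0 ≫ homologyZeroι K = K.iCycles 0 := by
  unfold homologyZeroι
  rw [← Category.assoc]
  exact (congrArg (· ≫ _) (CochainComplex.isoHomologyπ₀ K).hom_inv_id).trans (Category.id_comp _)

lemma homologyZeroι_naturality {K L : CochainComplex (ModuleCat.{u} R) ℕ} (φ : K ⟶ L) :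
    HomologicalComplex.homologyMap φ 0 ≫ homologyZeroι L = homologyZeroι K ≫ φ.f 0 := by
  rw [← cancel_epi (K.homologyπ 0), HomologicalComplex.homologyπ_naturality_assoc,
    homologyπ_homologyZeroι, ← Category.assoc, homologyπ_homologyZeroι,
    HomologicalComplex.cyclesMap_i]

lemma homologyZeroι_injective (K : CochainComplex (ModuleCat.{u} R) ℕ) :
    Function.Injective (homologyZeroι K).hom := by
  rw [← ModuleCat.mono_iff_injective]
  unfold homologyZeroι
  infer_instance

lemma exists_homologyZeroι_eq (K : CochainComplex (ModuleCat.{u} R) ℕ) (c : K.X 0)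
    (hc : (K.d 0 1).hom c = 0) : ∃ z, (homologyZeroι K).hom z = c := by
  let φ : ModuleCat.of R R ⟶ K.X 0 := ModuleCat.ofHom (LinearMap.toSpanSingleton R _ c)
  have hφ : φ ≫ K.d 0 1 = 0 := by
    ext
    simp [φ, hc]
  refine ⟨(K.liftCycles φ 1 (by simp) hφ ≫ K.homologyπ 0).hom 1, ?_⟩
  change ((K.liftCycles φ 1 (by simp) hφ ≫ K.homologyπ 0) ≫ homologyZeroι K).hom 1 = c
  rw [Category.assoc, homologyπ_homologyZeroι, HomologicalComplex.liftCycles_i]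
  simp [φ]

lemma d_homologyZeroι (K : CochainComplex (ModuleCat.{u} R) ℕ) (z : K.homology 0) :
    (K.d 0 1).hom ((homologyZeroι K).hom z) = 0 := by
  change (homologyZeroι K ≫ K.d 0 1).hom z = 0
  unfold homologyZeroι
  rw [Category.assoc, HomologicalComplex.iCycles_d, comp_zero]
  rfl

end Comparison

/-! ### Removal of the term of degree zero. -/

section Truncation

universe v₁ u₁

variable {D : Type u₁} [Category.{v₁} D] [Abelian D]

instance : (CochainComplex.truncate (V := D)).Additive where
  map_add {K L f g} := by
    ext n
    rfl

lemma shortExact_map_truncate (S : ShortComplex (CochainComplex D ℕ)) (hS : S.ShortExact) :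
    (S.map CochainComplex.truncate).ShortExact :=
  HomologicalComplex.shortExact_of_degreewise_shortExact _ fun n =>
    hS.map_of_exact (HomologicalComplex.eval D (ComplexShape.up ℕ) (n + 1))

lemma isZero_homology_truncate (K : CochainComplex D ℕ) (n : ℕ)
    (h : IsZero (K.homology (n + 2))) :
    IsZero ((CochainComplex.truncate.obj K).homology (n + 1)) := by
  rw [← HomologicalComplex.exactAt_iff_isZero_homology,
    HomologicalComplex.exactAt_iff' _ n (n + 1) (n + 2) (by simp) (by simp)]
  rw [← HomologicalComplex.exactAt_iff_isZero_homology,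
    HomologicalComplex.exactAt_iff' _ (n + 1) (n + 2) (n + 3) (by simp) (by simp)] at h
  exact h

end Truncation

/-! ### Cohomology of chains in degree zero and its dependence on the radical. -/

section Chains

variable {R : Type u} [CommRing R] {P : Type u} [PartialOrder P] {A : Type u} {w : P → Finset A}
  {x : A → R}

variable (w x) in
/-- The map from a module to the cochains of degree `0`. -/
def chainsUnit (M : ModuleCat.{u} R) : M ⟶ ((localizationChains w x).obj M).X 0 :=
  ModuleCat.ofHom (LinearMap.pi fun f : Fin 0 ↪o P =>
    LocalizedModule.mkLinearMap (Submonoid.powers (∏ a ∈ chainSupport w f, x a)) M)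

lemma chainsUnit_naturality {M N : ModuleCat.{u} R} (g : M ⟶ N) :
    g ≫ chainsUnit w x N = chainsUnit w x M ≫ ((localizationChains w x).map g).f 0 := by
  ext m
  funext f
  exact congrArg (fun z => z.hom m) ((awayUnit (∏ a ∈ chainSupport w f, x a)).naturality g)

lemma chainSupport_zero (f : Fin 0 ↪o P) : chainSupport w f = ∅ := by
  ext a
  simp

lemma bijective_mkLinearMap_one (M : Type u) [AddCommGroup M] [Module R M] :
    Function.Bijective (LocalizedModule.mkLinearMap (Submonoid.powers (1 : R)) M) := by
  constructor
  · intro m m' h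
    obtain ⟨⟨_, k, rfl⟩, hk⟩ := (IsLocalizedModule.eq_iff_exists (Submonoid.powers (1 : R))
      (LocalizedModule.mkLinearMap _ M)).1 h
    simpa [Submonoid.smul_def] using hk
  · intro z
    obtain ⟨⟨m, ⟨_, k, rfl⟩⟩, h⟩ := IsLocalizedModule.surj (Submonoid.powers (1 : R))
      (LocalizedModule.mkLinearMap _ M) z
    exact ⟨m, by simpa [Submonoid.smul_def] using h.symm⟩

/-- The unique chain of length zero has empty support, so only the empty product, which is one, is
inverted. -/
lemma isIso_chainsUnit (M : ModuleCat.{u} R) : IsIso (chainsUnit w x M) := by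
  rw [ConcreteCategory.isIso_iff_bijective]
  have key : ∀ f : Fin 0 ↪o P, Function.Bijective
      (LocalizedModule.mkLinearMap (Submonoid.powers (∏ a ∈ chainSupport w f, x a)) M) := by
    intro f
    have h1 : ∏ a ∈ chainSupport w f, x a = 1 := by simp [chainSupport_zero]
    rw [h1]
    exact bijective_mkLinearMap_one M
  let f₀ : Fin 0 ↪o P := ⟨⟨Fin.elim0, fun i => i.elim0⟩, fun {i} => i.elim0⟩
  have hf : ∀ f : Fin 0 ↪o P, f = f₀ := fun f => by ext i; exact i.elim0
  constructor
  · intro m m' h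
    exact (key f₀).1 (congrFun h f₀)
  · intro c
    obtain ⟨m, hm⟩ := (key f₀).2 (c f₀)
    refine ⟨m, funext fun f => ?_⟩
    rw [hf f]
    exact hm

lemma bijective_chainsUnit (M : ModuleCat.{u} R) :
    Function.Bijective (chainsUnit w x M).hom :=
  (ConcreteCategory.isIso_iff_bijective _).1 (isIso_chainsUnit M)

variable (w x) in
/-- The cochains of degree `0`. -/
def chainsUnitIso (M : ModuleCat.{u} R) : M ≅ ((localizationChains w x).obj M).X 0 :=
  @asIso _ _ _ _ (chainsUnit w x M) (isIso_chainsUnit M)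

lemma chainDelta_chainsUnit {M : ModuleCat.{u} R} (m : M) (f : Fin 1 ↪o P) :
    chainDelta w (localizationSystem x M) 0 ((chainsUnit w x M).hom m : ChainCochain w _ 0) f =
      LocalizedModule.mkLinearMap (Submonoid.powers (∏ a ∈ chainSupport w f, x a)) M m := by
  refine (chainDelta_apply w _ _ f).trans ?_
  simp only [Nat.reduceAdd, Finset.univ_unique, Fin.default_eq_zero, Fin.isValue, Fin.val_eq_zero,
    pow_zero, one_smul, Finset.sum_singleton]
  have h := congrArg (fun z => z.hom m) (unit_awayMap (Finset.prod_dvd_prod_of_subset _ _ x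
    (chainSupport_omit_le w f 0)) M)
  exact h

/-- The first coboundary sends `m` to its images in the localizations at the supports of the
elements of `P`. The torsion submodule is thus the cohomology in degree zero. -/
lemma d_chainsUnit_eq_zero_iff (hw : IsCovering w x) {M : ModuleCat.{u} R} (m : M) :
    (((localizationChains w x).obj M).d 0 1).hom ((chainsUnit w x M).hom m) = 0 ↔
      m ∈ torsionSubmodule (Ideal.span (Set.range x)) M := by
  rw [mem_torsionSubmodule_iff_away hw]
  have h1 : ((localizationChains w x).obj M).d 0 1 = ModuleCat.ofHom (chainDelta w _ 0) :=
    chainComplexObj_d w _ 0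
  rw [h1]
  have key : ∀ f : Fin 1 ↪o P,
      LocalizedModule.mkLinearMap (Submonoid.powers (∏ a ∈ chainSupport w f, x a)) M m = 0 ↔
      LocalizedModule.mkLinearMap (Submonoid.powers (∏ a ∈ w (f 0), x a)) M m = 0 := by
    intro f
    have : chainSupport w f = w (f 0) := by
      ext a
      simp
    rw [this]
  constructor
  · intro h p
    let f : Fin 1 ↪o P := OrderEmbedding.ofStrictMono (fun _ : Fin 1 => p)
      (Subsingleton.strictMono _)
    exact (key f).1 ((chainDelta_chainsUnit m f).symm.trans (congrFun h f))
  · intro h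
    exact funext fun f => (chainDelta_chainsUnit m f).trans ((key f).2 (h _))

variable (w x) in
/-- The cohomology of the chains in degree `0` as a subfunctor of the identity. -/
def chainsHomologyZeroι :
    localizationChains w x ⋙ HomologicalComplex.homologyFunctor _ _ 0 ⟶ 𝟭 (ModuleCat.{u} R) where
  app M := homologyZeroι ((localizationChains w x).obj M) ≫ (chainsUnitIso w x M).inv
  naturality {M N} g := by
    have h : HomologicalComplex.homologyMap ((localizationChains w x).map g) 0 ≫
        homologyZeroι _ ≫ (chainsUnitIso w x N).inv =
        (homologyZeroι _ ≫ (chainsUnitIso w x M).inv) ≫ g := by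
      rw [← Category.assoc, homologyZeroι_naturality, Iso.comp_inv_eq, Category.assoc,
        Category.assoc]
      refine congrArg _ ?_
      rw [Iso.eq_inv_comp]
      exact (chainsUnit_naturality g).symm
    exact h

lemma chainsHomologyZeroι_injective (M : ModuleCat.{u} R) :
    Function.Injective ((chainsHomologyZeroι w x).app M).hom := by
  rw [← ModuleCat.mono_iff_injective]
  have : Mono (homologyZeroι ((localizationChains w x).obj M)) :=
    (ModuleCat.mono_iff_injective _).2 (homologyZeroι_injective _)
  exact mono_comp (homologyZeroι ((localizationChains w x).obj M)) ((chainsUnitIso w x M).inv)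

lemma range_chainsHomologyZeroι (hw : IsCovering w x) (M : ModuleCat.{u} R) :
    LinearMap.range ((chainsHomologyZeroι w x).app M).hom =
      torsionSubmodule (Ideal.span (Set.range x)) M := by
  let j : ((localizationChains w x).obj M).homology 0 ⟶ M :=
    homologyZeroι ((localizationChains w x).obj M) ≫ (chainsUnitIso w x M).inv
  have h1 : ∀ z, (chainsUnit w x M).hom (j.hom z) = (homologyZeroι _).hom z := fun z =>
    congrArg (fun t => t.hom z) (show j ≫ (chainsUnitIso w x M).hom = homologyZeroι _ by simp [j])
  change LinearMap.range j.hom = _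
  ext m
  rw [← d_chainsUnit_eq_zero_iff hw]
  constructor
  · rintro ⟨z, rfl⟩
    rw [h1, d_homologyZeroι]
  · intro h
    obtain ⟨z, hz⟩ := exists_homologyZeroι_eq _ _ h
    exact ⟨z, (bijective_chainsUnit M).1 ((h1 z).trans hz)⟩

lemma dimensionShift_chains [IsNoetherianRing R] (hw : IsCovering w x) :
    DimensionShift fun n => localizationChains w x ⋙ HomologicalComplex.homologyFunctor _ _ n :=
  dimensionShift_of_exact _ (localizationChains_shortExact w x)
    (isZero_homology_localizationChains hw)

variable (w x) in
/-- The truncation of the complex of chains, in which the empty chain is omitted. -/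
abbrev truncatedChains : ModuleCat.{u} R ⥤ CochainComplex (ModuleCat.{u} R) ℕ :=
  localizationChains w x ⋙ CochainComplex.truncate

lemma truncatedChains_shortExact (S : ShortComplex (ModuleCat.{u} R)) (hS : S.ShortExact) :
    (S.map (truncatedChains w x)).ShortExact :=
  shortExact_map_truncate _ (localizationChains_shortExact w x S hS)

lemma dimensionShift_truncatedChains [IsNoetherianRing R] (hw : IsCovering w x) :
    DimensionShift fun n => truncatedChains w x ⋙ HomologicalComplex.homologyFunctor _ _ n :=
  dimensionShift_of_exact _ truncatedChains_shortExact fun E hE n =>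
    isZero_homology_truncate _ n (isZero_homology_localizationChains hw E hE (n + 1))

variable (w x) in
/-- The map from a module to the truncated cochains of degree `0`. -/
def truncatedChainsUnit (M : ModuleCat.{u} R) : M ⟶ ((truncatedChains w x).obj M).X 0 :=
  chainsUnit w x M ≫ ((localizationChains w x).obj M).d 0 1

lemma truncatedChainsUnit_naturality {M N : ModuleCat.{u} R} (g : M ⟶ N) :
    g ≫ truncatedChainsUnit w x N =
      truncatedChainsUnit w x M ≫ ((truncatedChains w x).map g).f 0 := by
  have h : g ≫ chainsUnit w x N ≫ ((localizationChains w x).obj N).d 0 1 =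
      (chainsUnit w x M ≫ ((localizationChains w x).obj M).d 0 1) ≫
        ((localizationChains w x).map g).f 1 := by
    rw [← Category.assoc, chainsUnit_naturality, Category.assoc, Category.assoc,
      HomologicalComplex.Hom.comm]
  exact h

lemma truncatedChainsUnit_d (M : ModuleCat.{u} R) :
    truncatedChainsUnit w x M ≫ ((truncatedChains w x).obj M).d 0 1 = 0 := by
  have h : (chainsUnit w x M ≫ ((localizationChains w x).obj M).d 0 1) ≫
      ((localizationChains w x).obj M).d 1 2 = 0 := by
    rw [Category.assoc, HomologicalComplex.d_comp_d, comp_zero]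
  exact h

variable (w x) in
/-- The map from a module to the cohomology of the truncated chains in degree `0`. -/
def toTruncatedHomologyZeroApp (M : ModuleCat.{u} R) :
    M ⟶ ((truncatedChains w x).obj M).homology 0 :=
  ((truncatedChains w x).obj M).liftCycles (truncatedChainsUnit w x M) 1 (by simp)
    (truncatedChainsUnit_d M) ≫ ((truncatedChains w x).obj M).homologyπ 0

lemma toTruncatedHomologyZeroApp_ι (M : ModuleCat.{u} R) :
    toTruncatedHomologyZeroApp w x M ≫ homologyZeroι ((truncatedChains w x).obj M) =
      truncatedChainsUnit w x M := by
  rw [toTruncatedHomologyZeroApp, Category.assoc, homologyπ_homologyZeroι,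
    HomologicalComplex.liftCycles_i]

variable (w x) in
/-- The map from a module to the cohomology of the truncated chains in degree `0`, as a natural
transformation. -/
def toTruncatedHomologyZero : 𝟭 (ModuleCat.{u} R) ⟶
    truncatedChains w x ⋙ HomologicalComplex.homologyFunctor _ _ 0 where
  app M := toTruncatedHomologyZeroApp w x M
  naturality {M N} g := by
    have : Mono (homologyZeroι ((truncatedChains w x).obj N)) :=
      (ModuleCat.mono_iff_injective _).2 (homologyZeroι_injective _)
    have h : g ≫ toTruncatedHomologyZeroApp w x N = toTruncatedHomologyZeroApp w x M ≫
        HomologicalComplex.homologyMap ((truncatedChains w x).map g) 0 := by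
      rw [← cancel_mono (homologyZeroι ((truncatedChains w x).obj N)), Category.assoc,
        Category.assoc, toTruncatedHomologyZeroApp_ι, homologyZeroι_naturality,
        truncatedChainsUnit_naturality, ← Category.assoc, toTruncatedHomologyZeroApp_ι]
    exact h

lemma homologyZeroι_toTruncatedHomologyZeroApp (M : ModuleCat.{u} R) (m : M) :
    (homologyZeroι ((truncatedChains w x).obj M)).hom
      ((toTruncatedHomologyZeroApp w x M).hom m) =
      (((localizationChains w x).obj M).d 0 1).hom ((chainsUnit w x M).hom m) :=
  congrArg (fun t => t.hom m) (toTruncatedHomologyZeroApp_ι (w := w) (x := x) M)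

lemma ker_toTruncatedHomologyZero (hw : IsCovering w x) (M : ModuleCat.{u} R) :
    LinearMap.ker ((toTruncatedHomologyZero w x).app M).hom =
      torsionSubmodule (Ideal.span (Set.range x)) M := by
  change LinearMap.ker (toTruncatedHomologyZeroApp w x M).hom = _
  ext m
  rw [← d_chainsUnit_eq_zero_iff hw, LinearMap.mem_ker]
  have h := homologyZeroι_toTruncatedHomologyZeroApp (w := w) (x := x) M m
  constructor
  · intro h0
    rw [h0, map_zero] at h
    exact h.symm
  · intro h0
    exact homologyZeroι_injective _ ((h.trans h0).trans (map_zero _).symm)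

/-- A cocycle of degree zero in the truncation is one of degree one in the full complex, where for
an injective module it is a coboundary. -/
lemma toTruncatedHomologyZero_surjective [IsNoetherianRing R] (hw : IsCovering w x)
    (E : ModuleCat.{u} R) (hE : Injective E) :
    Function.Surjective ((toTruncatedHomologyZero w x).app E).hom := by
  change Function.Surjective (toTruncatedHomologyZeroApp w x E).hom
  intro z
  have h0 := isZero_homology_localizationChains hw E hE 0
  rw [← HomologicalComplex.exactAt_iff_isZero_homology,
    HomologicalComplex.exactAt_iff' _ 0 1 2 (by simp) (by simp),
    ShortComplex.moduleCat_exact_iff] at h0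
  obtain ⟨b, hb⟩ := h0 ((homologyZeroι ((truncatedChains w x).obj E)).hom z)
    (d_homologyZeroι ((truncatedChains w x).obj E) z)
  obtain ⟨m, rfl⟩ := (bijective_chainsUnit (w := w) (x := x) E).2 b
  exact ⟨m, homologyZeroι_injective _ ((homologyZeroι_toTruncatedHomologyZeroApp E m).trans hb)⟩

variable {P' : Type u} [PartialOrder P'] {B : Type u} {w' : P' → Finset B} {y : B → R}

/-- Both sides have the torsion submodule in degree zero, and it only sees the radical. The posets
may differ, which compares flags with vertices, and so may the families. -/
theorem nonempty_homology_chains_iso [IsNoetherianRing R] (hw : IsCovering w x)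
    (hw' : IsCovering w' y)
    (h : (Ideal.span (Set.range x)).radical = (Ideal.span (Set.range y)).radical)
    (M : ModuleCat.{u} R) (n : ℕ) :
    Nonempty (((localizationChains w x).obj M).homology n ≅
      ((localizationChains w' y).obj M).homology n) := by
  obtain ⟨θ⟩ := nonempty_iso_of_range_eq (chainsHomologyZeroι w x) (chainsHomologyZeroι w' y)
    chainsHomologyZeroι_injective chainsHomologyZeroι_injective fun M => by
      rw [range_chainsHomologyZeroι hw, range_chainsHomologyZeroι hw',
        torsionSubmodule_eq_of_radical_eq h]
  exact (dimensionShift_chains hw).nonempty_iso (dimensionShift_chains hw') θ n M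

/-- On injective modules degree zero is the quotient by the torsion submodule; left exactness
carries the comparison to all modules before the dimension shift. -/
theorem nonempty_homology_truncatedChains_iso [IsNoetherianRing R] (hw : IsCovering w x)
    (hw' : IsCovering w' y)
    (h : (Ideal.span (Set.range x)).radical = (Ideal.span (Set.range y)).radical)
    (M : ModuleCat.{u} R) (n : ℕ) :
    Nonempty (((truncatedChains w x).obj M).homology n ≅
      ((truncatedChains w' y).obj M).homology n) := by
  obtain ⟨θ⟩ := nonempty_iso_of_ker_eq
    (isLeftExact_homology_zero (truncatedChains w x) truncatedChains_shortExact)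
    (isLeftExact_homology_zero (truncatedChains w' y) truncatedChains_shortExact)
    (toTruncatedHomologyZero w x) (toTruncatedHomologyZero w' y)
    (toTruncatedHomologyZero_surjective hw) (toTruncatedHomologyZero_surjective hw') fun M => by
      rw [ker_toTruncatedHomologyZero (w := w) (x := x) hw, ker_toTruncatedHomologyZero hw',
        torsionSubmodule_eq_of_radical_eq h]
  exact (dimensionShift_truncatedChains hw).nonempty_iso (dimensionShift_truncatedChains hw') θ n M

end Chains

end

end Adelic

namespace Adelic

noncomputable section

/-! ### Evaluation of adelic cochains at flags. -/

section Evaluation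

variable {R : Type u} [CommRing R] {A : Type u} (x : A → R) (M : ModuleCat.{u} R)

/-- The map from a localization of `T` at `x_q` induced by a map from `T` to `M[1/x_τ]`, for
`q ⊆ τ`. -/
def liftTo {q : Simplex A} {τ : Finset A} (h : q.1 ≤ τ) {T : ModuleCat.{u} R}
    (g : T ⟶ (localizationSystem x M).obj τ) :
    ((localizations x).loc q).obj T ⟶ (localizationSystem x M).obj τ :=
  ModuleCat.ofHom (LocalizedModule.lift (Submonoid.powers (∏ a ∈ q.1, x a)) g.hom
    (isUnit_of_dvd (Finset.prod_dvd_prod_of_subset _ _ x h) M))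

variable {x M}

lemma unit_liftTo {q : Simplex A} {τ : Finset A} (h : q.1 ≤ τ) {T : ModuleCat.{u} R}
    (g : T ⟶ (localizationSystem x M).obj τ) :
    ((localizations x).unit q).app T ≫ liftTo x M h g = g := by
  ext : 1
  exact LocalizedModule.lift_comp _ _ _

lemma liftTo_hom_ext {q : Simplex A} {τ : Finset A} (h : q.1 ≤ τ) {T : ModuleCat.{u} R}
    {g g' : ((localizations x).loc q).obj T ⟶ (localizationSystem x M).obj τ}
    (e : ((localizations x).unit q).app T ≫ g = ((localizations x).unit q).app T ≫ g') :
    g = g' :=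
  away_hom_ext _ (Finset.prod_dvd_prod_of_subset _ _ x h) e

lemma map_liftTo {q : Simplex A} {τ : Finset A} (h : q.1 ≤ τ) {T T' : ModuleCat.{u} R}
    (φ : T ⟶ T') (g : T' ⟶ (localizationSystem x M).obj τ) :
    ((localizations x).loc q).map φ ≫ liftTo x M h g = liftTo x M h (φ ≫ g) := by
  apply liftTo_hom_ext h
  rw [unit_liftTo, ← Category.assoc, ← ((localizations x).unit q).naturality, Category.assoc,
    unit_liftTo]
  rfl

lemma liftTo_map {q : Simplex A} {τ ρ : Finset A} (h : q.1 ≤ τ) (h' : τ ≤ ρ)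
    {T : ModuleCat.{u} R} (g : T ⟶ (localizationSystem x M).obj τ) :
    liftTo x M h g ≫ (localizationSystem x M).map (homOfLE h') =
      liftTo x M (h.trans h') (g ≫ (localizationSystem x M).map (homOfLE h')) := by
  apply liftTo_hom_ext (h.trans h')
  rw [unit_liftTo, ← Category.assoc, unit_liftTo]

lemma liftTo_sum {q : Simplex A} {τ : Finset A} (h : q.1 ≤ τ) {T : ModuleCat.{u} R}
    {ι : Type*} (s : Finset ι) (n : ι → ℤ) (g : ι → (T ⟶ (localizationSystem x M).obj τ)) :
    liftTo x M h (∑ i ∈ s, n i • g i) = ∑ i ∈ s, n i • liftTo x M h (g i) := by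
  apply liftTo_hom_ext h
  rw [unit_liftTo, Preadditive.comp_sum]
  refine Finset.sum_congr rfl fun i _ => ?_
  rw [Preadditive.comp_zsmul, unit_liftTo]

lemma chainOmit_zero_lt {k : ℕ} (f : Fin (k + 1) ↪o (Simplex A)ᵒᵈ) (i : Fin k) :
    OrderDual.ofDual (chainOmit f 0 i) < OrderDual.ofDual (f 0) :=
  f.strictMono (Fin.succ_pos _)

lemma chainOmit_le {k : ℕ} {f : Fin (k + 1) ↪o (Simplex A)ᵒᵈ} {τ : Finset A}
    (h : ∀ i, (OrderDual.ofDual (f i)).1 ≤ τ) (j : Fin (k + 1)) (i : Fin k) :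
    (OrderDual.ofDual (chainOmit f j i)).1 ≤ τ :=
  h _

lemma chainOmit_lt {k : ℕ} {f : Fin (k + 1) ↪o (Simplex A)ᵒᵈ} {p : Simplex A}
    (h : ∀ i, OrderDual.ofDual (f i) < p) (j : Fin (k + 1)) (i : Fin k) :
    OrderDual.ofDual (chainOmit f j i) < p :=
  h _

variable (x M) in
/-- The evaluation of `tail k p` at a flag of length `k`. -/
def tailEval : (k : ℕ) → (p : Simplex A) → (f : Fin k ↪o (Simplex A)ᵒᵈ) →
    (∀ i, OrderDual.ofDual (f i) < p) → (τ : Finset A) → (∀ i, (OrderDual.ofDual (f i)).1 ≤ τ) →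
    (tail (localizations x) (const (Simplex A) M) k p ⟶ (localizationSystem x M).obj τ)
  | 0, _, _, _, τ, _ => (awayUnit (∏ a ∈ τ, x a)).app M
  | k + 1, _, f, hf, τ, h => tailProj _ _ k (hf 0) ≫
      liftTo x M (q := OrderDual.ofDual (f 0)) (h 0)
        (tailEval k (OrderDual.ofDual (f 0)) (chainOmit f 0)
          (chainOmit_zero_lt f) τ (chainOmit_le h 0))

lemma tailEval_succ {k : ℕ} {p q : Simplex A} (hq : q < p) (f : Fin (k + 1) ↪o (Simplex A)ᵒᵈ)
    (g : Fin k ↪o (Simplex A)ᵒᵈ) (hf : ∀ i, OrderDual.ofDual (f i) < p)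
    (hg : ∀ i, OrderDual.ofDual (g i) < q) {τ : Finset A} (h : ∀ i, (OrderDual.ofDual (f i)).1 ≤ τ)
    (h' : ∀ i, (OrderDual.ofDual (g i)).1 ≤ τ) (hqτ : q.1 ≤ τ) (e : OrderDual.ofDual (f 0) = q)
    (e' : chainOmit f 0 = g) :
    tailEval x M (k + 1) p f hf τ h = tailProj _ _ k hq ≫
      liftTo x M hqτ (tailEval x M k q g hg τ h') := by
  subst e e'
  rfl

lemma tailRes_tailEval (k : ℕ) {p q : Simplex A} (hq : q < p) (f : Fin k ↪o (Simplex A)ᵒᵈ)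
    (hf : ∀ i, OrderDual.ofDual (f i) < q) {τ : Finset A}
    (h : ∀ i, (OrderDual.ofDual (f i)).1 ≤ τ) :
    tailRes _ _ k hq ≫ tailEval x M k q f hf τ h =
      tailEval x M k p f (fun i => (hf i).trans hq) τ h := by
  cases k with
  | zero => exact Category.id_comp _
  | succ k =>
    rw [tailEval, tailRes, tailLift_proj_assoc]
    rfl

lemma tailEval_map (k : ℕ) {p : Simplex A} (f : Fin k ↪o (Simplex A)ᵒᵈ)
    (hf : ∀ i, OrderDual.ofDual (f i) < p) {τ ρ : Finset A}
    (h : ∀ i, (OrderDual.ofDual (f i)).1 ≤ τ)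
    (h' : τ ≤ ρ) :
    tailEval x M k p f hf τ h ≫ (localizationSystem x M).map (homOfLE h') =
      tailEval x M k p f hf ρ (fun i => (h i).trans h') := by
  induction k generalizing p with
  | zero => exact unit_awayMap (Finset.prod_dvd_prod_of_subset _ _ x h') M
  | succ k ih =>
    rw [tailEval, Category.assoc, liftTo_map, ih]
    rfl

lemma chainOmit_zero_omit {k : ℕ} {P : Type u} [PartialOrder P] (f : Fin (k + 2) ↪o P)
    (i : Fin (k + 1)) :
    chainOmit (chainOmit f i.succ) 0 = chainOmit (chainOmit f 0) i := by
  ext j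
  simp

/-- Both sides obey the same recursion: the coface of index zero inserts a unit, which `liftTo`
cancels, and the others act inside the outermost localization with their index, hence their sign,
shifted by one. -/
lemma tailDelta_tailEval (k : ℕ) {p : Simplex A} (f : Fin (k + 1) ↪o (Simplex A)ᵒᵈ)
    (hf : ∀ i, OrderDual.ofDual (f i) < p) {τ : Finset A}
    (h : ∀ i, (OrderDual.ofDual (f i)).1 ≤ τ) :
    tailDelta _ _ k p ≫ tailEval x M (k + 1) p f hf τ h = ∑ i : Fin (k + 1), (-1 : ℤ) ^ (i : ℕ) •
      tailEval x M k p (chainOmit f i) (chainOmit_lt hf i) τ (chainOmit_le h i) := by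
  induction k generalizing p with
  | zero =>
    rw [tailEval, ← Category.assoc, tailDelta_zero_proj, Category.assoc, unit_liftTo,
      tailRes_tailEval]
    simp
  | succ k ih =>
    rw [tailEval, ← Category.assoc, tailDelta_succ_proj, Preadditive.sub_comp, Category.assoc,
      unit_liftTo, tailRes_tailEval, Category.assoc, map_liftTo, ih, liftTo_sum,
      Preadditive.comp_sum, Fin.sum_univ_succ (n := k + 1), sub_eq_add_neg,
      ← Finset.sum_neg_distrib]
    congr 1
    · simp
    · refine Finset.sum_congr rfl fun i _ => ?_
      rw [Preadditive.comp_zsmul, Fin.val_succ, pow_succ, mul_neg_one, neg_smul,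
        tailEval_succ (hf 0) (chainOmit f i.succ) (chainOmit (chainOmit f 0) i) _
          (chainOmit_lt (chainOmit_zero_lt f) i) _ (chainOmit_le (chainOmit_le h 0) i) (h 0)
          (by simp) (chainOmit_zero_omit f i)]

variable (x M) in
/-- The evaluation of the adelic cochains at a flag. -/
def cochainsEval (s : ℕ) (f : Fin (s + 1) ↪o (Simplex A)ᵒᵈ) (τ : Finset A)
    (h : ∀ i, (OrderDual.ofDual (f i)).1 ≤ τ) :
    cochains (localizations x) (const (Simplex A) M) s ⟶ (localizationSystem x M).obj τ :=
  cochainsProj _ _ s (OrderDual.ofDual (f 0)) ≫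
    liftTo x M (q := OrderDual.ofDual (f 0)) (h 0)
      (tailEval x M s (OrderDual.ofDual (f 0)) (chainOmit f 0)
        (chainOmit_zero_lt f) τ (chainOmit_le h 0))

lemma cochainsEval_eq {s : ℕ} {q : Simplex A} (f : Fin (s + 1) ↪o (Simplex A)ᵒᵈ)
    (g : Fin s ↪o (Simplex A)ᵒᵈ)
    (hg : ∀ i, OrderDual.ofDual (g i) < q) {τ : Finset A} (h : ∀ i, (OrderDual.ofDual (f i)).1 ≤ τ)
    (h' : ∀ i, (OrderDual.ofDual (g i)).1 ≤ τ) (hqτ : q.1 ≤ τ) (e : OrderDual.ofDual (f 0) = q)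
    (e' : chainOmit f 0 = g) :
    cochainsEval x M s f τ h = cochainsProj _ _ s q ≫
      liftTo x M hqτ (tailEval x M s q g hg τ h') := by
  subst e e'
  rfl

lemma cochainsEval_map (s : ℕ) (f : Fin (s + 1) ↪o (Simplex A)ᵒᵈ) {τ ρ : Finset A}
    (h : ∀ i, (OrderDual.ofDual (f i)).1 ≤ τ) (h' : τ ≤ ρ) :
    cochainsEval x M s f τ h ≫ (localizationSystem x M).map (homOfLE h') =
      cochainsEval x M s f ρ (fun i => (h i).trans h') := by
  rw [cochainsEval, Category.assoc, liftTo_map, tailEval_map]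
  rfl

lemma delta_cochainsEval (s : ℕ) (f : Fin (s + 2) ↪o (Simplex A)ᵒᵈ) {τ : Finset A}
    (h : ∀ i, (OrderDual.ofDual (f i)).1 ≤ τ) :
    delta _ _ s ≫ cochainsEval x M (s + 1) f τ h = ∑ i : Fin (s + 2), (-1 : ℤ) ^ (i : ℕ) •
      cochainsEval x M s (chainOmit f i) τ (chainOmit_le h i) := by
  rw [cochainsEval, ← Category.assoc, delta_proj, Preadditive.sub_comp, Category.assoc,
    unit_liftTo, Category.assoc, map_liftTo, tailDelta_tailEval, liftTo_sum,
    Preadditive.comp_sum, Fin.sum_univ_succ (n := s + 1), sub_eq_add_neg, ← Finset.sum_neg_distrib]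
  congr 1
  · rw [tailEval, tailLift_proj_assoc]
    simp [cochainsEval]
  · refine Finset.sum_congr rfl fun i _ => ?_
    rw [Preadditive.comp_zsmul, Fin.val_succ, pow_succ, mul_neg_one, neg_smul,
      cochainsEval_eq (q := OrderDual.ofDual (f 0)) (chainOmit f i.succ)
        (chainOmit (chainOmit f 0) i)
        (chainOmit_lt (chainOmit_zero_lt f) i) _ (chainOmit_le (chainOmit_le h 0) i) (h 0) (by simp)
        (chainOmit_zero_omit f i)]

lemma augmentation_cochainsEval (f : Fin 1 ↪o (Simplex A)ᵒᵈ) {τ : Finset A}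
    (h : ∀ i, (OrderDual.ofDual (f i)).1 ≤ τ) :
    augmentation (localizations x) M ≫ cochainsEval x M 0 f τ h =
      (awayUnit (∏ a ∈ τ, x a)).app M := by
  rw [cochainsEval, ← Category.assoc, augmentation_proj]
  exact unit_liftTo (h 0) _

end Evaluation

end

end Adelic

namespace Adelic

noncomputable section

/-! ### Transitivity of localization. -/

section LocalizedModule

variable {R : Type*} [CommRing R] {T L W : Type*} [AddCommGroup T] [AddCommGroup L]
  [AddCommGroup W] [Module R T] [Module R L] [Module R W]

/-- An element of `L` comes from `T` after multiplication by some `s ∈ S`, and a multiple of `s`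
lies in `S'`; so the kernel of `h` can be controlled by that of `g`. -/
lemma isLocalizedModule_of_comp (S S' : Submonoid R) (hS : ∀ s ∈ S, ∃ d, d * s ∈ S')
    (m : T →ₗ[R] L) [IsLocalizedModule S m] (g : T →ₗ[R] W) [IsLocalizedModule S' g]
    (h : L →ₗ[R] W) (e : h ∘ₗ m = g) : IsLocalizedModule S' h where
  map_units := IsLocalizedModule.map_units g
  surj y := by
    obtain ⟨⟨t, s⟩, hs⟩ := IsLocalizedModule.surj S' g y
    exact ⟨⟨m t, s⟩, by rw [hs, ← e]; rfl⟩
  exists_of_eq {a b} hab := by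
    obtain ⟨⟨t, s⟩, hs⟩ := IsLocalizedModule.surj S m (a - b)
    have h0 : g t = 0 := by
      rw [← e, LinearMap.comp_apply, ← hs, Submonoid.smul_def, map_smul, map_sub, hab, sub_self,
        smul_zero]
    obtain ⟨c, hc⟩ := (IsLocalizedModule.eq_zero_iff S' g).1 h0
    obtain ⟨d, hd⟩ := hS s s.2
    refine ⟨c * ⟨d * s, hd⟩, ?_⟩
    rw [← sub_eq_zero, ← smul_sub, Submonoid.smul_def]
    have : ((c * ⟨d * s, hd⟩ : S') : R) = d * (c * s) := by
      change (c : R) * (d * s) = _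
      ring
    rw [this, mul_smul, mul_smul, ← Submonoid.smul_def s, hs, ← map_smul]
    change d • m (c • t) = 0
    rw [hc, map_zero, smul_zero]

lemma bijective_of_isLocalizedModule_comp (S : Submonoid R)
    (m : T →ₗ[R] L) [IsLocalizedModule S m] (g : T →ₗ[R] W) [IsLocalizedModule S g]
    (h : L →ₗ[R] W) (e : h ∘ₗ m = g) : Function.Bijective h := by
  have : h = IsLocalizedModule.linearEquiv S m g := by
    apply IsLocalizedModule.ext S m (IsLocalizedModule.map_units g)
    rw [e]
    ext t
    simp
  rw [this]
  exact LinearEquiv.bijective _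

end LocalizedModule

/-! ### Flags below a simplex. -/

section Flags

variable {A : Type u}

/-- The flags of length `k` below `p`. -/
abbrev FlagBelow (k : ℕ) (p : Simplex A) : Type u :=
  {f : Fin k ↪o (Simplex A)ᵒᵈ // ∀ i, OrderDual.ofDual (f i) < p}

lemma flag_le {k : ℕ} {p : Simplex A} {τ : Finset A} (h : p.1 ≤ τ) (f : FlagBelow k p)
    (i : Fin k) : (OrderDual.ofDual (f.1 i)).1 ≤ τ :=
  (show (OrderDual.ofDual (f.1 i)).1 ≤ p.1 from (f.2 i).le).trans h

lemma exists_flag_cons {k : ℕ} {q : Simplex A} (g : FlagBelow k q) :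
    ∃ f : Fin (k + 1) ↪o (Simplex A)ᵒᵈ, OrderDual.ofDual (f 0) = q ∧ chainOmit f 0 = g.1 := by
  refine ⟨OrderEmbedding.ofStrictMono (Fin.cons (OrderDual.toDual q) g.1) ?_, rfl, ?_⟩
  · intro i j hij
    induction j using Fin.cases with
    | zero => simp at hij
    | succ j =>
      induction i using Fin.cases with
      | zero => exact g.2 j
      | succ i => exact g.1.strictMono (by simpa using hij)
  · ext j
    rfl

lemma flag_ext {k : ℕ} {f g : Fin (k + 1) ↪o (Simplex A)ᵒᵈ} (h : f 0 = g 0)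
    (h' : chainOmit f 0 = chainOmit g 0) : f = g := by
  refine RelEmbedding.ext fun j => ?_
  induction j using Fin.cases with
  | zero => exact h
  | succ j => exact congrArg (fun f => f j) h'

lemma lt_of_zero_lt {k : ℕ} {f : Fin (k + 1) ↪o (Simplex A)ᵒᵈ} {p : Simplex A}
    (h : OrderDual.ofDual (f 0) < p) (i : Fin (k + 1)) : OrderDual.ofDual (f i) < p :=
  lt_of_le_of_lt (f.monotone (Fin.zero_le i)) h

lemma bijective_flagBelow (k : ℕ) (p : Simplex A) :
    Function.Bijective (fun f : FlagBelow (k + 1) p =>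
      (⟨⟨OrderDual.ofDual (f.1 0), f.2 0⟩, chainOmit f.1 0, chainOmit_zero_lt f.1⟩ :
        Σ q : {q : Simplex A // q < p}, FlagBelow k q.1)) := by
  constructor
  · rintro ⟨f, hf⟩ ⟨g, hg⟩ h
    have h0 : f 0 = g 0 := congrArg (fun z => z.1.1) h
    have h1 : chainOmit f 0 = chainOmit g 0 := congrArg (fun z => z.2.1) h
    exact Subtype.ext (flag_ext h0 h1)
  · rintro ⟨⟨q, hq⟩, g⟩
    obtain ⟨f, rfl, hf⟩ := exists_flag_cons g
    refine ⟨⟨f, lt_of_zero_lt hq⟩, ?_⟩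
    obtain ⟨g, hg⟩ := g
    subst hf
    rfl

/-- This finiteness is what lets localization commute with the inner products of the adelic
cochains. -/
instance finite_lt (p : Simplex A) : Finite {q : Simplex A // q < p} := by
  classical
  refine Finite.of_injective (β := {τ : Finset A // τ ∈ p.1.powerset})
    (fun q => ⟨q.1.1, Finset.mem_powerset.2 q.2.le⟩) fun q q' h => ?_
  exact Subtype.ext (Subtype.ext (by simpa using h))

end Flags

/-! ### The nested localizations collapse to a product over flags. -/

section Evaluation

variable {R : Type u} [CommRing R] {A : Type u} {x : A → R} {M : ModuleCat.{u} R}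

lemma exists_mul_mem_powers {r r' : R} (h : r ∣ r') :
    ∀ s ∈ Submonoid.powers r, ∃ d, d * s ∈ Submonoid.powers r' := by
  rintro _ ⟨k, rfl⟩
  obtain ⟨d, hd⟩ := pow_dvd_pow_of_dvd h k
  exact ⟨d, k, by change r' ^ k = _; rw [hd, mul_comm]⟩

lemma pi_liftTo_comp {q : Simplex A} {τ : Finset A} (h : q.1 ≤ τ) {T : ModuleCat.{u} R}
    {ι : Type u} (g : ι → (T ⟶ (localizationSystem x M).obj τ)) :
    (LinearMap.pi fun i => (liftTo x M h (g i)).hom) ∘ₗ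
      (((localizations x).unit q).app T).hom = LinearMap.pi fun i => (g i).hom := by
  refine LinearMap.ext fun t => funext fun i => ?_
  exact congrArg (fun φ => φ.hom t) (unit_liftTo h (g i))

variable (x M) in
/-- The modules `tail k p` of the localizations at the products of the `x_a`. -/
abbrev localizationTail (k : ℕ) (p : Simplex A) : ModuleCat.{u} R :=
  tail (localizations x) (const (Simplex A) M) k p

variable (x M) in
/-- The adelic cochains of the localizations at the products of the `x_a`. -/
abbrev localizationCochains (s : ℕ) : ModuleCat.{u} R :=
  cochains (localizations x) (const (Simplex A) M) s

variable (x M) in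
/-- The projection to the factor of all flags that start at `p`. -/
abbrev localizationCochainsProj (s : ℕ) (p : Simplex A) :
    localizationCochains x M s →ₗ[R]
      ((localizations x).loc p).obj (localizationTail x M s p) :=
  (cochainsProj (localizations x) (const (Simplex A) M) s p).hom

variable (x M) in
/-- The adelic cochains as a product of modules. -/
def localizationCochainsEquiv (s : ℕ) : localizationCochains x M s ≃ₗ[R]
    ∀ p : Simplex A, ((localizations x).loc p).obj (localizationTail x M s p) :=
  (ModuleCat.piIsoPi fun p : Simplex A =>
    ((localizations x).loc p).obj (localizationTail x M s p)).toLinearEquiv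

lemma localizationCochainsEquiv_apply (s : ℕ) (c : localizationCochains x M s) (p : Simplex A) :
    localizationCochainsEquiv x M s c p = localizationCochainsProj x M s p c :=
  congrArg (fun φ : localizationCochains x M s ⟶ _ => φ.hom c)
    (ModuleCat.piIsoPi_hom_ker_subtype (fun p : Simplex A =>
      ((localizations x).loc p).obj (localizationTail x M s p)) p)

instance isLocalizedModule_unit (q : Simplex A) (T : ModuleCat.{u} R) :
    IsLocalizedModule (Submonoid.powers (∏ a ∈ q.1, x a))
      (((localizations x).unit q).app T).hom :=
  inferInstanceAs (IsLocalizedModule _ (LocalizedModule.mkLinearMap (Submonoid.powers _) T))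

instance isLocalizedModule_awayUnit (r : R) (T : ModuleCat.{u} R) :
    IsLocalizedModule (Submonoid.powers r) ((awayUnit r).app T).hom :=
  inferInstanceAs (IsLocalizedModule _ (LocalizedModule.mkLinearMap (Submonoid.powers _) T))

/-- Below a simplex, the evaluations at the flags exhibit the product of the modules `M[1/x_τ]` as
a localization of `tail k p`. -/
lemma isLocalizedModule_tailEval (k : ℕ) {p : Simplex A} {τ : Finset A} (hp : p.1 ≤ τ) :
    IsLocalizedModule (Submonoid.powers (∏ a ∈ τ, x a)) (LinearMap.pi fun f : FlagBelow k p =>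
      (tailEval x M k p f.1 f.2 τ (flag_le hp f)).hom) := by
  induction k generalizing p with
  | zero =>
    let f₀ : FlagBelow 0 p := ⟨(OrderEmbedding.ofIsEmpty), fun i => i.elim0⟩
    have : Unique (FlagBelow 0 p) :=
      { default := f₀, uniq := fun f => Subtype.ext (RelEmbedding.ext fun i => i.elim0) }
    exact IsLocalizedModule.of_linearEquiv (Submonoid.powers (∏ a ∈ τ, x a))
      ((awayUnit (∏ a ∈ τ, x a)).app M).hom
      (LinearEquiv.funUnique (FlagBelow 0 p) R ((localizationSystem x M).obj τ)).symm
  | succ k ih =>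
    have hq : ∀ q : {q : Simplex A // q < p}, q.1.1 ≤ τ := fun q =>
      (show q.1.1 ≤ p.1 from q.2.le).trans hp
    let g := fun q : {q : Simplex A // q < p} => LinearMap.pi fun f : FlagBelow k q.1 =>
      (liftTo x M (hq q) (tailEval x M k q.1 f.1 f.2 τ (flag_le (hq q) f))).hom
    -- Since `x_q` divides `x_τ`, the localization of `tail k q` at `x_τ` factors through that at
    -- `x_q`, and the second map is again a localization at `x_τ`.
    have hg : ∀ q, IsLocalizedModule (Submonoid.powers (∏ a ∈ τ, x a)) (g q) := fun q =>
      have := ih (hq q)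
      isLocalizedModule_of_comp (Submonoid.powers (∏ a ∈ q.1.1, x a)) _
        (exists_mul_mem_powers (Finset.prod_dvd_prod_of_subset _ _ x (hq q))) _ _ _
        (pi_liftTo_comp (hq q) _)
    have h1 := IsLocalizedModule.pi (Submonoid.powers (∏ a ∈ τ, x a)) g
    let e1 : localizationTail x M (k + 1) p ≃ₗ[R] ∀ q : {q : Simplex A // q < p},
        ((localizations x).loc q.1).obj (localizationTail x M k q.1) :=
      (ModuleCat.piIsoPi fun q : {q : Simplex A // q < p} =>
        ((localizations x).loc q.1).obj (localizationTail x M k q.1)).toLinearEquiv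
    let e2 := (LinearEquiv.piCurry R (fun (q : {q : Simplex A // q < p}) (_ : FlagBelow k q.1) =>
      (localizationSystem x M).obj τ)).symm
    let e3 := LinearEquiv.funCongrLeft R ((localizationSystem x M).obj τ)
      (Equiv.ofBijective _ (bijective_flagBelow k p))
    have h2 := IsLocalizedModule.of_linearEquiv_right (Submonoid.powers (∏ a ∈ τ, x a)) _ e1
      (hf := IsLocalizedModule.of_linearEquiv (Submonoid.powers (∏ a ∈ τ, x a)) _ (e2.trans e3)
        (hf := h1))
    refine (congrArg (IsLocalizedModule _) (LinearMap.ext fun t => funext fun f => ?_)).mpr h2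
    have h3 : e1 t ⟨OrderDual.ofDual (f.1 0), f.2 0⟩ =
        (tailProj (localizations x) (const (Simplex A) M) k (f.2 0)).hom t :=
      congrArg (fun φ : localizationTail x M (k + 1) p ⟶ _ => φ.hom t)
        (ModuleCat.piIsoPi_hom_ker_subtype _ _)
    exact DFunLike.congr_arg (liftTo x M (q := OrderDual.ofDual (f.1 0)) (flag_le hp f 0)
      (tailEval x M k (OrderDual.ofDual (f.1 0)) (chainOmit f.1 0)
        (chainOmit_zero_lt f.1) τ (chainOmit_le (flag_le hp f) 0))).hom h3.symm

/-- For `τ = p` the unit and the product of the evaluations are both localizations of `tail k p` at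
`x_p`. -/
lemma bijective_liftTo_tailEval (k : ℕ) (p : Simplex A) :
    Function.Bijective (LinearMap.pi fun f : FlagBelow k p =>
      (liftTo x M (q := p) le_rfl (tailEval x M k p f.1 f.2 p.1 (flag_le le_rfl f))).hom) :=
  have := isLocalizedModule_tailEval (x := x) (M := M) k (p := p) le_rfl
  bijective_of_isLocalizedModule_comp (Submonoid.powers (∏ a ∈ p.1, x a))
    (((localizations x).unit p).app (localizationTail x M k p)).hom _ _ (pi_liftTo_comp le_rfl _)

lemma chainSupport_flagSet {s : ℕ} (f : Fin (s + 1) ↪o (Simplex A)ᵒᵈ) :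
    chainSupport flagSet f = (OrderDual.ofDual (f 0)).1 := by
  ext a
  rw [mem_chainSupport]
  exact ⟨fun ⟨i, hi⟩ => (show (OrderDual.ofDual (f i)).1 ≤ (OrderDual.ofDual (f 0)).1 from
    f.monotone (Fin.zero_le i)) hi, fun h => ⟨0, h⟩⟩

lemma flag_le_chainSupport {s : ℕ} (f : Fin s ↪o (Simplex A)ᵒᵈ) (i : Fin s) :
    (OrderDual.ofDual (f i)).1 ≤ chainSupport flagSet f :=
  fun a ha => (mem_chainSupport flagSet f a).2 ⟨i, ha⟩

variable (x M) in
/-- The comparison of the adelic cochains with the cochains on flags. -/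
def cochainsToFlags (s : ℕ) : cochains (localizations x) (const (Simplex A) M) s ⟶
    ((localizationChains (flagSet (A := A)) x).obj M).X (s + 1) :=
  ModuleCat.ofHom (LinearMap.pi fun f : Fin (s + 1) ↪o (Simplex A)ᵒᵈ =>
    (cochainsEval x M s f (chainSupport flagSet f) (flag_le_chainSupport f)).hom)

lemma cochainsEval_hom_map (s : ℕ) (f : Fin (s + 1) ↪o (Simplex A)ᵒᵈ) {τ ρ : Finset A}
    (h : ∀ i, (OrderDual.ofDual (f i)).1 ≤ τ) (h' : τ ≤ ρ)
    (c : localizationCochains x M s) :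
    ((localizationSystem x M).map (homOfLE h')).hom ((cochainsEval x M s f τ h).hom c) =
      (cochainsEval x M s f ρ (fun i => (h i).trans h')).hom c :=
  congrArg (fun φ : localizationCochains x M s ⟶ _ => φ.hom c) (cochainsEval_map s f h h')

lemma cochainsEval_hom {s : ℕ} {q : Simplex A} (f : Fin (s + 1) ↪o (Simplex A)ᵒᵈ)
    (g : FlagBelow s q) (h : ∀ i, (OrderDual.ofDual (f i)).1 ≤ q.1)
    (e : OrderDual.ofDual (f 0) = q) (e' : chainOmit f 0 = g.1)
    (c : localizationCochains x M s) :
    (cochainsEval x M s f q.1 h).hom c =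
      (liftTo x M le_rfl (tailEval x M s q g.1 g.2 q.1 (flag_le le_rfl g))).hom
        (localizationCochainsProj x M s q c) :=
  congrArg (fun φ : localizationCochains x M s ⟶ _ => φ.hom c)
    (cochainsEval_eq f g.1 g.2 h (flag_le le_rfl g) le_rfl e e')

/-- Group the flags by their first, hence largest, member `p` and apply `bijective_liftTo_tailEval`
to each group. The product over `p` may be infinite, but it stands outside all localizations. -/
lemma bijective_cochainsToFlags (s : ℕ) : Function.Bijective (cochainsToFlags x M s).hom := by
  constructor
  · rw [injective_iff_map_eq_zero]
    intro c hc
    apply (localizationCochainsEquiv x M s).injective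
    rw [map_zero]
    funext p
    rw [localizationCochainsEquiv_apply]
    apply (bijective_liftTo_tailEval s p).1
    refine Eq.trans (funext fun g => ?_) (map_zero _).symm
    obtain ⟨f, hf, hf'⟩ := exists_flag_cons g
    have hs : chainSupport flagSet f ≤ p.1 := by rw [chainSupport_flagSet, hf]
    have h0 : (cochainsEval x M s f (chainSupport flagSet f) (flag_le_chainSupport f)).hom c =
      0 := congrFun hc f
    have h1 := cochainsEval_hom_map s f (flag_le_chainSupport f) hs c
    rw [h0, map_zero] at h1
    exact (cochainsEval_hom f g _ hf hf' c).symm.trans h1.symm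
  · intro b
    choose flag h0 h1 using fun p => exists_flag_cons (A := A) (k := s) (q := p)
    have hs : ∀ p g, chainSupport flagSet (flag p g) ≤ p.1 := fun p g => by
      rw [chainSupport_flagSet, h0]
    choose c hc using fun p => (bijective_liftTo_tailEval (x := x) (M := M) s p).2 fun g =>
      resMap (localizationSystem x M) (hs p g) (b (flag p g))
    refine ⟨(localizationCochainsEquiv x M s).symm c, funext fun f => ?_⟩
    have hf : chainSupport flagSet f ≤ (OrderDual.ofDual (f 0)).1 := (chainSupport_flagSet f).le
    have hf' : (OrderDual.ofDual (f 0)).1 ≤ chainSupport flagSet f := (chainSupport_flagSet f).ge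
    -- The support of a flag equals its first member only propositionally, so values are compared
    -- after transport along `hf`, which `hf'` inverts.
    apply Function.LeftInverse.injective (g := resMap (localizationSystem x M) hf')
      (f := resMap (localizationSystem x M) hf)
    · intro m
      rw [resMap_resMap, resMap_rfl]
    refine (cochainsEval_hom_map s f (flag_le_chainSupport f) hf _).trans ?_
    let g : FlagBelow s (OrderDual.ofDual (f 0)) := ⟨chainOmit f 0, chainOmit_zero_lt f⟩
    rw [cochainsEval_hom f g _ rfl rfl, ← localizationCochainsEquiv_apply,
      LinearEquiv.apply_symm_apply]
    refine (congrFun (hc _) g).trans ?_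
    have key : ∀ f' (_ : f' = f) (h : chainSupport flagSet f' ≤ (OrderDual.ofDual (f 0)).1),
        resMap (localizationSystem x M) h (b f') = resMap (localizationSystem x M) hf (b f) := by
      rintro f' rfl h
      rfl
    exact key _ (flag_ext (h0 _ g) (h1 _ g)) _

end Evaluation

end

end Adelic

namespace Adelic

noncomputable section

lemma nonempty_iso_of_bijective {R : Type u} [CommRing R]
    {C D : CochainComplex (ModuleCat.{u} R) ℕ} (f : ∀ n, C.X n ⟶ D.X n)
    (hf : ∀ n, Function.Bijective (f n).hom)
    (h : ∀ n, f n ≫ D.d n (n + 1) = C.d n (n + 1) ≫ f (n + 1)) : Nonempty (C ≅ D) := by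
  have := fun n => (ConcreteCategory.isIso_iff_bijective (f n)).2 (hf n)
  refine ⟨HomologicalComplex.Hom.isoOfComponents (fun n => asIso (f n)) ?_⟩
  rintro i _ rfl
  exact h i

/-! ### The adelic complexes as complexes of flags. -/

section Flags

variable {R : Type u} [CommRing R] {A : Type u} (x : A → R) (M : ModuleCat.{u} R)

lemma localizationChains_d {P : Type u} [PartialOrder P] (w : P → Finset A) (n : ℕ) :
    ((localizationChains w x).obj M).d n (n + 1) =
      ModuleCat.ofHom (chainDelta w (localizationSystem x M) n) :=
  chainComplexObj_d w _ n

lemma cochainsToFlags_d (s : ℕ) :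
    cochainsToFlags x M s ≫ ((localizationChains flagSet x).obj M).d (s + 1) (s + 1 + 1) =
      delta (localizations x) (const (Simplex A) M) s ≫ cochainsToFlags x M (s + 1) := by
  rw [localizationChains_d]
  ext c
  funext f
  refine (chainDelta_apply flagSet (localizationSystem x M) _ f).trans ?_
  have h : ((delta (localizations x) (const (Simplex A) M) s ≫ cochainsEval x M (s + 1) f
      (chainSupport flagSet f) (flag_le_chainSupport f)).hom c) = _ :=
    congrArg (fun φ : localizationCochains x M s ⟶ _ => φ.hom c)
      (delta_cochainsEval s f (flag_le_chainSupport f))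
  refine Eq.trans ?_ h.symm
  rw [ModuleCat.hom_sum, LinearMap.sum_apply]
  refine Finset.sum_congr rfl fun i _ => ?_
  exact congrArg (((-1 : ℤ) ^ (i : ℕ)) • ·) (cochainsEval_hom_map s (chainOmit f i)
    (flag_le_chainSupport _) (chainSupport_omit_le flagSet f i) c)

lemma chainsUnit_flags_d :
    chainsUnit (flagSet (A := A)) x M ≫ ((localizationChains flagSet x).obj M).d 0 1 =
      augmentation (localizations x) M ≫ cochainsToFlags x M 0 := by
  rw [localizationChains_d]
  ext m
  funext f
  refine (chainDelta_chainsUnit m f).trans ?_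
  exact (congrArg (fun φ : M ⟶ _ => φ.hom m)
    (augmentation_cochainsEval f (flag_le_chainSupport f))).symm

lemma nonempty_augmentedComplex_iso : Nonempty (augmentedComplex (localizations x) M ≅
    (localizationChains (flagSet (A := A)) x).obj M) := by
  refine nonempty_iso_of_bijective (fun n => match n with
    | 0 => chainsUnit flagSet x M
    | s + 1 => cochainsToFlags x M s) ?_ ?_
  · rintro (_ | s)
    · exact bijective_chainsUnit M
    · exact bijective_cochainsToFlags s
  · rintro (_ | s)
    · exact chainsUnit_flags_d x M
    · refine (cochainsToFlags_d x M s).trans (congrArg (· ≫ cochainsToFlags x M (s + 1)) ?_)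
      exact (CochainComplex.of_d (cochains (localizations x) (const (Simplex A) M))
        (delta (localizations x) (const (Simplex A) M)) s).symm

lemma nonempty_complex_iso : Nonempty (complex (localizations x) (const (Simplex A) M) ≅
    (truncatedChains (flagSet (A := A)) x).obj M) := by
  obtain ⟨e⟩ := nonempty_augmentedComplex_iso x M
  exact ⟨(CochainComplex.truncateAugment _ _ _).symm ≪≫ CochainComplex.truncate.mapIso e⟩

end Flags

/-! ### The Koszul and Čech complexes as complexes of chains of vertices. -/

section Vertices

variable {R : Type u} [CommRing R]

lemma bijective_resMap {A : Type u} (N : Finset A ⥤ ModuleCat.{u} R) {σ τ : Finset A} (h : σ = τ) :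
    Function.Bijective (resMap N h.le) := by
  subst h
  exact (funext fun m => resMap_rfl N m : ⇑(resMap N (le_refl σ)) = id) ▸ Function.bijective_id

variable {A : Type u} [LinearOrder A]

lemma chainSupport_vertices {n : ℕ} (f : Fin n ↪o A) :
    chainSupport (fun a : A => {a}) f = vertices f := by
  ext a
  rw [mem_chainSupport]
  simp [vertices, eq_comm]

variable (N : Finset A ⥤ ModuleCat.{u} R)

/-- The comparison of the simplicial cochains with the cochains on chains of vertices. -/
def simpCochainsToChains (n : ℕ) :
    simpCochains N n ⟶ ModuleCat.of R (ChainCochain (fun a : A => {a}) N n) :=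
  ModuleCat.ofHom (LinearMap.pi fun f : Fin n ↪o A =>
    resMap N (chainSupport_vertices f).ge ∘ₗ (simpProj N f).hom)

lemma bijective_simpCochainsToChains (n : ℕ) :
    Function.Bijective (simpCochainsToChains N n).hom := by
  let e : (simpCochains N n : ModuleCat.{u} R) ≃ₗ[R] ∀ f : Fin n ↪o A, N.obj (vertices f) :=
    (ModuleCat.piIsoPi fun f : Fin n ↪o A => N.obj (vertices f)).toLinearEquiv
  have he : ∀ c f, e c f = (simpProj N f).hom c := fun c f =>
    congrArg (fun φ : simpCochains N n ⟶ _ => φ.hom c) (ModuleCat.piIsoPi_hom_ker_subtype _ f)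
  have h : ⇑(simpCochainsToChains N n).hom =
      Pi.map (fun f : Fin n ↪o A => resMap N (chainSupport_vertices f).ge) ∘ e := by
    funext c f
    exact congrArg (resMap N _) (he c f).symm
  rw [h]
  refine Function.Bijective.comp ?_ e.bijective
  exact Function.Bijective.piMap fun f => bijective_resMap N (chainSupport_vertices f).symm

lemma simpDelta_proj {n : ℕ} (f : Fin (n + 1) ↪o A) :
    simpDelta N n ≫ simpProj N f = ∑ i : Fin (n + 1), (-1 : ℤ) ^ (i : ℕ) •
      (simpProj N (omitVertex f i) ≫ N.map (homOfLE (vertices_omit_le f i))) :=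
  simpLift_proj N _ f

lemma simpCochainsToChains_d (n : ℕ) :
    simpCochainsToChains N n ≫ (chainComplexObj (fun a : A => {a}) N).d n (n + 1) =
      simpDelta N n ≫ simpCochainsToChains N (n + 1) := by
  rw [chainComplexObj_d]
  ext c
  funext f
  refine (chainDelta_apply (fun a : A => {a}) N _ f).trans ?_
  have h : (simpProj N f).hom ((simpDelta N n).hom c) = _ :=
    congrArg (fun φ : simpCochains N n ⟶ _ => φ.hom c) (simpDelta_proj N f)
  refine Eq.trans ?_ (congrArg (resMap N (chainSupport_vertices f).ge) h).symm
  rw [ModuleCat.hom_sum, LinearMap.sum_apply, map_sum]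
  refine Finset.sum_congr rfl fun i _ => ?_
  refine Eq.trans ?_ (map_zsmul (resMap N (chainSupport_vertices f).ge) _ _).symm
  refine congrArg (((-1 : ℤ) ^ (i : ℕ)) • ·) ?_
  refine (resMap_resMap N _ _ _).trans ?_
  exact (resMap_resMap N (vertices_omit_le f i) (chainSupport_vertices f).ge _).symm

lemma nonempty_augmentedSimplicialComplex_iso :
    Nonempty (augmentedSimplicialComplex N ≅ chainComplexObj (fun a : A => {a}) N) := by
  refine nonempty_iso_of_bijective (simpCochainsToChains N) (bijective_simpCochainsToChains N)
    fun n => (simpCochainsToChains_d N n).trans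
      (congrArg (· ≫ simpCochainsToChains N (n + 1)) ?_)
  exact (CochainComplex.of_d (simpCochains N) (simpDelta N) n).symm

lemma nonempty_simplicialComplex_iso :
    Nonempty (simplicialComplex N ≅
      CochainComplex.truncate.obj (chainComplexObj (fun a : A => {a}) N)) := by
  obtain ⟨e⟩ := nonempty_augmentedSimplicialComplex_iso N
  exact ⟨CochainComplex.truncate.mapIso e⟩

end Vertices

/-! ### The resulting identifications of cohomology. -/

section Cohomology

variable {R : Type u} [CommRing R] {A : Type u} (x : A → R) (M : ModuleCat.{u} R) (n : ℕ)

lemma nonempty_augmentedAdelicCohomology_iso : Nonempty (augmentedAdelicCohomology x M n ≅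
    ((localizationChains (flagSet (A := A)) x).obj M).homology n) :=
  (nonempty_augmentedComplex_iso x M).map (HomologicalComplex.homologyFunctor _ _ n).mapIso

lemma nonempty_adelicCohomology_iso : Nonempty (adelicCohomology x M n ≅
    ((truncatedChains (flagSet (A := A)) x).obj M).homology n) :=
  (nonempty_complex_iso x M).map (HomologicalComplex.homologyFunctor _ _ n).mapIso

lemma nonempty_stableKoszulCohomology_iso [LinearOrder A] :
    Nonempty (stableKoszulCohomology x M n ≅
      ((localizationChains (fun a : A => {a}) x).obj M).homology n) :=
  (nonempty_augmentedSimplicialComplex_iso (localizationSystem x M)).map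
    (HomologicalComplex.homologyFunctor _ _ n).mapIso

lemma nonempty_cechCohomology_iso [LinearOrder A] :
    Nonempty (cechCohomology x M n ≅
      ((truncatedChains (fun a : A => {a}) x).obj M).homology n) :=
  (nonempty_simplicialComplex_iso (localizationSystem x M)).map
    (HomologicalComplex.homologyFunctor _ _ n).mapIso

end Cohomology

end

end Adelic

namespace Adelic

noncomputable section

/-! ### Long exact sequences from functors that are exact on projectives. -/

section DerivedSequence

universe v₁ v₂ u₁ u₂

variable {C : Type u₁} [Category.{v₁} C] [Abelian C] {D : Type u₂} [Category.{v₂} D] [Abelian D]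
variable {F G H : C ⥤ D} [F.Additive] [G.Additive] [H.Additive] (α : F ⟶ G) (β : G ⟶ H)
  (w : ∀ X, α.app X ≫ β.app X = 0)

/-- The short complex of complexes obtained from a short complex of functors. -/
def mapComplexes (P : ChainComplex C ℕ) : ShortComplex (ChainComplex D ℕ) :=
  ShortComplex.mk ((NatTrans.mapHomologicalComplex α _).app P)
    ((NatTrans.mapHomologicalComplex β _).app P) (by ext n; exact w _)

/-- Functoriality of `mapComplexes`. -/
def mapComplexesMap {P Q : ChainComplex C ℕ} (φ : P ⟶ Q) :
    mapComplexes α β w P ⟶ mapComplexes α β w Q where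
  τ₁ := (F.mapHomologicalComplex _).map φ
  τ₂ := (G.mapHomologicalComplex _).map φ
  τ₃ := (H.mapHomologicalComplex _).map φ
  comm₁₂ := (NatTrans.mapHomologicalComplex α _).naturality φ
  comm₂₃ := (NatTrans.mapHomologicalComplex β _).naturality φ

/-- Functors that form short exact sequences on projective objects. -/
def ExactOnProjectives : Prop :=
  ∀ P : C, Projective P → (ShortComplex.mk (α.app P) (β.app P) (w P)).ShortExact

variable {α β w}

lemma ExactOnProjectives.shortExact (h : ExactOnProjectives α β w) {X : C}
    (P : ProjectiveResolution X) : (mapComplexes α β w P.complex).ShortExact :=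
  HomologicalComplex.shortExact_of_degreewise_shortExact _ fun n => h _ (P.projective n)

/-- The connecting map for a projective resolution. -/
def ExactOnProjectives.connecting (h : ExactOnProjectives α β w) {X : C}
    (P : ProjectiveResolution X) (n : ℕ) :
    (HomologicalComplex.homologyFunctor D _ (n + 1)).obj
        ((H.mapHomologicalComplex _).obj P.complex) ⟶
      (HomologicalComplex.homologyFunctor D _ n).obj ((F.mapHomologicalComplex _).obj P.complex) :=
  (h.shortExact P).δ (n + 1) n (by simp)

lemma ExactOnProjectives.connecting_naturality (h : ExactOnProjectives α β w) {X Y : C}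
    (P : ProjectiveResolution X) (Q : ProjectiveResolution Y) (φ : P.complex ⟶ Q.complex) (n : ℕ) :
    (H.mapHomologicalComplex _ ⋙ HomologicalComplex.homologyFunctor D _ (n + 1)).map φ ≫
        h.connecting Q n =
      h.connecting P n ≫
        (F.mapHomologicalComplex _ ⋙ HomologicalComplex.homologyFunctor D _ n).map φ :=
  (HomologicalComplex.HomologySequence.δ_naturality (mapComplexesMap α β w φ)
    (h.shortExact P) (h.shortExact Q) (n + 1) n (by simp)).symm

lemma ExactOnProjectives.connecting_comp (h : ExactOnProjectives α β w) {X : C}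
    (P : ProjectiveResolution X) (n : ℕ) :
    h.connecting P n ≫ (HomologicalComplex.homologyFunctor D _ n).map
      ((NatTrans.mapHomologicalComplex α _).app P.complex) = 0 :=
  (h.shortExact P).δ_comp (n + 1) n (by simp)

lemma ExactOnProjectives.exact_connecting (h : ExactOnProjectives α β w) {X : C}
    (P : ProjectiveResolution X) (n : ℕ) :
    (ShortComplex.mk _ _ (h.connecting_comp P n)).Exact :=
  (h.shortExact P).homology_exact₁ (n + 1) n (by simp)

variable [HasProjectiveResolutions C]

lemma ExactOnProjectives.derivedδ_naturality (h : ExactOnProjectives α β w) (n : ℕ) {X Y : C}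
    (f : X ⟶ Y) (P : ProjectiveResolution X) (Q : ProjectiveResolution Y) :
    (H.leftDerived (n + 1)).map f ≫ (Q.isoLeftDerivedObj H (n + 1)).hom ≫ h.connecting Q n ≫
        (Q.isoLeftDerivedObj F n).inv =
      ((P.isoLeftDerivedObj H (n + 1)).hom ≫ h.connecting P n ≫ (P.isoLeftDerivedObj F n).inv) ≫
        (F.leftDerived n).map f := by
  have hφ : (ProjectiveResolution.lift f P Q).f 0 ≫ Q.π.f 0 = P.π.f 0 ≫ f :=
    ProjectiveResolution.lift_commutes_zero f P Q
  rw [Category.assoc, Category.assoc,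
    ProjectiveResolution.isoLeftDerivedObj_inv_naturality f P Q _ hφ F n,
    ProjectiveResolution.isoLeftDerivedObj_hom_naturality_assoc f P Q _ hφ H (n + 1)]
  refine congrArg ((P.isoLeftDerivedObj H (n + 1)).hom ≫ ·) ?_
  exact (Category.assoc _ _ _).symm.trans ((congrArg (· ≫ (Q.isoLeftDerivedObj F n).inv)
    (h.connecting_naturality P Q (ProjectiveResolution.lift f P Q) n)).trans (Category.assoc _ _ _))

/-- The connecting map of left derived functors. -/
def ExactOnProjectives.derivedδ (h : ExactOnProjectives α β w) (n : ℕ) :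
    H.leftDerived (n + 1) ⟶ F.leftDerived n where
  app X := ((projectiveResolution X).isoLeftDerivedObj H (n + 1)).hom ≫
    h.connecting (projectiveResolution X) n ≫ ((projectiveResolution X).isoLeftDerivedObj F n).inv
  naturality {X Y} f :=
    h.derivedδ_naturality n f (projectiveResolution X) (projectiveResolution Y)

/-- Both neighbours of the connecting map in the long exact sequence are higher derived functors of
`G`. -/
lemma ExactOnProjectives.isIso_derivedδ (h : ExactOnProjectives α β w) (n : ℕ)
    (hG : ∀ X n, IsZero ((G.leftDerived (n + 1)).obj X)) :
    IsIso (h.derivedδ (n + 1)) := by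
  rw [NatTrans.isIso_iff_isIso_app]
  intro X
  have : IsIso (h.connecting (projectiveResolution X) (n + 1)) :=
    (h.shortExact (projectiveResolution X)).isIso_δ _ _ _
      ((hG X (n + 1)).of_iso ((projectiveResolution X).isoLeftDerivedObj G (n + 1 + 1)).symm)
      ((hG X n).of_iso ((projectiveResolution X).isoLeftDerivedObj G (n + 1)).symm)
  exact inferInstanceAs (IsIso (_ ≫ _ ≫ _))

lemma ExactOnProjectives.mono_derivedδ (h : ExactOnProjectives α β w)
    (hG : ∀ X n, IsZero ((G.leftDerived (n + 1)).obj X)) (X : C) :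
    Mono ((h.derivedδ 0).app X) := by
  have : Mono (h.connecting (projectiveResolution X) 0) :=
    (h.shortExact (projectiveResolution X)).mono_δ _ _ _
      ((hG X 0).of_iso ((projectiveResolution X).isoLeftDerivedObj G 1).symm)
  exact inferInstanceAs (Mono (_ ≫ _ ≫ _))

lemma ExactOnProjectives.derivedδ_comp_app (h : ExactOnProjectives α β w) (n : ℕ) (X : C) :
    (h.derivedδ n).app X ≫ (NatTrans.leftDerived α n).app X = 0 := by
  let P := projectiveResolution X
  rw [ProjectiveResolution.leftDerived_app_eq α P n]
  change (_ ≫ _ ≫ _) ≫ _ = 0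
  rw [Category.assoc, Category.assoc, Iso.inv_hom_id_assoc]
  have := h.connecting_comp P n
  rw [← Category.assoc (h.connecting P n), this, zero_comp, comp_zero]

lemma ExactOnProjectives.exact_derivedδ (h : ExactOnProjectives α β w) (n : ℕ) (X : C) :
    (ShortComplex.mk _ _ (h.derivedδ_comp_app n X)).Exact := by
  let P := projectiveResolution X
  refine ShortComplex.exact_of_iso ?_ (h.exact_connecting P n)
  refine ShortComplex.isoMk (P.isoLeftDerivedObj H (n + 1)).symm (P.isoLeftDerivedObj F n).symm
    (P.isoLeftDerivedObj G n).symm ?_ ?_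
  · change (P.isoLeftDerivedObj H (n + 1)).inv ≫ ((P.isoLeftDerivedObj H (n + 1)).hom ≫ _ ≫ _) = _
    rw [Iso.inv_hom_id_assoc]
    rfl
  · have := ProjectiveResolution.leftDerived_app_eq α P n
    refine (congrArg ((P.isoLeftDerivedObj F n).inv ≫ ·) this).trans ?_
    exact Iso.inv_hom_id_assoc _ _

end DerivedSequence

end

end Adelic

namespace Adelic

noncomputable section

/-! ### Ext as a functor of the second variable. -/

section Ext

variable (R : Type u) [CommRing R]

/-- The functor `X ↦ Hom(X, M)`, with values in the opposite category. -/
abbrev homTo (M : ModuleCat.{u} R) : ModuleCat.{u} R ⥤ (ModuleCat.{u} R)ᵒᵖ :=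
  ((linearYoneda R (ModuleCat.{u} R)).obj M).rightOp

/-- The map of functors `Hom(-, N) ⟶ Hom(-, M)`, in the opposite category, of a map `M ⟶ N`. -/
abbrev homToMap {M N : ModuleCat.{u} R} (g : M ⟶ N) : homTo R N ⟶ homTo R M :=
  NatTrans.rightOp ((linearYoneda R (ModuleCat.{u} R)).map g)

/-- Hom turns colimits in its first variable into limits. Right exactness is needed to identify the
zeroth left derived functor with `homTo R M` itself. -/
instance (M : ModuleCat.{u} R) : PreservesFiniteColimits (homTo R M) := by
  have h : PreservesLimits ((linearYoneda R (ModuleCat.{u} R)).obj M ⋙ forget _) :=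
    inferInstanceAs (PreservesLimits (yoneda.obj M))
  have : PreservesLimits ((linearYoneda R (ModuleCat.{u} R)).obj M) :=
    preservesLimits_of_reflects_of_preserves _ (forget _)
  exact preservesFiniteColimits_rightOp _

variable {R}

lemma comp_f_comp_g (S : ShortComplex (ModuleCat.{u} R)) {X : ModuleCat.{u} R} (φ : X ⟶ S.X₁) :
    (φ ≫ S.f) ≫ S.g = 0 := by
  rw [Category.assoc, S.zero, comp_zero]

lemma homToMap_comp (S : ShortComplex (ModuleCat.{u} R)) (X : ModuleCat.{u} R) :
    (homToMap R S.g).app X ≫ (homToMap R S.f).app X = 0 := by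
  apply Quiver.Hom.unop_inj
  ext φ : 2
  exact comp_f_comp_g S φ

/-- Hom out of a projective module is exact; passage to the opposite category reverses the sequence,
so `S.g` comes before `S.f`. -/
lemma exactOnProjectives_homToMap (S : ShortComplex (ModuleCat.{u} R)) (hS : S.ShortExact) :
    ExactOnProjectives (homToMap R S.g) (homToMap R S.f) (homToMap_comp S) := by
  intro P hP
  have := hS.mono_f
  have := hS.epi_g
  let T : ShortComplex (ModuleCat.{u} R) :=
    ShortComplex.mk (((linearYoneda R (ModuleCat.{u} R)).map S.f).app (Opposite.op P))
      (((linearYoneda R (ModuleCat.{u} R)).map S.g).app (Opposite.op P)) (by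
        ext φ : 2
        exact comp_f_comp_g S φ)
  have hT : T.ShortExact :=
    { exact := by
        rw [ShortComplex.moduleCat_exact_iff]
        intro (φ : P ⟶ S.X₂) (hφ : φ ≫ S.g = 0)
        exact ⟨hS.exact.lift φ hφ, hS.exact.lift_f φ hφ⟩
      mono_f := by
        rw [ModuleCat.mono_iff_injective]
        intro (φ : P ⟶ S.X₁) (φ' : P ⟶ S.X₁) (h : φ ≫ S.f = φ' ≫ S.f)
        exact (cancel_mono S.f).1 h
      epi_g := by
        rw [ModuleCat.epi_iff_surjective]
        intro (φ : P ⟶ S.X₃)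
        exact ⟨Projective.factorThru φ S.g, Projective.factorThru_comp φ S.g⟩ }
  exact hT.op

/-- A positive-degree cocycle is a map to `E` that vanishes on boundaries; by exactness of the
resolution and injectivity of `E` it factors through the differential. -/
lemma isZero_leftDerived_homTo (E : ModuleCat.{u} R) (hE : Injective E) (X : ModuleCat.{u} R)
    (n : ℕ) : IsZero (((homTo R E).leftDerived (n + 1)).obj X) := by
  let P := projectiveResolution X
  suffices h : IsZero (((Ext R (ModuleCat.{u} R) (n + 1)).obj (Opposite.op X)).obj E) from h.op
  refine IsZero.of_iso ?_ (P.isoExt (n + 1) E)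
  rw [← HomologicalComplex.exactAt_iff_isZero_homology,
    HomologicalComplex.exactAt_iff' _ n (n + 1) (n + 2) (by simp) (by simp),
    ShortComplex.moduleCat_exact_iff]
  intro (φ : P.complex.X (n + 1) ⟶ E) (hφ : P.complex.d (n + 2) (n + 1) ≫ φ = 0)
  exact ⟨(P.exact_succ n).descToInjective φ hφ, (P.exact_succ n).comp_descToInjective φ hφ⟩

end Ext

end

end Adelic

namespace Adelic

noncomputable section

/-! ### Naturality of the zeroth derived functor in the functor. -/

section ZeroDerived

universe v₁ v₂ u₁ u₂

variable {C : Type u₁} [Category.{v₁} C] [Abelian C] {D : Type u₂} [Category.{v₂} D] [Abelian D]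
variable {F G : C ⥤ D} [F.Additive] [G.Additive] (α : F ⟶ G)

lemma opcyclesMap_fromLeftDerivedZero' {X : C} (P : ProjectiveResolution X) :
    HomologicalComplex.opcyclesMap ((NatTrans.mapHomologicalComplex α _).app P.complex) 0 ≫
      P.fromLeftDerivedZero' G = P.fromLeftDerivedZero' F ≫ α.app X := by
  rw [← cancel_epi (HomologicalComplex.pOpcycles _ _), HomologicalComplex.p_opcyclesMap_assoc,
    P.pOpcycles_comp_fromLeftDerivedZero', P.pOpcycles_comp_fromLeftDerivedZero'_assoc]
  exact (α.naturality (P.π.f 0)).symm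

variable [HasProjectiveResolutions C]

lemma leftDerived_fromLeftDerivedZero :
    NatTrans.leftDerived α 0 ≫ G.fromLeftDerivedZero = F.fromLeftDerivedZero ≫ α := by
  ext X
  let P := projectiveResolution X
  rw [NatTrans.comp_app, NatTrans.comp_app, P.fromLeftDerivedZero_eq G, P.fromLeftDerivedZero_eq F,
    P.leftDerived_app_eq α 0]
  simp only [Category.assoc, Iso.inv_hom_id_assoc]
  refine congrArg ((P.isoLeftDerivedObj F 0).hom ≫ ·) ?_
  have h : HomologicalComplex.homologyMap ((NatTrans.mapHomologicalComplex α _).app P.complex) 0 ≫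
      HomologicalComplex.homologyι ((G.mapHomologicalComplex _).obj P.complex) 0 ≫
        P.fromLeftDerivedZero' G =
      (HomologicalComplex.homologyι ((F.mapHomologicalComplex _).obj P.complex) 0 ≫
        P.fromLeftDerivedZero' F) ≫ α.app X := by
    rw [Category.assoc, ← opcyclesMap_fromLeftDerivedZero' α P,
      HomologicalComplex.homologyι_naturality_assoc]
  exact h

end ZeroDerived

/-! ### Ext in degree zero as Hom. -/

section ExtZero

variable {R : Type u} [CommRing R]

/-- The isomorphism of `Ext^0(X, M)` with `Hom(X, M)`. -/
def extZeroEquiv (X M : ModuleCat.{u} R) :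
    ((Ext R (ModuleCat.{u} R) 0).obj (Opposite.op X)).obj M ≃ₗ[R] (X ⟶ M) :=
  (show ((Ext R (ModuleCat.{u} R) 0).obj (Opposite.op X)).obj M ≅ ModuleCat.of R (X ⟶ M) from
    ((homTo R M).leftDerivedZeroIsoSelf.app X).unop.symm).toLinearEquiv

lemma extZeroEquiv_map {X M N : ModuleCat.{u} R} (g : M ⟶ N)
    (e : ((Ext R (ModuleCat.{u} R) 0).obj (Opposite.op X)).obj M) :
    extZeroEquiv X N ((((Ext R (ModuleCat.{u} R) 0).obj (Opposite.op X)).map g).hom e) =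
      extZeroEquiv X M e ≫ g := by
  obtain ⟨φ, rfl⟩ := (extZeroEquiv X M).symm.surjective e
  rw [LinearEquiv.apply_symm_apply, ← LinearEquiv.eq_symm_apply]
  have h := congrArg (fun z => (z.app X).unop.hom φ)
    (leftDerived_fromLeftDerivedZero (homToMap R g))
  exact h

lemma extZeroEquiv_map_left {X Y M : ModuleCat.{u} R} (f : Y ⟶ X)
    (e : ((Ext R (ModuleCat.{u} R) 0).obj (Opposite.op X)).obj M) :
    extZeroEquiv Y M ((((Ext R (ModuleCat.{u} R) 0).map f.op).app M).hom e) =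
      f ≫ extZeroEquiv X M e := by
  obtain ⟨φ, rfl⟩ := (extZeroEquiv X M).symm.surjective e
  rw [LinearEquiv.apply_symm_apply, ← LinearEquiv.eq_symm_apply]
  have h := congrArg (fun z => z.unop.hom φ) ((homTo R M).fromLeftDerivedZero.naturality f)
  exact h

end ExtZero

end

end Adelic

namespace Adelic

noncomputable section

/-! ### Cokernels and colimits. -/

section Colim

universe v₁ u₁

variable {J : Type} [SmallCategory J] {V : Type u₁} [Category.{v₁} V] [Abelian V]

lemma nonempty_isColimit_of_exact {A B Q : J ⥤ V} (a : A ⟶ B) (π : B ⟶ Q)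
    (h : ∀ j, a.app j ≫ π.app j = 0) (hπ : ∀ j, Epi (π.app j))
    (he : ∀ j, (ShortComplex.mk (a.app j) (π.app j) (h j)).Exact) :
    Nonempty (IsColimit (CokernelCofork.ofπ (f := a) π (by ext j; exact h j))) := by
  have key : ∀ {T : J ⥤ V} (t : B ⟶ T) (_ : a ≫ t = 0) (j : J), a.app j ≫ t.app j = 0 :=
    fun t ht j => congrArg (fun z => z.app j) ht
  have fac : ∀ {T : J ⥤ V} (t : B ⟶ T) (ht : a ≫ t = 0) (j : J),
      π.app j ≫ (he j).desc (t.app j) (key t ht j) = t.app j :=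
    fun t ht j => (he j).g_desc (t.app j) (key t ht j)
  refine ⟨CokernelCofork.IsColimit.ofπ _ _ (fun {T} t ht =>
    { app := fun j => (he j).desc (t.app j) (key t ht j)
      naturality := fun j k f => ?_ }) ?_ ?_⟩
  · rw [← cancel_epi (π.app j), ← Category.assoc, ← π.naturality, Category.assoc, fac t ht,
      ← Category.assoc, fac t ht, t.naturality]
  · intro T t ht
    ext j
    exact fac t ht j
  · intro T t ht b hb
    ext j
    rw [← cancel_epi (π.app j), fac t ht, ← hb]
    rfl

/-- Cokernels of diagrams are pointwise, and taking colimits, a left adjoint, preserves them. -/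
lemma nonempty_colimit_iso_cokernel [HasColimitsOfShape J V] {A B Q : J ⥤ V} (a : A ⟶ B)
    (π : B ⟶ Q) (h : ∀ j, a.app j ≫ π.app j = 0) (hπ : ∀ j, Epi (π.app j))
    (he : ∀ j, (ShortComplex.mk (a.app j) (π.app j) (h j)).Exact) :
    Nonempty (colimit Q ≅ cokernel (colimMap a)) := by
  obtain ⟨hc⟩ := nonempty_isColimit_of_exact a π h hπ he
  have : (colim : (J ⥤ V) ⥤ V).PreservesZeroMorphisms :=
    Functor.preservesZeroMorphisms_of_isLeftAdjoint _
  exact ⟨IsColimit.coconePointUniqueUpToIso (CokernelCofork.mapIsColimit _ hc colim)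
    (colimit.isColimit (parallelPair (colimMap a) 0))⟩

end Colim

/-! ### Dimension shifting for colimits of Ext. -/

section ExtColimit

variable {R : Type u} [CommRing R] {J : Type} [SmallCategory J]
  (X : J ⥤ (ModuleCat.{u} R)ᵒᵖ)

/-- The diagram of the modules `Ext^n(X_j, M)`. -/
abbrev extDiagram (n : ℕ) (M : ModuleCat.{u} R) : J ⥤ ModuleCat.{u} R :=
  (X ⋙ Ext R (ModuleCat.{u} R) n) ⋙ (evaluation _ _).obj M

/-- The map of diagrams induced by a map of modules. -/
abbrev extDiagramMap (n : ℕ) {M N : ModuleCat.{u} R} (g : M ⟶ N) :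
    extDiagram X n M ⟶ extDiagram X n N :=
  Functor.whiskerLeft _ ((evaluation _ _).map g)

variable {S : ShortComplex (ModuleCat.{u} R)} (hS : S.ShortExact)

/-- The connecting map of `Ext`. -/
def extDiagramδ (n : ℕ) : extDiagram X n S.X₃ ⟶ extDiagram X (n + 1) S.X₁ :=
  Functor.whiskerLeft X (NatTrans.leftOp ((exactOnProjectives_homToMap S hS).derivedδ n))

include hS in
lemma nonempty_extDiagram_iso (hE : Injective S.X₂) (n : ℕ) :
    Nonempty (extDiagram X (n + 2) S.X₁ ≅ extDiagram X (n + 1) S.X₃) := by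
  have h := exactOnProjectives_homToMap S hS
  have := h.isIso_derivedδ n (isZero_leftDerived_homTo S.X₂ hE)
  have : IsIso (extDiagramδ X hS (n + 1)) := (NatTrans.isIso_iff_isIso_app _).2 fun j =>
    inferInstanceAs (IsIso ((h.derivedδ (n + 1)).app (X.obj j).unop).unop)
  exact ⟨(asIso (extDiagramδ X hS (n + 1))).symm⟩

include hS in
lemma nonempty_colimit_extDiagram_one_iso (hE : Injective S.X₂) :
    Nonempty (colimit (extDiagram X 1 S.X₁) ≅ cokernel (colimMap (extDiagramMap X 0 S.g))) := by
  have hδ := exactOnProjectives_homToMap S hS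
  refine nonempty_colimit_iso_cokernel (extDiagramMap X 0 S.g) (extDiagramδ X hS 0) ?_ ?_ ?_
  · intro j
    exact congrArg Quiver.Hom.unop (hδ.derivedδ_comp_app 0 (X.obj j).unop)
  · intro j
    have := hδ.mono_derivedδ (isZero_leftDerived_homTo S.X₂ hE) (X.obj j).unop
    exact inferInstanceAs (Epi ((hδ.derivedδ 0).app (X.obj j).unop).unop)
  · intro j
    exact (hδ.exact_derivedδ 0 (X.obj j).unop).unop

/-- Dimension shifting for Ext is made of natural isomorphisms and one cokernel, and colimits of
every shape preserve both. -/
lemma dimensionShift_colimit_ext :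
    DimensionShift fun n => colimit (X ⋙ Ext R (ModuleCat.{u} R) n) where
  one S hS hE := by
    obtain ⟨e⟩ := nonempty_colimit_extDiagram_one_iso X hS hE
    exact ⟨colimitObjIsoColimitCompEvaluation _ _ ≪≫ e ≪≫ (cokernel.mapIso _ _
      (colimitObjIsoColimitCompEvaluation _ _) (colimitObjIsoColimitCompEvaluation _ _)
      (colimit_map_colimitObjIsoColimitCompEvaluation_hom
        (X ⋙ Ext R (ModuleCat.{u} R) 0) S.g)).symm⟩
  succ S hS hE n := by
    obtain ⟨e⟩ := nonempty_extDiagram_iso X hS hE n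
    exact ⟨colimitObjIsoColimitCompEvaluation _ _ ≪≫ HasColimit.isoOfNatIso e ≪≫
      (colimitObjIsoColimitCompEvaluation _ _).symm⟩

end ExtColimit

/-! ### Local cohomology in degree zero and the comparison. -/

section LocalCohomology

variable {R : Type u} [CommRing R] (I : Ideal R)

lemma dimensionShift_localCohomology : DimensionShift (localCohomology I) :=
  dimensionShift_colimit_ext _

/-- The map `Ext^0(R/J, M) ⟶ M` that corresponds to the evaluation at `1`. -/
def evalOne (J : Ideal R) (M : ModuleCat.{u} R) :
    ((Ext R (ModuleCat.{u} R) 0).obj (Opposite.op (ModuleCat.of R (R ⧸ J)))).obj M →ₗ[R] M where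
  toFun e := (extZeroEquiv (ModuleCat.of R (R ⧸ J)) M e).hom (1 : R ⧸ J)
  map_add' e e' := by rw [map_add]; rfl
  map_smul' r e := by rw [map_smul]; rfl

lemma evalOne_map {J : Ideal R} {M N : ModuleCat.{u} R} (g : M ⟶ N)
    (e : ((Ext R (ModuleCat.{u} R) 0).obj (Opposite.op (ModuleCat.of R (R ⧸ J)))).obj M) :
    evalOne J N ((((Ext R (ModuleCat.{u} R) 0).obj (Opposite.op
      (ModuleCat.of R (R ⧸ J)))).map g).hom e) = g.hom (evalOne J M e) :=
  congrArg (fun φ : ModuleCat.of R (R ⧸ J) ⟶ N => φ.hom (1 : R ⧸ J)) (extZeroEquiv_map g e)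

lemma evalOne_map_left {J K : Ideal R} {M : ModuleCat.{u} R}
    (f : ModuleCat.of R (R ⧸ K) ⟶ ModuleCat.of R (R ⧸ J)) (hf : f.hom (1 : R ⧸ K) = (1 : R ⧸ J))
    (e : ((Ext R (ModuleCat.{u} R) 0).obj (Opposite.op (ModuleCat.of R (R ⧸ J)))).obj M) :
    evalOne K M ((((Ext R (ModuleCat.{u} R) 0).map f.op).app M).hom e) = evalOne J M e :=
  (congrArg (fun φ : ModuleCat.of R (R ⧸ K) ⟶ M => φ.hom (1 : R ⧸ K))
    (extZeroEquiv_map_left f e)).trans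
      (congrArg (extZeroEquiv (ModuleCat.of R (R ⧸ J)) M e).hom hf)

lemma evalOne_injective (J : Ideal R) (M : ModuleCat.{u} R) :
    Function.Injective (evalOne J M) := by
  intro e e' h
  apply (extZeroEquiv (ModuleCat.of R (R ⧸ J)) M).injective
  ext : 1
  exact Submodule.linearMap_qext _ (LinearMap.ext_ring h)

lemma exists_evalOne_eq {J : Ideal R} {M : ModuleCat.{u} R} {m : M} (h : ∀ r ∈ J, r • m = 0) :
    ∃ e, evalOne J M e = m := by
  let φ : ModuleCat.of R (R ⧸ J) ⟶ M :=
    ModuleCat.ofHom (J.liftQ (LinearMap.toSpanSingleton R M m) h)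
  refine ⟨(extZeroEquiv _ M).symm φ, ?_⟩
  change (extZeroEquiv _ M ((extZeroEquiv _ M).symm φ)).hom (1 : R ⧸ J) = m
  rw [LinearEquiv.apply_symm_apply]
  exact one_smul R m

lemma smul_evalOne {J : Ideal R} {M : ModuleCat.{u} R} (e) {r : R} (hr : r ∈ J) :
    r • evalOne J M e = 0 := by
  have : (r • 1 : R ⧸ J) = 0 := by
    rw [Algebra.smul_def, mul_one]
    exact Ideal.Quotient.eq_zero_iff_mem.2 hr
  exact (map_smul (extZeroEquiv (ModuleCat.of R (R ⧸ J)) M e).hom r (1 : R ⧸ J)).symm.trans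
    ((congrArg _ this).trans (map_zero _))

/-- The maps `Ext^0(R/I^t, M) ⟶ M` that correspond to the evaluation at `1`. -/
def extZeroEval (t : ℕᵒᵖᵒᵖ) :
    (localCohomology.diagram (localCohomology.idealPowersDiagram I) 0).obj t ⟶
      𝟭 (ModuleCat.{u} R) where
  app M := ModuleCat.ofHom (evalOne (I ^ t.unop.unop) M)
  naturality {M N} g := by
    ext e
    exact evalOne_map g e

/-- The map from the local cohomology in degree `0` to the identity. -/
def localCohomologyZeroι : localCohomology I 0 ⟶ 𝟭 (ModuleCat.{u} R) :=
  colimit.desc (localCohomology.diagram (localCohomology.idealPowersDiagram I) 0)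
    { pt := 𝟭 _
      ι :=
        { app := fun t => extZeroEval I t
          naturality := fun t t' f => by
            refine NatTrans.ext (funext fun M => ?_)
            ext e
            -- The transition maps between the quotients of `R` preserve `1`.
            exact evalOne_map_left ((localCohomology.ringModIdeals
              (localCohomology.idealPowersDiagram I)).map f.unop) rfl e } }

variable {I}

/-- The map from `Ext^0(R/I^t, M)` to the local cohomology. -/
def toLocalCohomologyZero (t : ℕᵒᵖᵒᵖ) :
    (localCohomology.diagram (localCohomology.idealPowersDiagram I) 0).obj t ⟶
      localCohomology I 0 :=
  colimit.ι (localCohomology.diagram (localCohomology.idealPowersDiagram I) 0) t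

lemma toLocalCohomologyZero_ι (t : ℕᵒᵖᵒᵖ) :
    toLocalCohomologyZero t ≫ localCohomologyZeroι I = extZeroEval I t :=
  colimit.ι_desc _ _

/-- Filtered colimits of modules are formed on the underlying sets, so every element appears at a
finite stage. -/
lemma exists_toLocalCohomologyZero {M : ModuleCat.{u} R} (z : (localCohomology I 0).obj M) :
    ∃ t e, ((toLocalCohomologyZero t).app M).hom e = z := by
  have h := isColimitOfPreserves ((evaluation (ModuleCat.{u} R) (ModuleCat.{u} R)).obj M)
    (colimit.isColimit (localCohomology.diagram (localCohomology.idealPowersDiagram I) 0))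
  have : PreservesFilteredColimitsOfSize.{0, 0} (forget (ModuleCat.{u} R)) :=
    preservesFilteredColimitsOfSize_shrink.{0, u, 0, u} _
  exact Concrete.isColimit_exists_rep _ h z

lemma localCohomologyZeroι_injective (M : ModuleCat.{u} R) :
    Function.Injective ((localCohomologyZeroι I).app M).hom := by
  rw [injective_iff_map_eq_zero]
  intro z hz
  obtain ⟨t, e, rfl⟩ := exists_toLocalCohomologyZero z
  have h : ((extZeroEval I t).app M).hom e = 0 :=
    (congrArg (fun φ => (φ.app M).hom e) (toLocalCohomologyZero_ι t)).symm.trans hz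
  exact (congrArg _ ((map_eq_zero_iff _ (evalOne_injective _ M)).1 h)).trans (map_zero _)

/-- At stage `t`, evaluation at `1` has as image the elements killed by `I ^ t`; over a Noetherian
ring their union is the torsion submodule. -/
lemma range_localCohomologyZeroι [IsNoetherianRing R] (M : ModuleCat.{u} R) :
    LinearMap.range ((localCohomologyZeroι I).app M).hom = torsionSubmodule I M := by
  refine Submodule.ext fun (m : M) => ?_
  refine Iff.trans ?_ (mem_torsionSubmodule_iff_exists_pow (I := I) (N := M)).symm
  constructor
  · rintro ⟨z, rfl⟩
    obtain ⟨t, e, rfl⟩ := exists_toLocalCohomologyZero z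
    refine ⟨t.unop.unop, fun r hr => ?_⟩
    have h := congrArg (fun φ => (φ.app M).hom e) (toLocalCohomologyZero_ι (I := I) t)
    exact (congrArg (r • ·) h).trans (smul_evalOne e hr)
  · rintro ⟨t, ht⟩
    obtain ⟨e, he⟩ := exists_evalOne_eq ht
    let s : ℕᵒᵖᵒᵖ := Opposite.op (Opposite.op t)
    have h : ((localCohomologyZeroι I).app M).hom (((toLocalCohomologyZero s).app M).hom e) =
        evalOne (I ^ s.unop.unop) M e :=
      congrArg (fun φ => (φ.app M).hom e) (toLocalCohomologyZero_ι (I := I) s)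
    exact ⟨((toLocalCohomologyZero s).app M).hom e, h.trans he⟩

lemma nonempty_homology_chains_iso_localCohomology [IsNoetherianRing R]
    {A : Type u} {x : A → R} {P : Type u} [PartialOrder P] {w : P → Finset A}
    (hw : IsCovering w x) (M : ModuleCat.{u} R) (n : ℕ) :
    Nonempty (((localizationChains w x).obj M).homology n ≅
      (localCohomology (Ideal.span (Set.range x)) n).obj M) := by
  obtain ⟨θ⟩ := nonempty_iso_of_range_eq (chainsHomologyZeroι w x)
    (localCohomologyZeroι (Ideal.span (Set.range x))) chainsHomologyZeroι_injective
    localCohomologyZeroι_injective fun N =>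
      (range_chainsHomologyZeroι hw N).trans (range_localCohomologyZeroι N).symm
  exact (dimensionShift_chains hw).nonempty_iso (dimensionShift_localCohomology _) θ n M

end LocalCohomology

end

end Adelic

/-! ### The theorem. -/

theorem mainTheorem6 {R : Type u} [CommRing R] [IsNoetherianRing R] (M : ModuleCat.{u} R)
    {A : Type u} (x : A → R) :
    (∀ n : ℕ, Nonempty (Adelic.augmentedAdelicCohomology x M n ≅
        (localCohomology (Ideal.span (Set.range x)) n).obj M)) ∧
    (∀ [LinearOrder A] (n : ℕ), Nonempty (Adelic.augmentedAdelicCohomology x M n ≅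
        Adelic.stableKoszulCohomology x M n)) ∧
    (∀ [LinearOrder A] (n : ℕ), Nonempty (Adelic.adelicCohomology x M n ≅
        Adelic.cechCohomology x M n)) ∧
    (∀ {B : Type u} (y : B → R),
      (Ideal.span (Set.range x)).radical = (Ideal.span (Set.range y)).radical →
      ∀ n : ℕ, Nonempty (Adelic.augmentedAdelicCohomology x M n ≅
          Adelic.augmentedAdelicCohomology y M n) ∧
        Nonempty (Adelic.adelicCohomology x M n ≅ Adelic.adelicCohomology y M n)) := by
  refine ⟨fun n => ?_, fun n => ?_, fun n => ?_, fun y h n => ⟨?_, ?_⟩⟩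
  · obtain ⟨e⟩ := Adelic.nonempty_augmentedAdelicCohomology_iso x M n
    obtain ⟨e'⟩ := Adelic.nonempty_homology_chains_iso_localCohomology
      (Adelic.isCovering_flags x) M n
    exact ⟨e ≪≫ e'⟩
  · obtain ⟨e⟩ := Adelic.nonempty_augmentedAdelicCohomology_iso x M n
    obtain ⟨e'⟩ := Adelic.nonempty_homology_chains_iso (Adelic.isCovering_flags x)
      (Adelic.isCovering_vertices x) rfl M n
    obtain ⟨e''⟩ := Adelic.nonempty_stableKoszulCohomology_iso x M n
    exact ⟨e ≪≫ e' ≪≫ e''.symm⟩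
  · obtain ⟨e⟩ := Adelic.nonempty_adelicCohomology_iso x M n
    obtain ⟨e'⟩ := Adelic.nonempty_homology_truncatedChains_iso (Adelic.isCovering_flags x)
      (Adelic.isCovering_vertices x) rfl M n
    obtain ⟨e''⟩ := Adelic.nonempty_cechCohomology_iso x M n
    exact ⟨e ≪≫ e' ≪≫ e''.symm⟩
  · obtain ⟨e⟩ := Adelic.nonempty_augmentedAdelicCohomology_iso x M n
    obtain ⟨e'⟩ := Adelic.nonempty_homology_chains_iso (Adelic.isCovering_flags x)
      (Adelic.isCovering_flags y) h M n
    obtain ⟨e''⟩ := Adelic.nonempty_augmentedAdelicCohomology_iso y M n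
    exact ⟨e ≪≫ e' ≪≫ e''.symm⟩
  · obtain ⟨e⟩ := Adelic.nonempty_adelicCohomology_iso x M n
    obtain ⟨e'⟩ := Adelic.nonempty_homology_truncatedChains_iso (Adelic.isCovering_flags x)
      (Adelic.isCovering_flags y) h M n
    obtain ⟨e''⟩ := Adelic.nonempty_adelicCohomology_iso y M n
    exact ⟨e ≪≫ e' ≪≫ e''.symm⟩
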